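/- Let $k$ be an algebraically closed field and $n\ge 1$. Let $X$ be an algebraic variety over $k$ on which $\mathrm{PGL}_n$ acts freely, with quotient variety $\pi\colon X\to X/\mathrm{PGL}_n$ (so $\pi$ is a principal $\mathrm{PGL}_n$-bundle). Let $P$ be a vector bundle on $X$ of weight $w\in\mathbb Z$: $\mathrm{GL}_n$ acts on $P$, linearly on fibres and lifting the action of $\mathrm{PGL}_n$ on $X$, and $t\in k^*\subset\mathrm{GL}_n$ acts on the fibres as multiplication by $t^w$. Let $0<j<\operatorname{rk}P$, let $\mathrm{Gr}_j(P)\to X$ be the Grassmannian bundle of rank $j$ sub-bundles, with universal sub-bundle $S$ and the induced $\mathrm{GL}_n$-action, and let $\phi\colon \mathrm{Gr}_j(P)/\mathrm{PGL}_n\to X/\mathrm{PGL}_n$ be the induced map. Let $\mathrm{Fr}_j(P)$ and $\mathrm{Fr}^\vee_j(P)$ be the bundles over $\mathrm{Gr}_j(P)$ whose fibres at $x$ are the isomorphisms $e\colon k^j\to S_x$, respectively $e\colon (k^j)^\vee\to S_x$, with the induced $\mathrm{GL}_n$-actions, and with the left $\mathrm{GL}_j$-actions $h\cdot e=e\circ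 h^{-1}$, respectively $h\cdot e=e\circ h^{\vee}$, where $h^\vee(\xi)=\xi\circ h$. If $\mathrm{GL}_m$ acts on a variety $Z$ with quotient variety $Y$, in such a way that the associated bundle of algebras $M_m(k)\times^{\mathrm{GL}_m}Z$ over $Y$ (for the conjugation action on $M_m(k)$) is generically a central simple algebra, let $[Z\to Y]\in\mathrm{Br}(k(Y))$ be the class of its generic fibre. (If scalars act trivially this bundle is $M_m(k)\times^{\mathrm{PGL}_m}Z$.) All quotients are quotients in the sense of fppf sheaves and are assumed to be varieties. Then the action of $\mathrm{PGL}_n$ on $\mathrm{Gr}_j(P)$ is free and $\phi$ is dominant; $\mathrm{Fr}_j(P)/\mathrm{GL}_n$ and $\mathrm{Fr}^\vee_j(P)/\mathrm{GL}_n$ with their induced $\mathrm{GL}_j$-actions have quotient $\mathrm{Gr}_j(P)/\mathrm{PGL}_n$, and for $w\neq 0$ these are free actions of $\mathrm{PGL}_j$; the four generic fibres involved are central simple algebras; and $$[\mathrm{Gr}_j(P)\to\mathrm{Gr}_j(P)/\mathrm{PGL}_n]=\phi^*[X\to X/\mathrm{PGL}_n],$$ $$[\mathrm{Fr}_j(P)/\mathrm{GL}_n\to\mathrm{Gr}_j(P)/\mathrm{PGL}_n]=w\,[\mathrm{Gr}_j(P)\to\mathrm{Gr}_j(P)/\mathrm{PGL}_n],$$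 $$[\mathrm{Fr}^\vee_j(P)/\mathrm{GL}_n\to\mathrm{Gr}_j(P)/\mathrm{PGL}_n]=-w\,[\mathrm{Gr}_j(P)\to\mathrm{Gr}_j(P)/\mathrm{PGL}_n].$$ -/

import Mathlib

open CategoryTheory AlgebraicGeometry Opposite Matrix
open scoped TensorProduct

universe u v w

noncomputable section

namespace TwistedGrassmannian

/-! ### The Brauer group of a field -/

namespace Brauer
section
variable {K : Type u} [Field K]

/-- `A` is a finite-dimensional central simple `K`-algebra. -/
structure IsCSA (A : AlgCat.{v} K) : Prop where
  isCentral : Algebra.IsCentral K A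
  isSimple : IsSimpleRing A
  finDim : FiniteDimensional K A

/-- The Brauer class of a central simple algebra. -/
def classOf (A : AlgCat.{v} K) (h : IsCSA A) : BrauerGroup.{u, v} K :=
  Quotient.mk (Brauer.CSA_Setoid K)
    { toAlgCat := A, isCentral := h.isCentral, isSimple := h.isSimple, fin_dim := h.finDim }

theorem mulLeftRight_surjective (A : Type v) [Ring A] [Algebra K A] [Algebra.IsCentral K A]
    [IsSimpleRing A] [FiniteDimensional K A] :
    Function.Surjective (AlgHom.mulLeftRight K A) := by
  let _ : Module (A ⊗[K] Aᵐᵒᵖ) A := TensorProduct.Algebra.module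
  have smul_def : ∀ (e : A ⊗[K] Aᵐᵒᵖ) (x : A), e • x = AlgHom.mulLeftRight K A e x :=
    fun _ _ => rfl
  have : IsSimpleModule (A ⊗[K] Aᵐᵒᵖ) A := by
    have : Nontrivial (Submodule (A ⊗[K] Aᵐᵒᵖ) A) := ⟨⊥, ⊤, by
      intro h
      have : (1 : A) ∈ (⊥ : Submodule (A ⊗[K] Aᵐᵒᵖ) A) := h ▸ Submodule.mem_top
      exact one_ne_zero ((Submodule.mem_bot _).1 this)⟩
    refine (isSimpleModule_iff _ _).2 ⟨fun N => ?_⟩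
    let I : TwoSidedIdeal A := .mk' (N : Set A) N.zero_mem N.add_mem N.neg_mem
      (fun {a b} hb => by
        have := N.smul_mem (a ⊗ₜ[K] (1 : Aᵐᵒᵖ)) hb
        simpa [smul_def] using this)
      (fun {a b} ha => by
        have := N.smul_mem ((1 : A) ⊗ₜ[K] (MulOpposite.op b)) ha
        simpa [smul_def] using this)
    have hI : ∀ x, x ∈ I ↔ x ∈ N := fun x => TwoSidedIdeal.mem_mk' _ _ _ _ _ _ x
    rcases eq_bot_or_eq_top I with h | h
    · left
      rw [eq_bot_iff]
      intro x hx
      have := (hI x).2 hx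
      rw [h] at this
      simpa using this
    · right
      rw [eq_top_iff]
      intro x _
      refine (hI x).1 ?_
      rw [h]; trivial
  intro g
  have key : ∀ f : Module.End (A ⊗[K] Aᵐᵒᵖ) A, ∃ c : K, ∀ x, f x = c • x := by
    intro f
    have h1 : ∀ x, f x = x * f 1 := fun x => by
      have := f.map_smul (x ⊗ₜ[K] (1 : Aᵐᵒᵖ)) 1
      simpa [smul_def] using this
    have h2 : ∀ x, f x = f 1 * x := fun x => by
      have := f.map_smul ((1 : A) ⊗ₜ[K] (MulOpposite.op x)) 1
      simpa [smul_def] using this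
    have hc : f 1 ∈ Subalgebra.center K A := by
      rw [Subalgebra.mem_center_iff]
      intro b
      rw [← h1, ← h2]
    obtain ⟨c, hc⟩ := (Algebra.IsCentral.mem_center_iff K).1 hc
    exact ⟨c, fun x => by rw [h2, hc, Algebra.smul_def]⟩
  let f : Module.End (Module.End (A ⊗[K] Aᵐᵒᵖ) A) A :=
    { toFun := g
      map_add' := map_add g
      map_smul' := fun φ x => by
        obtain ⟨c, hc⟩ := key φ
        simp [hc] }
  classical
  let b := Module.finBasis K A
  obtain ⟨r, hr⟩ := jacobson_density f (Finset.univ.image b)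
  refine ⟨r, b.ext fun i => ?_⟩
  rw [← smul_def, ← hr (b i) (by simp)]
  rfl

theorem isSimpleRing_tensor (A : Type v) [Ring A] [Algebra K A] [Algebra.IsCentral K A]
    [IsSimpleRing A] [FiniteDimensional K A] (B : Type w) [Ring B] [Algebra K B]
    [IsSimpleRing B] : IsSimpleRing (B ⊗[K] A) := by
  classical
  let b := Module.finBasis K A
  have : Nontrivial (B ⊗[K] A) :=
    TensorProduct.nontrivial_of_linearMap_injective_of_flat_left K B A
      (Algebra.linearMap K A) (FaithfulSMul.algebraMap_injective K A)
  refine ⟨⟨fun I => ?_⟩⟩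
  by_cases hI : I = ⊥
  · exact Or.inl hI
  right
  have stab : ∀ (e : A ⊗[K] Aᵐᵒᵖ) (x : B ⊗[K] A), x ∈ I →
      (AlgHom.mulLeftRight K A e).lTensor B x ∈ I := by
    intro e x hx
    induction e with
    | zero => simp [I.zero_mem]
    | add e f he hf => simpa [LinearMap.lTensor_add] using I.add_mem he hf
    | tmul a a' =>
      have : ∀ x : B ⊗[K] A, (AlgHom.mulLeftRight K A (a ⊗ₜ a')).lTensor B x =
          ((1 : B) ⊗ₜ[K] a) * x * ((1 : B) ⊗ₜ[K] a'.unop) := by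
        intro x
        induction x using TensorProduct.induction_on with
        | zero => simp
        | tmul y z => simp
        | add y z hy hz => rw [map_add, hy, hz, mul_add, add_mul]
      rw [this]
      exact I.mul_mem_right _ _ (I.mul_mem_left _ _ hx)
  let J : TwoSidedIdeal B := .mk' {y | y ⊗ₜ[K] (1 : A) ∈ I}
    (by simp [I.zero_mem])
    (fun {y z} hy hz => by simpa [TensorProduct.add_tmul] using I.add_mem hy hz)
    (fun {y} hy => by simpa [TensorProduct.neg_tmul] using I.neg_mem hy)
    (fun {y z} hz => by simpa using I.mul_mem_left (y ⊗ₜ[K] (1 : A)) _ hz)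
    (fun {y z} hy => by simpa using I.mul_mem_right _ (z ⊗ₜ[K] (1 : A)) hy)
  have hJ : ∀ y, y ∈ J ↔ y ⊗ₜ[K] (1 : A) ∈ I := fun y => TwoSidedIdeal.mem_mk' _ _ _ _ _ _ y
  have hJtop : J = ⊤ := by
    refine (eq_bot_or_eq_top J).resolve_left fun h => hI ?_
    rw [eq_bot_iff]
    intro x hx
    rw [TwoSidedIdeal.mem_bot]
    obtain ⟨c, rfl⟩ := (TensorProduct.equivFinsuppOfBasisRight (M := B) b).symm.surjective x
    have hc : ∀ i, c i = 0 := by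
      intro i
      obtain ⟨e, he⟩ := mulLeftRight_surjective A
        ((LinearMap.toSpanSingleton K A 1).comp (b.coord i))
      have := stab e _ hx
      rw [he, TensorProduct.equivFinsuppOfBasisRight_symm_apply, Finsupp.sum, map_sum] at this
      have h2 : ∀ j ∈ c.support, ((LinearMap.toSpanSingleton K A 1).comp (b.coord i)).lTensor B
          (c j ⊗ₜ[K] b j) = if j = i then c i ⊗ₜ[K] (1 : A) else 0 := by
        intro j _
        by_cases hji : j = i
        · subst hji; simp
        · simp [hji]
      rw [Finset.sum_congr rfl h2, Finset.sum_ite_eq' c.support i] at this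
      by_contra hci
      rw [if_pos (by simpa using hci)] at this
      have := (hJ _).2 this
      rw [h, TwoSidedIdeal.mem_bot] at this
      exact hci this
    have : c = 0 := Finsupp.ext hc
    simp [this]
  rw [eq_top_iff]
  have h1 : (1 : B ⊗[K] A) ∈ I := by
    have : (1 : B) ∈ J := by rw [hJtop]; trivial
    exact (hJ 1).1 this
  intro x _
  simpa using I.mul_mem_left x _ h1

theorem central_tensor (A : Type v) [Ring A] [Algebra K A] [Algebra.IsCentral K A]
    (B : Type w) [Ring B] [Algebra K B] [Nontrivial A] (z : B ⊗[K] A)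
    (hz : ∀ y, Commute y z) : ∃ y ∈ Subalgebra.center K B, z = y ⊗ₜ[K] (1 : A) := by
  have h1 : z ∈ Subalgebra.centralizer K
      ((Algebra.TensorProduct.includeRight : A →ₐ[K] B ⊗[K] A).range : Set (B ⊗[K] A)) :=
    (Subalgebra.mem_centralizer_iff K).2 fun y _ => (hz y)
  rw [Subalgebra.centralizer_range_includeRight_eq_center_tensorProduct] at h1
  obtain ⟨t, rfl⟩ := h1
  have h2 : ∃ y : B, (Algebra.TensorProduct.map (AlgHom.id K B)
      (Subalgebra.center K A).val) t = y ⊗ₜ[K] (1 : A) := by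
    clear hz
    induction t with
    | zero => exact ⟨0, by simp⟩
    | add s t hs ht =>
      obtain ⟨y, hy⟩ := hs
      obtain ⟨y', hy'⟩ := ht
      exact ⟨y + y', by
        rw [TensorProduct.add_tmul, ← hy, ← hy']
        exact map_add _ _ _⟩
    | tmul y c =>
      obtain ⟨c, hc⟩ := c
      obtain ⟨k, rfl⟩ := (Algebra.IsCentral.mem_center_iff K).1 hc
      refine ⟨k • y, ?_⟩
      simp [TensorProduct.smul_tmul, Algebra.algebraMap_eq_smul_one]
  obtain ⟨y, hy⟩ := h2
  refine ⟨y, Subalgebra.mem_center_iff.2 fun x => ?_, hy⟩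
  have := hz (x ⊗ₜ[K] (1 : A))
  change _ * (Algebra.TensorProduct.map (AlgHom.id K B) (Subalgebra.center K A).val) t =
    (Algebra.TensorProduct.map (AlgHom.id K B) (Subalgebra.center K A).val) t * _ at this
  rw [hy] at this
  have h3 : (x * y) ⊗ₜ[K] (1 : A) = (y * x) ⊗ₜ[K] (1 : A) := by simpa using this
  exact Algebra.TensorProduct.includeLeft_injective (S := K)
    (FaithfulSMul.algebraMap_injective K A) h3

/-- Tensor product of central simple algebras. -/
def tensor (A B : CSA.{u, u} K) : CSA.{u, u} K where
  toAlgCat := AlgCat.of K (A ⊗[K] B)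
  isCentral := ⟨fun z hz => by
    obtain ⟨y, hy, rfl⟩ := central_tensor (K := K) B A z
      fun y => Subalgebra.mem_center_iff.1 hz y
    obtain ⟨c, rfl⟩ := (Algebra.IsCentral.mem_center_iff K).1 hy
    exact Algebra.mem_bot.2 ⟨c, by rw [Algebra.TensorProduct.algebraMap_apply]⟩⟩
  isSimple := isSimpleRing_tensor (K := K) B A
  fin_dim := inferInstanceAs (FiniteDimensional K (A ⊗[K] B))

/-- The opposite of a central simple algebra. -/
def opposite (A : CSA.{u, u} K) : CSA.{u, u} K where
  toAlgCat := AlgCat.of K Aᵐᵒᵖ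
  isCentral := inferInstanceAs (Algebra.IsCentral K Aᵐᵒᵖ)
  isSimple := inferInstanceAs (IsSimpleRing Aᵐᵒᵖ)
  fin_dim := inferInstanceAs (FiniteDimensional K Aᵐᵒᵖ)

/-- The ground field as a central simple algebra. -/
def ground (K : Type u) [Field K] : CSA.{u, u} K where
  toAlgCat := AlgCat.of K K
  isCentral := inferInstanceAs (Algebra.IsCentral K K)
  isSimple := inferInstanceAs (IsSimpleRing K)
  fin_dim := inferInstanceAs (FiniteDimensional K K)

/-- Extension of scalars of a central simple algebra along a field homomorphism. -/
def baseChange {L : Type u} [Field L] (f : K →+* L) (A : CSA.{u, u} K) : CSA.{u, u} L :=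
  letI : Algebra K L := f.toAlgebra
  { toAlgCat := AlgCat.of L (L ⊗[K] A)
    isCentral := ⟨fun z hz => by
      obtain ⟨y, hy, rfl⟩ := central_tensor (K := K) A L z
        fun y => Subalgebra.mem_center_iff.1 hz y
      exact Algebra.mem_bot.2 ⟨y, by rw [Algebra.TensorProduct.algebraMap_apply]; rfl⟩⟩
    isSimple := isSimpleRing_tensor (K := K) A L
    fin_dim := inferInstanceAs (FiniteDimensional L (L ⊗[K] A)) }

theorem equiv_of_algEquiv {A B : CSA.{u, u} K} (e : A ≃ₐ[K] B) : IsBrauerEquivalent A B :=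
  ⟨1, 1, one_ne_zero, one_ne_zero, ⟨e.mapMatrix⟩⟩

theorem equiv_of_prod {A B : CSA.{u, u} K} {m n : ℕ} {p q : ℕ} (hm : m ≠ 0) (hn : n ≠ 0)
    (hp : p ≠ 0) (hq : q ≠ 0)
    (e : Matrix (Fin m × Fin n) (Fin m × Fin n) A ≃ₐ[K]
      Matrix (Fin p × Fin q) (Fin p × Fin q) B) : IsBrauerEquivalent A B :=
  ⟨m * n, p * q, mul_ne_zero hm hn, mul_ne_zero hp hq,
    ⟨(Matrix.reindexAlgEquiv K A finProdFinEquiv).symm.trans <|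
      e.trans (Matrix.reindexAlgEquiv K B finProdFinEquiv)⟩⟩

theorem tensor_congr {A A' B B' : CSA.{u, u} K} (h : IsBrauerEquivalent A A')
    (h' : IsBrauerEquivalent B B') : IsBrauerEquivalent (tensor A B) (tensor A' B') := by
  obtain ⟨m, p, hm, hp, ⟨e⟩⟩ := h
  obtain ⟨n, q, hn, hq, ⟨e'⟩⟩ := h'
  exact equiv_of_prod (A := tensor A B) (B := tensor A' B') hm hn hp hq
    ((Matrix.kroneckerTMulAlgEquiv (Fin m) (Fin n) K K A B).symm.trans <|
      (Algebra.TensorProduct.congr e e').trans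
        (Matrix.kroneckerTMulAlgEquiv (Fin p) (Fin q) K K A' B'))

theorem opposite_congr {A B : CSA.{u, u} K} (h : IsBrauerEquivalent A B) :
    IsBrauerEquivalent (opposite A) (opposite B) := by
  obtain ⟨m, p, hm, hp, ⟨e⟩⟩ := h
  exact ⟨m, p, hm, hp, ⟨(AlgEquiv.mopMatrix (R := K) (α := A)).trans <|
    (AlgEquiv.op e).trans (AlgEquiv.mopMatrix (R := K) (α := B)).symm⟩⟩

theorem baseChange_congr {L : Type u} [Field L] (f : K →+* L) {A B : CSA.{u, u} K}
    (h : IsBrauerEquivalent A B) : IsBrauerEquivalent (baseChange f A) (baseChange f B) := by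
  let _ : Algebra K L := f.toAlgebra
  obtain ⟨m, p, hm, hp, ⟨e⟩⟩ := h
  exact equiv_of_prod (A := baseChange f A) (B := baseChange f B) one_ne_zero hm one_ne_zero hp
    ((Matrix.kroneckerTMulAlgEquiv (Fin 1) (Fin m) K L L A).symm.trans <|
      (Algebra.TensorProduct.congr (AlgEquiv.refl (R := L)) e).trans
        (Matrix.kroneckerTMulAlgEquiv (Fin 1) (Fin p) K L L B))

theorem opposite_tensor (A : CSA.{u, u} K) :
    IsBrauerEquivalent (tensor (opposite A) A) (ground K) := by
  have hs := mulLeftRight_surjective (K := K) A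
  have := isSimpleRing_tensor (K := K) Aᵐᵒᵖ A
  have hi : Function.Injective (AlgHom.mulLeftRight K A) :=
    RingHom.injective (AlgHom.mulLeftRight K A).toRingHom
  have hd : Module.finrank K A ≠ 0 := Module.finrank_pos.ne'
  let e : (Aᵐᵒᵖ ⊗[K] A) ≃ₐ[K] Matrix (Fin (Module.finrank K A)) (Fin (Module.finrank K A)) K :=
    (Algebra.TensorProduct.comm K Aᵐᵒᵖ A).trans <|
      (AlgEquiv.ofBijective _ ⟨hi, hs⟩).trans (algEquivMatrix (Module.finBasis K A))
  exact ⟨1, 1 * Module.finrank K A, one_ne_zero, by simpa using hd,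
    ⟨(e.mapMatrix (m := Fin 1)).trans <| (Matrix.compAlgEquiv _ _ K K).trans <|
      Matrix.reindexAlgEquiv K K finProdFinEquiv⟩⟩

/-- Addition in the Brauer group is induced by the tensor product. -/
instance : Add (BrauerGroup.{u, u} K) :=
  ⟨Quotient.map₂ tensor fun _ _ h _ _ h' => tensor_congr h h'⟩

/-- The negative of a Brauer class is the class of the opposite algebra. -/
instance : Neg (BrauerGroup.{u, u} K) :=
  ⟨Quotient.map opposite fun _ _ h => opposite_congr h⟩

/-- The zero Brauer class is the class of `K`. -/
instance : Zero (BrauerGroup.{u, u} K) := ⟨Quotient.mk (Brauer.CSA_Setoid K) (ground K)⟩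

/-- The Brauer group of `K`, written additively. -/
instance : AddCommGroup (BrauerGroup.{u, u} K) where
  add_assoc := by
    rintro ⟨A⟩ ⟨B⟩ ⟨C⟩
    exact Quotient.sound (equiv_of_algEquiv (A := tensor (tensor A B) C)
      (B := tensor A (tensor B C)) (Algebra.TensorProduct.assoc K K K A B C))
  zero_add := by
    rintro ⟨A⟩
    exact Quotient.sound (equiv_of_algEquiv (A := tensor (ground K) A)
      (B := A) (Algebra.TensorProduct.lid K A))
  add_zero := by
    rintro ⟨A⟩
    exact Quotient.sound (equiv_of_algEquiv (A := tensor A (ground K))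
      (B := A) (Algebra.TensorProduct.rid K K A))
  add_comm := by
    rintro ⟨A⟩ ⟨B⟩
    exact Quotient.sound (equiv_of_algEquiv (A := tensor A B)
      (B := tensor B A) (Algebra.TensorProduct.comm K A B))
  neg_add_cancel := by
    rintro ⟨A⟩
    exact Quotient.sound (opposite_tensor A)
  nsmul := nsmulRec
  zsmul := zsmulRec

/-- The pullback of Brauer classes along a field homomorphism. -/
def pullback {L : Type u} [Field L] (f : K →+* L) : BrauerGroup.{u, u} K → BrauerGroup.{u, u} L :=
  Quotient.map (baseChange f) fun _ _ h => baseChange_congr f h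
end
end Brauer

/-! ### Changes of frames -/

theorem linearIndependent_change {R M : Type*} [CommRing R] [AddCommGroup M] [Module R M] {j : ℕ}
    (g : GL (Fin j) R) {v : Fin j → M} (hv : LinearIndependent R v) :
    LinearIndependent R fun l => ∑ m, g.1 l m • v m := by
  rw [Fintype.linearIndependent_iff] at hv ⊢
  intro c hc
  have h1 : ∑ m, (c ᵥ* g.1) m • v m = 0 := by
    rw [← hc]
    simp only [Matrix.vecMul, dotProduct, Finset.smul_sum, Finset.sum_smul, smul_smul]
    exact Finset.sum_comm
  have h2 : c ᵥ* g.1 = 0 := funext (hv _ h1)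
  have h3 : c = 0 := by
    have := congrArg (fun d => d ᵥ* (g⁻¹).1) h2
    simpa only [Matrix.vecMul_vecMul, Units.mul_inv, Matrix.vecMul_one, Matrix.zero_vecMul]
      using this
  exact fun i => congrFun h3 i

theorem change_change {R M : Type*} [CommRing R] [AddCommGroup M] [Module R M] {j : ℕ}
    (g h : Matrix (Fin j) (Fin j) R) (v : Fin j → M) (l : Fin j) :
    ∑ m, (g * h) l m • v m = ∑ m, g l m • ∑ p, h m p • v p := by
  simp only [Matrix.mul_apply, Finset.smul_sum, Finset.sum_smul, smul_smul]
  exact Finset.sum_comm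

theorem one_change {R M : Type*} [CommRing R] [AddCommGroup M] [Module R M] {j : ℕ}
    (v : Fin j → M) (l : Fin j) : ∑ m, (1 : Matrix (Fin j) (Fin j) R) l m • v m = v l := by
  simp [Matrix.one_apply]

theorem span_change_le {R M : Type*} [CommRing R] [AddCommGroup M] [Module R M] {j : ℕ}
    (g : Matrix (Fin j) (Fin j) R) (v : Fin j → M) :
    Submodule.span R (Set.range fun l => ∑ m, g l m • v m) ≤ Submodule.span R (Set.range v) := by
  rw [Submodule.span_le]
  rintro _ ⟨l, rfl⟩
  exact Submodule.sum_mem _ fun m _ => Submodule.smul_mem _ _ (Submodule.subset_span ⟨m, rfl⟩)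

theorem span_change {R M : Type*} [CommRing R] [AddCommGroup M] [Module R M] {j : ℕ}
    (g : GL (Fin j) R) (v : Fin j → M) :
    Submodule.span R (Set.range fun l => ∑ m, g.1 l m • v m) = Submodule.span R (Set.range v) := by
  refine le_antisymm (span_change_le _ _) ?_
  refine le_trans (le_of_eq ?_) (span_change_le (g⁻¹).1 fun l => ∑ m, g.1 l m • v m)
  simp only [← change_change, Units.inv_mul, one_change]

/-- The inverse transpose of an invertible matrix. -/
def invTranspose {R : Type*} [CommRing R] {j : ℕ} (g : GL (Fin j) R) : GL (Fin j) R :=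
  ⟨(g⁻¹).1ᵀ, g.1ᵀ, by rw [← Matrix.transpose_mul, Units.mul_inv, Matrix.transpose_one],
    by rw [← Matrix.transpose_mul, Units.inv_mul, Matrix.transpose_one]⟩

/-! ### Functor-of-points actions of `GL_n` and quotients -/

section Actions
variable {S : Scheme.{u}}

/-- The ring of regular functions of an `S`-scheme `T`. -/
abbrev Fn (T : Over S) : Type u := Γ(T.left, ⊤)

/-- Pullback of functions. -/
def fnMap {T' T : Over S} (f : T' ⟶ T) : Fn T →+* Fn T' := f.left.appTop.hom

theorem fnMap_comp {T'' T' T : Over S} (g : T'' ⟶ T') (f : T' ⟶ T) :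
    fnMap (g ≫ f) = (fnMap g).comp (fnMap f) := rfl

/-- Pullback of `T`-points of `GL_n`. -/
def glMap {n : ℕ} {T' T : Over S} (f : T' ⟶ T) : GL (Fin n) (Fn T) →* GL (Fin n) (Fn T') :=
  Matrix.GeneralLinearGroup.map (fnMap f)

theorem glMap_comp {n : ℕ} {T'' T' T : Over S} (g : T'' ⟶ T') (f : T' ⟶ T)
    (a : GL (Fin n) (Fn T)) : glMap (g ≫ f) a = glMap g (glMap f a) := by
  simp only [glMap, fnMap_comp]
  rfl

/-- The scalar matrix `t` as a `T`-point of `GL_n`. -/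
abbrev scalarPt (n : ℕ) {T : Over S} (t : (Fn T)ˣ) : GL (Fin n) (Fn T) :=
  Matrix.GeneralLinearGroup.scalar (Fin n) t

/-- An action (on the left) of the group functor `GL_n : T ↦ GL_n(𝒪(T))` on a presheaf `F` on
`S`-schemes. -/
structure GLAction (n : ℕ) (F : (Over S)ᵒᵖ ⥤ Type v) where
  act : ∀ {T : Over S}, GL (Fin n) (Fn T) → F.obj (op T) → F.obj (op T)
  one_act : ∀ {T : Over S} (x : F.obj (op T)), act 1 x = x
  mul_act : ∀ {T : Over S} (g h : GL (Fin n) (Fn T)) (x : F.obj (op T)),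
    act (g * h) x = act g (act h x)
  map_act : ∀ {T' T : Over S} (f : T' ⟶ T) (g : GL (Fin n) (Fn T)) (x : F.obj (op T)),
    F.map f.op (act g x) = act (glMap f g) (F.map f.op x)

/-- An action of the group scheme `GL_n` on an `S`-scheme `X`, i.e. an action on the functor of
points of `X`. -/
abbrev GLSchemeAction (n : ℕ) (X : Over S) := GLAction n (yoneda.obj X)

/-- The action on a scheme representing `F` induced by an action on `F`. -/
def GLAction.ofRepresentable {n : ℕ} {F : (Over S)ᵒᵖ ⥤ Type v} {X : Over S}
    (A : GLAction n F) (h : F.RepresentableBy X) : GLSchemeAction n X where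
  act {T} g x := h.homEquiv.symm (A.act g (h.homEquiv (show T ⟶ X from x)))
  one_act x := by simp [A.one_act]
  mul_act g g' x := by simp [A.mul_act]
  map_act {T' T} f g x := by
    change f ≫ h.homEquiv.symm _ = h.homEquiv.symm (A.act _ (h.homEquiv (f ≫ (show T ⟶ X from x))))
    rw [h.comp_homEquiv_symm, A.map_act, h.homEquiv_comp]

theorem GLAction.comp_act {n : ℕ} {X : Over S} (A : GLSchemeAction n X) {T' T : Over S}
    (f : T' ⟶ T) (g : GL (Fin n) (Fn T)) (x : T ⟶ X) :
    f ≫ (show T ⟶ X from A.act g x) = A.act (glMap f g) (f ≫ x) :=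
  A.map_act f g x

/-- Scalar matrices act trivially, and the stabiliser of every `T`-point consists of scalar
matrices. In other words, the action factors through `PGL_n = GL_n / 𝔾_m` and `PGL_n` acts
freely. -/
structure GLAction.IsFreePGL {n : ℕ} {F : (Over S)ᵒᵖ ⥤ Type v} (A : GLAction n F) : Prop where
  scalar_act : ∀ {T : Over S} (t : (Fn T)ˣ) (x : F.obj (op T)), A.act (scalarPt n t) x = x
  stabilizer : ∀ {T : Over S} (g : GL (Fin n) (Fn T)) (x : F.obj (op T)), A.act g x = x →
    ∃ t : (Fn T)ˣ, g = scalarPt n t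

/-- Coverings in the fppf topology consisting of a single morphism. -/
structure IsFppfCover {T' T : Over S} (p : T' ⟶ T) : Prop where
  flat : Flat p.left
  lfp : LocallyOfFinitePresentation p.left
  surj : Surjective p.left

/-- `π : X ⟶ Y` is the quotient of `X` by the action of `GL_n`: `π` is invariant, every point
of `Y` lifts to `X` fppf-locally, and two points of `X` with the same image in `Y` are fppf-locally
conjugate. That is, `Y` represents the quotient of `X` by `GL_n` in the category of fppf sheaves. -/
structure GLAction.IsQuotient {n : ℕ} {X Y : Over S} (A : GLSchemeAction n X) (π : X ⟶ Y) :
    Prop where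
  invariant : ∀ {T : Over S} (g : GL (Fin n) (Fn T)) (x : T ⟶ X),
    (show T ⟶ X from A.act g x) ≫ π = x ≫ π
  lift : ∀ {T : Over S} (y : T ⟶ Y), ∃ (T' : Over S) (p : T' ⟶ T), IsFppfCover p ∧
    ∃ x : T' ⟶ X, x ≫ π = p ≫ y
  transitive : ∀ {T : Over S} (x x' : T ⟶ X), x ≫ π = x' ≫ π →
    ∃ (T' : Over S) (p : T' ⟶ T), IsFppfCover p ∧
      ∃ g : GL (Fin n) (Fn T'), A.act g (p ≫ x) = p ≫ x'

/-- `π` is a principal `PGL_n`-bundle: `PGL_n` acts freely on `X` with quotient `Y`. -/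
structure GLAction.IsPGLBundle {n : ℕ} {X Y : Over S} (A : GLSchemeAction n X) (π : X ⟶ Y) :
    Prop where
  isQuotient : A.IsQuotient π
  isFree : A.IsFreePGL

/-- An algebraic variety over `S` (the spectrum of a field): an integral separated scheme of
finite type. -/
class IsVariety (X : Over S) : Prop where
  isIntegral : IsIntegral X.left
  isSeparated : IsSeparated X.hom
  locallyOfFiniteType : LocallyOfFiniteType X.hom
  quasiCompact : QuasiCompact X.hom

attribute [instance] IsVariety.isIntegral

theorem GLAction.IsQuotient.isDominant {n : ℕ} {X Y : Over S} {A : GLSchemeAction n X}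
    {π : X ⟶ Y} (h : A.IsQuotient π) : IsDominant π.left := by
  obtain ⟨T', p, hp, x, hx⟩ := h.lift (𝟙 Y)
  have := hp.surj
  have h2 : x.left ≫ π.left = p.left := by
    rw [← Over.comp_left, hx]; simp
  have : Surjective (x.left ≫ π.left) := h2 ▸ hp.surj
  have : Surjective π.left := Surjective.of_comp x.left π.left
  infer_instance
end Actions

/-! ### The generic fibre of the associated bundle of matrix algebras -/

section Generic

/-- A dominant morphism of integral schemes maps the generic point to the generic point. -/
theorem specializes_genericPoint {X Y : Scheme.{u}} [IsIntegral X] [IsIntegral Y] (f : X ⟶ Y)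
    [IsDominant f] : f (genericPoint X) ⤳ genericPoint Y := by
  rw [specializes_iff_mem_closure]
  have h : IsGenericPoint (f (genericPoint X)) (closure (f '' Set.univ)) :=
    (genericPoint_spec X).image f.continuous
  rw [h.def, Set.image_univ, f.denseRange.closure_range]
  trivial

/-- The inclusion `k(Y) ⟶ k(X)` of function fields given by a dominant morphism `X ⟶ Y`. -/
def functionFieldMap {X Y : Scheme.{u}} [IsIntegral X] [IsIntegral Y] (f : X ⟶ Y)
    [IsDominant f] : Y.functionField →+* X.functionField :=
  (Y.presheaf.stalkSpecializes (specializes_genericPoint f) ≫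
    f.stalkMap (genericPoint X)).hom

/-- The germ of a function at the generic point. -/
def germ {X : Scheme.{u}} [IsIntegral X] (U : X.Opens) (h : genericPoint X ∈ U) :
    Γ(X, U) →+* X.functionField :=
  (X.presheaf.germ U (genericPoint X) h).hom

theorem functionFieldMap_germ {X Y : Scheme.{u}} [IsIntegral X] [IsIntegral Y] (f : X ⟶ Y)
    [IsDominant f] (V : Y.Opens) (hV : genericPoint Y ∈ V) (hV' : genericPoint X ∈ f ⁻¹ᵁ V)
    (s : Γ(Y, V)) : functionFieldMap f (germ V hV s) = germ (f ⁻¹ᵁ V) hV' (f.app V s) := by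
  have h := Y.presheaf.germ_stalkSpecializes (U := V) hV (specializes_genericPoint f)
  have h2 := Scheme.Hom.germ_stalkMap f V (genericPoint X) hV'
  change (Y.presheaf.germ V _ hV ≫ Y.presheaf.stalkSpecializes (specializes_genericPoint f) ≫
    f.stalkMap (genericPoint X)).hom s = (f.app V ≫ X.presheaf.germ (f ⁻¹ᵁ V) _ hV').hom s
  rw [reassoc_of% h, h2]

theorem germ_res {X : Scheme.{u}} [IsIntegral X] {U V : X.Opens} (i : V ⟶ U)
    (h : genericPoint X ∈ V) (s : Γ(X, U)) :
    germ V h (X.presheaf.map i.op s) = germ U (i.le h) s :=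
  congr($(X.presheaf.germ_res i _ h) s)

variable {S : Scheme.{u}}

/-- Let `GL_n` act on `X` and let `π : X ⟶ Y` be invariant. A matrix of functions `M` on
`π⁻¹(V)` is equivariant if, seen as a morphism from `π⁻¹(V)` to the space of `n × n` matrices, it
satisfies `M(g x) = g M(x) g⁻¹`. Such an `M` is the same as a section over `V` of the associated
bundle of matrix algebras `M_n ×^{GL_n} X`. -/
def GLAction.IsEquivariantOver {n : ℕ} {X Y : Over S} (A : GLSchemeAction n X) (π : X ⟶ Y)
    (V : Y.left.Opens) (M : Matrix (Fin n) (Fin n) Γ(X.left, π.left ⁻¹ᵁ V)) : Prop :=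
  ∀ (T : Over S) (x y : T ⟶ X) (g : GL (Fin n) (Fn T)), A.act g x = y →
    ∀ (hx : ⊤ ≤ x.left ⁻¹ᵁ (π.left ⁻¹ᵁ V)) (hy : ⊤ ≤ y.left ⁻¹ᵁ (π.left ⁻¹ᵁ V)),
      M.map (y.left.appLE (π.left ⁻¹ᵁ V) ⊤ hy) =
        g.1 * M.map (x.left.appLE (π.left ⁻¹ᵁ V) ⊤ hx) * (g⁻¹).1

/-- `GL_n` acts on `X` and `π : X ⟶ Y` is dominant and invariant under the action. -/
structure GLAction.IsInvariant {n : ℕ} {X Y : Over S} (A : GLSchemeAction n X) (π : X ⟶ Y) :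
    Prop where
  dominant : IsDominant π.left
  invariant : ∀ {T : Over S} (g : GL (Fin n) (Fn T)) (x : T ⟶ X),
    (show T ⟶ X from A.act g x) ≫ π = x ≫ π

theorem GLAction.IsQuotient.isInvariant {n : ℕ} {X Y : Over S} {A : GLSchemeAction n X}
    {π : X ⟶ Y} (h : A.IsQuotient π) : A.IsInvariant π := ⟨h.isDominant, h.invariant⟩


section Equivariant
variable {n : ℕ} {X Y : Over S} {A : GLSchemeAction n X} {π : X ⟶ Y} {V V' : Y.left.Opens}
  {M N : Matrix (Fin n) (Fin n) Γ(X.left, π.left ⁻¹ᵁ V)}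

theorem GLAction.IsEquivariantOver.add (hM : A.IsEquivariantOver π V M)
    (hN : A.IsEquivariantOver π V N) : A.IsEquivariantOver π V (M + N) := by
  intro T x y g e hx hy
  have h1 := hM T x y g e hx hy
  have h2 := hN T x y g e hx hy
  rw [Matrix.map_add _ (map_add _), Matrix.map_add _ (map_add _), h1, h2, mul_add, add_mul]

theorem GLAction.IsEquivariantOver.mul (hM : A.IsEquivariantOver π V M)
    (hN : A.IsEquivariantOver π V N) : A.IsEquivariantOver π V (M * N) := by
  intro T x y g e hx hy
  have h1 := hM T x y g e hx hy
  have h2 := hN T x y g e hx hy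
  rw [Matrix.map_mul, Matrix.map_mul, h1, h2]
  simp only [mul_assoc, Units.inv_mul_cancel_left]

/-- Restriction of functions from `π⁻¹(V)` to `π⁻¹(V')`. -/
def resPreimage (π : X ⟶ Y) (i : V' ≤ V) :
    Γ(X.left, π.left ⁻¹ᵁ V) →+* Γ(X.left, π.left ⁻¹ᵁ V') :=
  (X.left.presheaf.map (homOfLE (π.left.preimage_mono i)).op).hom

theorem appLE_resPreimage (i : V' ≤ V) {T : Over S} (x : T ⟶ X)
    (hx : ⊤ ≤ x.left ⁻¹ᵁ (π.left ⁻¹ᵁ V')) (s : Γ(X.left, π.left ⁻¹ᵁ V)) :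
    x.left.appLE (π.left ⁻¹ᵁ V') ⊤ hx (resPreimage π i s) =
      x.left.appLE (π.left ⁻¹ᵁ V) ⊤
        (hx.trans (x.left.preimage_mono (π.left.preimage_mono i))) s :=
  congr($(Scheme.Hom.map_appLE x.left hx (homOfLE (π.left.preimage_mono i)).op) s)

theorem GLAction.IsEquivariantOver.res (hM : A.IsEquivariantOver π V M) (i : V' ≤ V) :
    A.IsEquivariantOver π V' (M.map (resPreimage π i)) := by
  intro T x y g e hx hy
  have h1 := hM T x y g e (hx.trans (x.left.preimage_mono (π.left.preimage_mono i)))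
    (hy.trans (y.left.preimage_mono (π.left.preimage_mono i)))
  rw [Matrix.map_map, Matrix.map_map]
  simp only [Function.comp_def, appLE_resPreimage]
  exact h1

theorem GLAction.IsInvariant.isEquivariantOver_scalar (h : A.IsInvariant π) (s : Γ(Y.left, V)) :
    A.IsEquivariantOver π V (Matrix.scalar (Fin n) (π.left.app V s)) := by
  intro T x y g e hx hy
  have key : ∀ (z : T ⟶ X) (hz : ⊤ ≤ z.left ⁻¹ᵁ (π.left ⁻¹ᵁ V)),
      z.left.appLE (π.left ⁻¹ᵁ V) ⊤ hz (π.left.app V s) =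
        (z ≫ π).left.appLE V ⊤ hz s := fun z hz =>
    congr($(Scheme.Hom.comp_appLE z.left π.left V ⊤ hz) s).symm
  have hxy : y ≫ π = x ≫ π := by rw [← e]; exact h.invariant g x
  have hyx : y.left.appLE (π.left ⁻¹ᵁ V) ⊤ hy (π.left.app V s) =
      x.left.appLE (π.left ⁻¹ᵁ V) ⊤ hx (π.left.app V s) := by
    rw [key, key]
    congr 3
    rw [hxy]
  have hs : ∀ (R R' : Type u) [CommRing R] [CommRing R'] (φ : R →+* R') (r : R),
      (Matrix.scalar (Fin n) r).map φ = Matrix.scalar (Fin n) (φ r) := by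
    intro R R' _ _ φ r
    ext a b
    by_cases hab : a = b
    · subst hab; simp
    · simp [hab]
  have e1 := hs _ _ (y.left.appLE (π.left ⁻¹ᵁ V) ⊤ hy).hom (π.left.app V s)
  have e2 := hs _ _ (x.left.appLE (π.left ⁻¹ᵁ V) ⊤ hx).hom (π.left.app V s)
  refine e1.trans (Eq.trans ?_ (congrArg (fun Z => g.1 * Z * (g⁻¹).1) e2.symm))
  dsimp only
  rw [← (Matrix.scalar_comm _ (fun _ => Commute.all _ _) g.1), mul_assoc, Units.mul_inv, mul_one]
  exact congrArg _ hyx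

end Equivariant

theorem genericPoint_mem_preimage {X Y : Scheme.{u}} [IsIntegral X] [IsIntegral Y] (f : X ⟶ Y)
    [IsDominant f] {V : Y.Opens} (hV : genericPoint Y ∈ V) : genericPoint X ∈ f ⁻¹ᵁ V :=
  (specializes_genericPoint f).mem_open V.isOpen hV

/-- The generic fibre of the associated bundle `M_n ×^{GL_n} X` of matrix algebras over the
quotient `Y` of `X`: the `k(Y)`-algebra of all germs, at the generic point, of equivariant matrices
of functions on `π⁻¹(V)`, for `V` a nonempty open subset of `Y`. -/
def GLAction.genericSubalgebra {n : ℕ} {X Y : Over S} [IsIntegral X.left] [IsIntegral Y.left]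
    (A : GLSchemeAction n X) (π : X ⟶ Y) [IsDominant π.left] (h : A.IsInvariant π) :
    letI : Algebra Y.left.functionField X.left.functionField :=
      (functionFieldMap π.left).toAlgebra
    Subalgebra Y.left.functionField (Matrix (Fin n) (Fin n) X.left.functionField) :=
  letI : Algebra Y.left.functionField X.left.functionField :=
    (functionFieldMap π.left).toAlgebra
  { carrier := {a | ∃ (V : Y.left.Opens) (hV : genericPoint Y.left ∈ V)
      (M : Matrix (Fin n) (Fin n) Γ(X.left, π.left ⁻¹ᵁ V)), A.IsEquivariantOver π V M ∧
        a = M.map (germ (π.left ⁻¹ᵁ V) (genericPoint_mem_preimage π.left hV))}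
    add_mem' := by
      rintro _ _ ⟨V, hV, M, hM, rfl⟩ ⟨W, hW, N, hN, rfl⟩
      refine ⟨V ⊓ W, ⟨hV, hW⟩, _, (hM.res inf_le_left).add (hN.res inf_le_right), ?_⟩
      rw [Matrix.map_add _ (map_add _), Matrix.map_map, Matrix.map_map]
      congr 1 <;> ext <;> exact (germ_res _ _ _).symm
    mul_mem' := by
      rintro _ _ ⟨V, hV, M, hM, rfl⟩ ⟨W, hW, N, hN, rfl⟩
      refine ⟨V ⊓ W, ⟨hV, hW⟩, _, (hM.res inf_le_left).mul (hN.res inf_le_right), ?_⟩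
      rw [Matrix.map_mul, Matrix.map_map, Matrix.map_map]
      congr 1 <;> ext <;> exact (germ_res _ _ _).symm
    algebraMap_mem' := by
      intro c
      obtain ⟨V, hV, s, rfl⟩ := Y.left.presheaf.exists_germ_eq c
      refine ⟨V, hV, _, h.isEquivariantOver_scalar s, ?_⟩
      have := functionFieldMap_germ π.left V hV (genericPoint_mem_preimage π.left hV) s
      ext a b
      by_cases hab : a = b
      · subst hab
        simp only [Matrix.algebraMap_matrix_apply, Matrix.scalar_apply, Matrix.map_apply,
          Matrix.diagonal_apply_eq, if_true]
        exact this
      · simp [Matrix.algebraMap_matrix_apply, hab] }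

/-- The same as an object of the category of `k(Y)`-algebras. -/
def GLAction.genericAlgebra {n : ℕ} {X Y : Over S} [IsIntegral X.left] [IsIntegral Y.left]
    (A : GLSchemeAction n X) (π : X ⟶ Y) (h : A.IsInvariant π) :
    AlgCat.{u} Y.left.functionField :=
  haveI := h.dominant
  letI : Algebra Y.left.functionField X.left.functionField :=
    (functionFieldMap π.left).toAlgebra
  AlgCat.of Y.left.functionField (A.genericSubalgebra π h)

end Generic

/-! ### Vector bundles, Grassmannian bundles and frame bundles -/

section Bundles
variable {S : Scheme.{u}}

/-- A (geometric) vector bundle of rank `r` on `X`: an `X`-scheme whose sections along every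
`T`-point of `X` form a module over the functions on `T`, compatibly with base change, and which
has, locally on `X`, a basis of `r` sections. -/
structure VBundle (X : Over S) (r : ℕ) where
  total : Over S
  proj : total ⟶ X
  [addCommGroup : ∀ {T : Over S} (x : T ⟶ X), AddCommGroup {v : T ⟶ total // v ≫ proj = x}]
  [module : ∀ {T : Over S} (x : T ⟶ X), Module (Fn T) {v : T ⟶ total // v ≫ proj = x}]
  comp_add : ∀ {T' T : Over S} (f : T' ⟶ T) (x : T ⟶ X) (v v' : {v : T ⟶ total // v ≫ proj = x})
    (w w' : {v : T' ⟶ total // v ≫ proj = f ≫ x}), w.1 = f ≫ v.1 → w'.1 = f ≫ v'.1 →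
      (w + w').1 = f ≫ (v + v').1
  comp_smul : ∀ {T' T : Over S} (f : T' ⟶ T) (x : T ⟶ X) (a : Fn T)
    (v : {v : T ⟶ total // v ≫ proj = x}) (w : {v : T' ⟶ total // v ≫ proj = f ≫ x}),
      w.1 = f ≫ v.1 → (fnMap f a • w).1 = f ≫ (a • v).1
  locally_free : ∀ p : X.left, ∃ (U : Over S) (i : U ⟶ X), IsOpenImmersion i.left ∧
    p ∈ Set.range i.left ∧ ∃ e : Fin r → {v : U ⟶ total // v ≫ proj = i},
      ∀ {T : Over S} (f : T ⟶ U) (b : Fin r → {v : T ⟶ total // v ≫ proj = f ≫ i}),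
        (∀ l, (b l).1 = f ≫ (e l).1) →
          LinearIndependent (Fn T) b ∧ Submodule.span (Fn T) (Set.range b) = ⊤

/-- Open immersions can be pulled back along arbitrary morphisms. -/
theorem exists_base_change {U T T' : Over S} (i : U ⟶ T) [IsOpenImmersion i.left] (g : T' ⟶ T)
    (t : T'.left) (ht : g.left t ∈ Set.range i.left) :
    ∃ (W : Over S) (k : W ⟶ T') (l : W ⟶ U), IsOpenImmersion k.left ∧ t ∈ Set.range k.left ∧
      l ≫ i = k ≫ g := by
  let V : T'.left.Opens := g.left ⁻¹ᵁ i.left.opensRange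
  have hV : Set.range (V.ι ≫ g.left) ⊆ Set.range i.left := by
    rintro _ ⟨a, rfl⟩
    exact a.2
  let l : V.toScheme ⟶ U.left := IsOpenImmersion.lift i.left (V.ι ≫ g.left) hV
  have hl : l ≫ i.left = V.ι ≫ g.left := IsOpenImmersion.lift_fac _ _ _
  refine ⟨Over.mk (V.ι ≫ T'.hom), Over.homMk V.ι, Over.homMk l ?_, ?_, ?_, ?_⟩
  · change l ≫ U.hom = V.ι ≫ T'.hom
    rw [← Over.w i, ← Category.assoc, hl, Category.assoc, Over.w g]
  · change IsOpenImmersion V.ι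
    infer_instance
  · exact ⟨⟨t, ht⟩, rfl⟩
  · ext1
    exact hl

namespace VBundle
variable {X : Over S} {r : ℕ} (P : VBundle X r)

/-- The sections of `P` along a `T`-point `x` of `X`, i.e. the global sections of `x^* P`. -/
abbrev Sect {T : Over S} (x : T ⟶ X) : Type u := {v : T ⟶ P.total // v ≫ P.proj = x}

instance {T : Over S} (x : T ⟶ X) : AddCommGroup (P.Sect x) := P.addCommGroup x
instance {T : Over S} (x : T ⟶ X) : Module (Fn T) (P.Sect x) := P.module x

/-- Pullback of sections. -/
def pull {T' T : Over S} (f : T' ⟶ T) {x : T ⟶ X} {y : T' ⟶ X} (h : f ≫ x = y) (v : P.Sect x) :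
    P.Sect y :=
  ⟨f ≫ v.1, by rw [Category.assoc, v.2, h]⟩

theorem pull_pull {T'' T' T : Over S} (g : T'' ⟶ T') (f : T' ⟶ T) {x : T ⟶ X} {y : T' ⟶ X}
    {z : T'' ⟶ X} (h : f ≫ x = y) (h' : g ≫ y = z) (v : P.Sect x) :
    P.pull g h' (P.pull f h v) = P.pull (g ≫ f) (by rw [Category.assoc, h, h']) v :=
  Subtype.ext (Category.assoc _ _ _).symm

theorem pull_id {T : Over S} {x : T ⟶ X} (h : 𝟙 T ≫ x = x) (v : P.Sect x) :
    P.pull (𝟙 T) h v = v :=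
  Subtype.ext (Category.id_comp _)

theorem pull_add {T' T : Over S} (f : T' ⟶ T) {x : T ⟶ X} {y : T' ⟶ X} (h : f ≫ x = y)
    (v w : P.Sect x) : P.pull f h (v + w) = P.pull f h v + P.pull f h w := by
  subst h
  exact Subtype.ext (P.comp_add f x v w (P.pull f rfl v) (P.pull f rfl w) rfl rfl).symm

theorem pull_smul {T' T : Over S} (f : T' ⟶ T) {x : T ⟶ X} {y : T' ⟶ X} (h : f ≫ x = y)
    (a : Fn T) (v : P.Sect x) : P.pull f h (a • v) = fnMap f a • P.pull f h v := by
  subst h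
  exact Subtype.ext (P.comp_smul f x a v (P.pull f rfl v) rfl).symm

theorem pull_zero {T' T : Over S} (f : T' ⟶ T) {x : T ⟶ X} {y : T' ⟶ X} (h : f ≫ x = y) :
    P.pull f h (0 : P.Sect x) = 0 := by
  have := P.pull_smul f h 0 0
  simpa using this

theorem pull_sum {T' T : Over S} (f : T' ⟶ T) {x : T ⟶ X} {y : T' ⟶ X} (h : f ≫ x = y)
    {ι : Type*} (s : Finset ι) (v : ι → P.Sect x) :
    P.pull f h (∑ l ∈ s, v l) = ∑ l ∈ s, P.pull f h (v l) :=
  map_sum (⟨⟨P.pull f h, P.pull_zero f h⟩, P.pull_add f h⟩ : P.Sect x →+ P.Sect y) v s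

/-- A `j`-tuple of sections of `x^* P` is a partial frame if it is linearly independent after
every base change; equivalently, at every point of `T`. -/
def IsFrame {j : ℕ} {T : Over S} {x : T ⟶ X} (v : Fin j → P.Sect x) : Prop :=
  ∀ {T' : Over S} (f : T' ⟶ T) (y : T' ⟶ X) (h : f ≫ x = y),
    LinearIndependent (Fn T') fun l => P.pull f h (v l)

variable {P} in
theorem IsFrame.pull {j : ℕ} {T : Over S} {x : T ⟶ X} {v : Fin j → P.Sect x} (hv : P.IsFrame v)
    {T' : Over S} (f : T' ⟶ T) {y : T' ⟶ X} (h : f ≫ x = y) :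
    P.IsFrame fun l => P.pull f h (v l) := by
  intro T'' g z h'
  simp only [pull_pull]
  exact hv _ _ _

/-- A `T`-point of the Grassmannian bundle `Gr_j(P)`: a point `x : T ⟶ X` together with a
sub-bundle of rank `j` of `x^* P`. The sub-bundle is given by its sections along all
`f : T' ⟶ T`. They form submodules stable under base change (`pull_mem`), membership is a local
condition (`local_mem`), and locally on `T` there is a partial frame of `x^* P` of length `j` that
spans the sub-bundle (`exists_frame`). -/
structure GrPoint (j : ℕ) (T : Over S) where
  base : T ⟶ X
  sub : ∀ {T' : Over S} (f : T' ⟶ T) (y : T' ⟶ X), f ≫ base = y → Submodule (Fn T') (P.Sect y)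
  pull_mem : ∀ {T'' T' : Over S} (g : T'' ⟶ T') (f : T' ⟶ T) (y : T' ⟶ X) (h : f ≫ base = y)
    (z : T'' ⟶ X) (h' : g ≫ y = z) (v : P.Sect y), v ∈ sub f y h →
      P.pull g h' v ∈ sub (g ≫ f) z (by rw [Category.assoc, h, h'])
  local_mem : ∀ {T' : Over S} (f : T' ⟶ T) (y : T' ⟶ X) (h : f ≫ base = y) (v : P.Sect y),
    (∀ t : T'.left, ∃ (U : Over S) (i : U ⟶ T'), IsOpenImmersion i.left ∧ t ∈ Set.range i.left ∧
      P.pull i rfl v ∈ sub (i ≫ f) (i ≫ y) (by rw [Category.assoc, h])) → v ∈ sub f y h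
  exists_frame : ∀ t : T.left, ∃ (U : Over S) (i : U ⟶ T), IsOpenImmersion i.left ∧
    t ∈ Set.range i.left ∧ ∃ v : Fin j → P.Sect (i ≫ base), P.IsFrame v ∧
      ∀ {T' : Over S} (f : T' ⟶ U) (y : T' ⟶ X) (h : f ≫ i ≫ base = y),
        sub (f ≫ i) y (by rw [Category.assoc, h]) =
          Submodule.span (Fn T') (Set.range fun l => P.pull f h (v l))

variable {P}

theorem GrPoint.ext' {j : ℕ} {T : Over S} {a b : P.GrPoint j T} (h : a.base = b.base)
    (h' : ∀ {T' : Over S} (f : T' ⟶ T) (y : T' ⟶ X) (ha : f ≫ a.base = y) (hb : f ≫ b.base = y),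
      a.sub f y ha = b.sub f y hb) : a = b := by
  obtain ⟨xa, sa, _, _, _⟩ := a
  obtain ⟨xb, sb, _, _, _⟩ := b
  obtain rfl : xa = xb := h
  have : @sa = @sb := by
    funext T' f y hy
    exact h' f y hy hy
  subst this
  rfl

/-- Pullback of points of the Grassmannian bundle. -/
def GrPoint.pullback {j : ℕ} {T' T : Over S} (g : T' ⟶ T) (s : P.GrPoint j T) :
    P.GrPoint j T' where
  base := g ≫ s.base
  sub f y h := s.sub (f ≫ g) y (by rw [Category.assoc, h])
  pull_mem g' f y h z h' v hv := by
    have := s.pull_mem g' (f ≫ g) y (by rw [Category.assoc, h]) z h' v hv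
    simpa only [Category.assoc] using this
  local_mem f y h v hv := by
    refine s.local_mem (f ≫ g) y (by rw [Category.assoc, h]) v fun t => ?_
    obtain ⟨U, i, hi, ht, hm⟩ := hv t
    exact ⟨U, i, hi, ht, by simpa only [Category.assoc] using hm⟩
  exists_frame t := by
    obtain ⟨U, i, hi, ht, v, hv, hs⟩ := s.exists_frame (g.left t)
    obtain ⟨W, k, l, hk, htk, hc⟩ := exists_base_change i g t ht
    have hb : l ≫ i ≫ s.base = k ≫ g ≫ s.base := by rw [← Category.assoc, hc, Category.assoc]
    refine ⟨W, k, hk, htk, fun a => P.pull l hb (v a), hv.pull _ _, fun f y h => ?_⟩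
    simp only [pull_pull]
    rw [← hs (f ≫ l) y (by rw [Category.assoc, hb, h])]
    simp only [Category.assoc, hc]

/-- The functor of points of the Grassmannian bundle `Gr_j(P)`. -/
def grassmannian (P : VBundle X r) (j : ℕ) : (Over S)ᵒᵖ ⥤ Type (u + 1) where
  obj T := P.GrPoint j T.unop
  map g := ↾fun s => s.pullback g.unop
  map_id T := by
    ext s
    refine GrPoint.ext' (Category.id_comp _) fun f y ha hb => ?_
    simp [GrPoint.pullback]
  map_comp f g := by
    ext s
    refine GrPoint.ext' (Category.assoc _ _ _) fun f y ha hb => ?_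
    simp [GrPoint.pullback]

theorem GrPoint.mem_congr {j : ℕ} {T : Over S} (s : P.GrPoint j T) {T' : Over S} {f f' : T' ⟶ T}
    {y y' : T' ⟶ X} (h : f ≫ s.base = y) (h' : f' ≫ s.base = y') (hf : f = f') (hy : y = y')
    {v : P.Sect y} {v' : P.Sect y'} (hv : v.1 = v'.1) (hm : v ∈ s.sub f y h) :
    v' ∈ s.sub f' y' h' := by
  subst hf hy
  obtain rfl : v = v' := Subtype.ext hv
  exact hm

variable (P)

/-- A `T`-point of the bundle of frames of the universal sub-bundle on the Grassmannian bundle: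
a point of `Gr_j(P)`, i.e. a sub-bundle `s` of rank `j`, together with a basis `frame` of `s`.
A basis is the same as an isomorphism `e : 𝒪^j ⟶ s` (where `frame l` is the image under `e` of the
standard basis vector), and also the same as an isomorphism `e : (𝒪^j)^∨ ⟶ s` (where `frame l` is
the image under `e` of the `l`-th vector of the dual basis). -/
structure FrPoint (j : ℕ) (T : Over S) extends P.GrPoint j T where
  frame : Fin j → P.Sect base
  isFrame : P.IsFrame frame
  span_frame : ∀ {T' : Over S} (f : T' ⟶ T) (y : T' ⟶ X) (h : f ≫ base = y),
    sub f y h = Submodule.span (Fn T') (Set.range fun l => P.pull f h (frame l))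

variable {P}

theorem FrPoint.ext' {j : ℕ} {T : Over S} {a b : P.FrPoint j T} (h : a.toGrPoint = b.toGrPoint)
    (h' : ∀ l, (a.frame l).1 = (b.frame l).1) : a = b := by
  obtain ⟨a, va, _, _⟩ := a
  obtain ⟨b, vb, _, _⟩ := b
  obtain rfl : a = b := h
  obtain rfl : va = vb := funext fun l => Subtype.ext (h' l)
  rfl

/-- Pullback of points of the frame bundle. -/
def FrPoint.pullback {j : ℕ} {T' T : Over S} (g : T' ⟶ T) (s : P.FrPoint j T) :
    P.FrPoint j T' where
  toGrPoint := s.toGrPoint.pullback g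
  frame l := P.pull g rfl (s.frame l)
  isFrame := IsFrame.pull s.isFrame g rfl
  span_frame f y h := by
    refine (s.span_frame (f ≫ g) y (by rw [Category.assoc]; exact h)).trans ?_
    exact congrArg (fun b => Submodule.span _ (Set.range b))
      (funext fun l => (P.pull_pull f g rfl h (s.frame l)).symm)

/-- The functor of points of the frame bundle of the universal sub-bundle on `Gr_j(P)`. -/
def frameBundle (P : VBundle X r) (j : ℕ) : (Over S)ᵒᵖ ⥤ Type (u + 1) where
  obj T := P.FrPoint j T.unop
  map g := ↾fun s => s.pullback g.unop
  map_id T := by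
    ext s
    exact FrPoint.ext' congr($((P.grassmannian j).map_id T) s.toGrPoint)
      fun l => Category.id_comp _
  map_comp f g := by
    ext s
    exact FrPoint.ext' congr($((P.grassmannian j).map_comp f g) s.toGrPoint)
      fun l => Category.assoc _ _ _

/-- The change of frame by an invertible matrix. -/
def FrPoint.changeFrame {j : ℕ} {T : Over S} (g : GL (Fin j) (Fn T)) (s : P.FrPoint j T) :
    P.FrPoint j T where
  toGrPoint := s.toGrPoint
  frame l := ∑ m, g.1 l m • s.frame m
  isFrame f y h := by
    simp only [pull_sum, pull_smul]
    exact linearIndependent_change (glMap f g) (s.isFrame f y h)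
  span_frame f y h := by
    simp only [pull_sum, pull_smul]
    exact (s.span_frame f y h).trans (span_change (glMap f g) _).symm

/-- The contravariant action of `GL_j` on the frame bundle: in terms of isomorphisms
`e : (𝒪^j)^∨ ⟶ s`, the matrix `h` maps `e` to `e ∘ h^∨`, where `h^∨` maps a linear form `ξ` to
`ξ ∘ h`. So the `l`-th vector of the new frame is `∑ m, h l m • frame m`. -/
def contravariantAction (P : VBundle X r) (j : ℕ) : GLAction j (P.frameBundle j) where
  act {T} h s := FrPoint.changeFrame h s
  one_act s := FrPoint.ext' rfl fun l => congrArg _ (one_change _ _)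
  mul_act g h s := FrPoint.ext' rfl fun l => congrArg _ (change_change _ _ _ _)
  map_act f g s := FrPoint.ext' rfl fun l => congrArg Subtype.val (by
    change P.pull f rfl (∑ m, g.1 l m • s.frame m) =
      ∑ m, fnMap f (g.1 l m) • P.pull f rfl (s.frame m)
    simp only [pull_sum, pull_smul])

/-- The covariant action of `GL_j` on the frame bundle: in terms of isomorphisms
`e : 𝒪^j ⟶ s`, the matrix `h` maps `e` to `e ∘ h⁻¹`. So the `l`-th vector of the new frame is
`∑ m, (h⁻¹) m l • frame m`. -/
def covariantAction (P : VBundle X r) (j : ℕ) : GLAction j (P.frameBundle j) where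
  act {T} h s := FrPoint.changeFrame (invTranspose h) s
  one_act s := by
    rw [show ∀ {R : Type u} [CommRing R], invTranspose (1 : GL (Fin j) R) = 1 from
      Units.ext (by simp [invTranspose])]
    exact (P.contravariantAction j).one_act s
  mul_act g h s := by
    rw [show invTranspose (g * h) = invTranspose g * invTranspose h from
      Units.ext (by simp [invTranspose, Matrix.transpose_mul])]
    exact (P.contravariantAction j).mul_act _ _ s
  map_act f g s := (P.contravariantAction j).map_act f (invTranspose g) s

/-- An action of `GL_n` on the vector bundle `P` lifting the action `A` on `X` (equivariantly and
linearly on fibres), such that scalar matrices `t` act on the fibres as multiplication by `t ^ w`: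
this makes `P` a vector bundle of weight `w` on `X`. -/
structure WeightStructure {n : ℕ} (A : GLSchemeAction n X) (P : VBundle X r) (w : ℤ) where
  action : GLSchemeAction n P.total
  act_proj : ∀ {T : Over S} (g : GL (Fin n) (Fn T)) (v : T ⟶ P.total),
    (show T ⟶ P.total from action.act g v) ≫ P.proj = A.act g (v ≫ P.proj)
  act_add : ∀ {T : Over S} (g : GL (Fin n) (Fn T)) (x : T ⟶ X) (v v' : P.Sect x)
    (u u' : P.Sect (show T ⟶ X from A.act g x)), u.1 = action.act g v.1 → u'.1 = action.act g v'.1 →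
      (u + u').1 = action.act g (v + v').1
  act_smul : ∀ {T : Over S} (g : GL (Fin n) (Fn T)) (x : T ⟶ X) (a : Fn T) (v : P.Sect x)
    (u : P.Sect (show T ⟶ X from A.act g x)), u.1 = action.act g v.1 →
      (a • u).1 = action.act g (a • v).1
  scalar_act : ∀ {T : Over S} (t : (Fn T)ˣ) (x : T ⟶ X) (v : P.Sect x),
    action.act (scalarPt n t) v.1 = (((t ^ w : (Fn T)ˣ) : Fn T) • v).1

namespace WeightStructure
variable {n : ℕ} {A : GLSchemeAction n X} {w : ℤ} (E : WeightStructure A P w)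

/-- The linear bijection between fibres given by the action. -/
def fibreEquiv {T : Over S} (g : GL (Fin n) (Fn T)) {x y : T ⟶ X} (h : A.act g x = y) :
    P.Sect x ≃ₗ[Fn T] P.Sect y where
  toFun v := ⟨E.action.act g v.1, by rw [E.act_proj, v.2, h]⟩
  map_add' v v' := by
    subst h
    exact Subtype.ext (E.act_add g x v v' _ _ rfl rfl).symm
  map_smul' a v := by
    subst h
    exact Subtype.ext (E.act_smul g x a v _ rfl).symm
  invFun v := ⟨E.action.act g⁻¹ v.1, by
    rw [E.act_proj, v.2, ← h, ← A.mul_act, inv_mul_cancel, A.one_act]⟩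
  left_inv v := Subtype.ext (by
    change E.action.act _ (E.action.act _ _) = _
    rw [← E.action.mul_act, inv_mul_cancel, E.action.one_act])
  right_inv v := Subtype.ext (by
    change E.action.act _ (E.action.act _ _) = _
    rw [← E.action.mul_act, mul_inv_cancel, E.action.one_act])


theorem pull_fibreEquiv {T' T : Over S} (f : T' ⟶ T) (g : GL (Fin n) (Fn T)) {x y : T ⟶ X}
    (h : A.act g x = y) {x' y' : T' ⟶ X} (hx : f ≫ x = x') (hy : f ≫ y = y')
    (h' : A.act (glMap f g) x' = y') (v : P.Sect x) :
    P.pull f hy (E.fibreEquiv g h v) = E.fibreEquiv (glMap f g) h' (P.pull f hx v) :=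
  Subtype.ext (E.action.comp_act f g v.1)

/-- The sections of `g s`, for a sub-bundle `s`. -/
def actSub {j : ℕ} {T : Over S} (g : GL (Fin n) (Fn T)) (s : P.GrPoint j T) {T' : Over S}
    (f : T' ⟶ T) (y : T' ⟶ X) (h : f ≫ (show T ⟶ X from A.act g s.base) = y) :
    Submodule (Fn T') (P.Sect y) :=
  (s.sub f (A.act (glMap f g)⁻¹ y) (by
      rw [← h, A.comp_act, ← A.mul_act, inv_mul_cancel, A.one_act])).comap
    (E.fibreEquiv (glMap f g)⁻¹ rfl).toLinearMap

theorem mem_actSub {j : ℕ} {T : Over S} {g : GL (Fin n) (Fn T)} {s : P.GrPoint j T} {T' : Over S}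
    {f : T' ⟶ T} {y : T' ⟶ X} (h : f ≫ (show T ⟶ X from A.act g s.base) = y) {v : P.Sect y}
    {y' : T' ⟶ X} (h' : f ≫ s.base = y') {v' : P.Sect y'}
    (hv : v'.1 = E.action.act (glMap f g)⁻¹ v.1) :
    v ∈ E.actSub g s f y h ↔ v' ∈ s.sub f y' h' := by
  have hy : A.act (glMap f g)⁻¹ y = y' := by
    rw [← h, ← h', A.comp_act, ← A.mul_act, inv_mul_cancel, A.one_act]
  exact ⟨s.mem_congr _ _ rfl hy hv.symm, s.mem_congr _ _ rfl hy.symm hv⟩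

theorem actSub_base {T' T : Over S} (g : GL (Fin n) (Fn T)) (f : T' ⟶ T) {x : T ⟶ X}
    {y : T' ⟶ X} (h : f ≫ (show T ⟶ X from A.act g x) = y) :
    A.act (glMap f g)⁻¹ y = f ≫ x := by
  rw [← h, A.comp_act, ← A.mul_act, inv_mul_cancel, A.one_act]

theorem actSub_span {j : ℕ} {T : Over S} (g : GL (Fin n) (Fn T)) (s : P.GrPoint j T)
    {T' : Over S} (f : T' ⟶ T) (y : T' ⟶ X) (h : f ≫ (show T ⟶ X from A.act g s.base) = y)
    {ι : Type*} (v : ι → P.Sect (f ≫ s.base)) (w : ι → P.Sect y)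
    (hvw : ∀ l, (w l).1 = E.action.act (glMap f g) (v l).1)
    (hs : s.sub f (f ≫ s.base) rfl = Submodule.span (Fn T') (Set.range v)) :
    E.actSub g s f y h = Submodule.span (Fn T') (Set.range w) := by
  let e := E.fibreEquiv (glMap f g) (x := f ≫ s.base) (y := y) (by rw [← h, A.comp_act])
  have hw : w = e ∘ v := funext fun l => Subtype.ext (hvw l)
  have h1 : E.actSub g s f y h = (s.sub f (f ≫ s.base) rfl).map e.toLinearMap := by
    ext u
    rw [Submodule.mem_map_equiv]
    exact E.mem_actSub h rfl rfl
  rw [h1, hs, hw, Submodule.map_span, Set.range_comp]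
  rfl

/-- The induced action of `GL_n` on points of the Grassmannian bundle: `g` maps a sub-bundle `s` of
`x^* P` to the sub-bundle `g s` of `(g x)^* P`. -/
def actGr {j : ℕ} {T : Over S} (g : GL (Fin n) (Fn T)) (s : P.GrPoint j T) : P.GrPoint j T where
  base := A.act g s.base
  sub f y h := E.actSub g s f y h
  pull_mem g' f y h z h' v hv := by
    refine (E.mem_actSub _ (by rw [actSub_base g f h, Category.assoc]) ?_).2
      (s.pull_mem g' f _ _ _ rfl _ hv)
    change g' ≫ (show _ ⟶ P.total from E.action.act _ _) = E.action.act _ (g' ≫ v.1)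
    rw [E.action.comp_act, glMap_comp, map_inv]
  local_mem f y h v hv := by
    refine s.local_mem f _ _ _ fun t => ?_
    obtain ⟨U, i, hi, ht, hm⟩ := hv t
    refine ⟨U, i, hi, ht, (E.mem_actSub _ _ ?_).1 hm⟩
    change i ≫ (show _ ⟶ P.total from E.action.act _ _) = E.action.act _ (i ≫ v.1)
    rw [E.action.comp_act, glMap_comp, map_inv]
  exists_frame t := by
    obtain ⟨U, i, hi, ht, v, hv, hs⟩ := s.exists_frame t
    let e := E.fibreEquiv (glMap i g) (x := i ≫ s.base)
      (y := i ≫ (show T ⟶ X from A.act g s.base)) (A.comp_act i g s.base).symm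
    refine ⟨U, i, hi, ht, fun l => e (v l), ?_, ?_⟩
    · intro T' f y h
      have hb : A.act (glMap f (glMap i g)) (f ≫ i ≫ s.base) = y := by
        rw [← h, A.comp_act, A.comp_act]
      simp only [e, E.pull_fibreEquiv f (glMap i g) _ rfl h hb]
      exact (hv f _ rfl).map' _ (LinearEquiv.ker _)
    · intro T' f y h
      refine E.actSub_span g s (f ≫ i) y _
        (fun l => P.pull f (Category.assoc _ _ _).symm (v l)) _ (fun l => ?_) (hs f _ _)
      change f ≫ (show U ⟶ P.total from E.action.act _ _) = E.action.act _ (f ≫ (v l).1)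
      rw [E.action.comp_act, glMap_comp]

/-- The induced action of `GL_n` on the Grassmannian bundle. -/
def grAction (j : ℕ) : GLAction n (P.grassmannian j) where
  act g s := E.actGr g s
  one_act s := by
    refine GrPoint.ext' (A.one_act _) fun f y ha hb => ?_
    ext v
    exact E.mem_actSub ha hb (by rw [map_one, inv_one, E.action.one_act])
  mul_act {T} g h s := by
    refine GrPoint.ext' (A.mul_act _ _ _) fun f y ha hb => ?_
    ext v
    have h1 : f ≫ (show T ⟶ X from A.act h s.base) = A.act (glMap f g)⁻¹ y :=
      (actSub_base (A := A) g f hb).symm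
    have h2 : A.act (glMap f h)⁻¹ (A.act (glMap f g)⁻¹ y) = f ≫ s.base :=
      actSub_base (A := A) h f h1
    let v1 : P.Sect (A.act (glMap f g)⁻¹ y) := E.fibreEquiv (glMap f g)⁻¹ rfl v
    let v2 : P.Sect (f ≫ s.base) := E.fibreEquiv (glMap f h)⁻¹ h2 v1
    refine (E.mem_actSub ha (rfl : f ≫ s.base = _) (v' := v2) ?_).trans
      (((E.mem_actSub h1 (rfl : f ≫ s.base = _) (v' := v2) rfl).symm).trans
        (E.mem_actSub (s := E.actGr h s) hb h1 (v' := v1) rfl).symm)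
    change E.action.act _ (E.action.act _ _) = _
    rw [← E.action.mul_act, map_mul, _root_.mul_inv_rev]
  map_act {T' T} k g s := by
    refine GrPoint.ext' (A.map_act k g s.base) fun f y ha hb => ?_
    ext v
    have h1 : (f ≫ k) ≫ (show T ⟶ X from A.act g s.base) = y := (Category.assoc _ _ _).trans ha
    exact (E.mem_actSub h1 (actSub_base g (f ≫ k) h1).symm
      (v' := E.fibreEquiv _ rfl v) rfl).trans
      (E.mem_actSub (s := s.pullback k) hb
        ((Category.assoc _ _ _).symm.trans (actSub_base g (f ≫ k) h1).symm)
        (by rw [← glMap_comp]; rfl)).symm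

/-- The induced action of `GL_n` on points of the frame bundle: `g` maps a sub-bundle `s` with
frame `v` to the sub-bundle `g s` with the frame `g v`. -/
def actFr {j : ℕ} {T : Over S} (g : GL (Fin n) (Fn T)) (s : P.FrPoint j T) : P.FrPoint j T where
  toGrPoint := E.actGr g s.toGrPoint
  frame l := E.fibreEquiv g rfl (s.frame l)
  isFrame f y h := by
    have hb : A.act (glMap f g) (f ≫ s.base) = y := by
      rw [← A.comp_act]; exact h
    have h2 : (fun l => P.pull f h (E.fibreEquiv g rfl (s.frame l))) =
        E.fibreEquiv (glMap f g) hb ∘ fun l => P.pull f rfl (s.frame l) :=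
      funext fun l => E.pull_fibreEquiv f g rfl rfl h hb _
    rw [h2]
    exact (s.isFrame f _ rfl).map' _ (LinearEquiv.ker _)
  span_frame f y h := by
    refine E.actSub_span g s.toGrPoint f y h (fun l => P.pull f rfl (s.frame l)) _ (fun l => ?_)
      (s.span_frame f _ rfl)
    exact E.action.comp_act f g _

/-- The induced action of `GL_n` on the frame bundle. -/
def frAction (j : ℕ) : GLAction n (P.frameBundle j) where
  act g s := E.actFr g s
  one_act s := FrPoint.ext' ((E.grAction j).one_act s.toGrPoint) fun _ => E.action.one_act _
  mul_act g h s := FrPoint.ext' ((E.grAction j).mul_act g h s.toGrPoint)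
    fun _ => E.action.mul_act g h _
  map_act f g s := FrPoint.ext' ((E.grAction j).map_act f g s.toGrPoint)
    fun _ => E.action.comp_act f g _

end WeightStructure

/-- The projection from the Grassmannian bundle to the base. -/
def grProj {j : ℕ} {Gr : Over S} (hGr : (P.grassmannian j).RepresentableBy Gr) : Gr ⟶ X :=
  (show P.GrPoint j Gr from hGr.homEquiv (𝟙 Gr)).base

/-- The projection from the frame bundle to the Grassmannian bundle, forgetting the frame. -/
def frProj {j : ℕ} {Gr Fr : Over S} (hGr : (P.grassmannian j).RepresentableBy Gr)
    (hFr : (P.frameBundle j).RepresentableBy Fr) : Fr ⟶ Gr :=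
  hGr.homEquiv.symm (show P.FrPoint j Fr from hFr.homEquiv (𝟙 Fr)).toGrPoint

/-- The quotient `Fr / GL_n` of the frame bundle `Fr` of the universal sub-bundle on `Gr = Gr_j(P)`,
with the action of `GL_j` on it induced by a given action `J` of `GL_j` on the frame bundle, and
the map from `Fr / GL_n` to the quotient `q : Gr ⟶ Q` of `Gr` by `GL_n` that is induced by the
projection `Fr ⟶ Gr`. -/
structure FrameQuotient {n : ℕ} {A : GLSchemeAction n X} {w : ℤ} (E : WeightStructure A P w)
    {j : ℕ} (J : GLAction j (P.frameBundle j)) {Gr Q : Over S}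
    (hGr : (P.grassmannian j).RepresentableBy Gr) (q : Gr ⟶ Q) where
  /-- the frame bundle `Fr` -/
  frames : Over S
  represents : (P.frameBundle j).RepresentableBy frames
  /-- the quotient `Fr / GL_n` -/
  quot : Over S
  isVariety : IsVariety quot
  quotMap : frames ⟶ quot
  isQuotient : ((E.frAction j).ofRepresentable represents).IsQuotient quotMap
  /-- the induced action of `GL_j` -/
  action : GLSchemeAction j quot
  quotMap_act : ∀ {T : Over S} (h : GL (Fin j) (Fn T)) (e : T ⟶ frames),
    (show T ⟶ quot from action.act h (e ≫ quotMap)) =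
      (show T ⟶ frames from (J.ofRepresentable represents).act h e) ≫ quotMap
  /-- the induced map `Fr / GL_n ⟶ Q` -/
  toQuot : quot ⟶ Q
  quotMap_toQuot : quotMap ≫ toQuot = frProj hGr represents ≫ q

attribute [instance] FrameQuotient.isVariety

end VBundle
end Bundles

end TwistedGrassmannian

end

open TwistedGrassmannian

noncomputable section

namespace TwistedGrassmannian

/-! ### Coverings in the fppf topology -/

section Covers
variable {S : Scheme.{u}}

open Limits

/-! Let a group functor `G` act on `Z` with fppf quotient `π : Z ⟶ Y`, and let `ρ` be a linear
representation of `G`. If stabilisers act trivially in `ρ` (`IsHonest`), the trivial bundle with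
fibre `ρ` descends to `Y`, and its generic fibre is a `k(Y)`-vector space of the dimension of `ρ`.
If stabilisers act by scalars (`IsProjective`), the conjugation representation is honest, so the
matrix algebra descends to a form over `k(Y)`. This form is a central simple algebra, and its class
is attached to the pair of `π` and `ρ`.

Three properties determine everything. The class is additive for tensor products, because Kronecker
products of equivariant matrices are equivariant. It changes sign for duals, because transposes of
equivariant matrices are equivariant for the dual. It vanishes for honest representations, because
the algebra then acts on the descended vector space and is its full endomorphism algebra.
Consequently the class depends only on the characters of the stabilisers: if they act by `t` in `ρ`
and by `t ^ m` in `τ`, then `τ` tensored with a representation of character `t ^ (-m)` built from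
`ρ` is honest, so the class of `τ` is `m` times that of `ρ` (`brauer_eq_zsmul`).

This is applied to the frame bundle `Fr` with the group `GL_n × GL_j` over `Q = Gr/PGL_n`, where
`GL_j` changes frames contravariantly. If `(g, h)` fixes a frame, then `g` fixes a point of `X`, so
`g = t` is scalar; it multiplies the frame by `t ^ w`, so `h = t ^ (-w)` (`stabilizer_frame`).
Therefore the standard representation of `GL_j` has class `-w` times that of `GL_n`. The former is
the class of `Fr/GL_n ⟶ Q` and the latter that of `Gr ⟶ Q`, because classes are functorial for
equivariant maps (`brauer_eq_pullback`); the same functoriality for `Gr ⟶ X` gives the pullback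
formula. The covariant action differs from the contravariant one by the inverse transpose, which
dualises the representation and changes the sign. The scalar `t` of `GL_j` acts on `Fr` like a
scalar `s` of `GL_n` with `s ^ w = t`, hence trivially on `Fr/GL_n`; such an `s` exists fppf-locally
when `w ≠ 0`.

The technical core is `DescentDatum.exists_basis_forms`. The generic fibre is defined by equivariant
functions on preimages of Zariski open sets, while `π` has sections only fppf-locally. One takes a
section over a flat affine `Spec B` near the generic point, descends vector spaces along `K ⟶ K ⊗
B`, clears denominators, and glues the result to equivariant functions over the open image of `Spec
B`. Since `Fr` is not assumed integral, values are taken at an arbitrary field-valued point `z₀`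
over the generic point of `Y`, not at a generic point of `Z`. -/

theorem fnMap_comp_apply {T'' T' T : Over S} (g : T'' ⟶ T') (f : T' ⟶ T) (a : Fn T) :
    fnMap (g ≫ f) a = fnMap g (fnMap f a) := rfl

theorem fnMap_id_apply {T : Over S} (a : Fn T) : fnMap (𝟙 T) a = a := by
  simp [fnMap]

namespace IsFppfCover

theorem epi {T' T : Over S} {p : T' ⟶ T} (hp : IsFppfCover p) : Epi p := by
  have := hp.flat
  have := hp.surj
  have : Epi p.left := Flat.epi_of_flat_of_surjective p.left
  exact (Over.forget S).epi_of_epi_map (by exact this)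

theorem comp {T'' T' T : Over S} {q : T'' ⟶ T'} {p : T' ⟶ T} (hq : IsFppfCover q)
    (hp : IsFppfCover p) : IsFppfCover (q ≫ p) := by
  have := hp.flat
  have := hp.surj
  have := hp.lfp
  have := hq.flat
  have := hq.surj
  have := hq.lfp
  refine ⟨?_, ?_, ?_⟩ <;> rw [Over.comp_left] <;> infer_instance

/-- Coverings can be pulled back. -/
theorem exists_base_change {T' T : Over S} {p : T' ⟶ T} (hp : IsFppfCover p) {U : Over S}
    (f : U ⟶ T) : ∃ (U' : Over S) (q : U' ⟶ U) (f' : U' ⟶ T'), IsFppfCover q ∧ f' ≫ p = q ≫ f := by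
  have := hp.flat
  have := hp.surj
  have := hp.lfp
  refine ⟨Over.mk (pullback.fst f.left p.left ≫ U.hom), Over.homMk (pullback.fst f.left p.left) rfl,
    Over.homMk (pullback.snd f.left p.left) ?_, ⟨?_, ?_, ?_⟩, ?_⟩
  · change pullback.snd f.left p.left ≫ T'.hom = pullback.fst f.left p.left ≫ U.hom
    rw [← Over.w f, ← Over.w p, pullback.condition_assoc]
  · change Flat (pullback.fst f.left p.left); infer_instance
  · change LocallyOfFinitePresentation (pullback.fst f.left p.left); infer_instance
  · change Surjective (pullback.fst f.left p.left); infer_instance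
  · ext1
    exact pullback.condition.symm

protected theorem id (T : Over S) : IsFppfCover (𝟙 T) := by
  refine ⟨?_, ?_, ?_⟩ <;> rw [Over.id_left] <;> infer_instance

/-- Functions are morphisms to the affine line over `ℤ`, and a flat surjective morphism is an
epimorphism of schemes. -/
theorem fnMap_injective {T' T : Over S} {p : T' ⟶ T} (hp : IsFppfCover p) :
    Function.Injective (fnMap p) := by
  have := hp.flat
  have := hp.surj
  have : Epi p.left := Flat.epi_of_flat_of_surjective p.left
  intro a b hab
  let e := fun T : Scheme.{u} => AffineSpace.toSpecMvPolyIntEquiv (n := PUnit.{u + 1}) (X := T)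
  have h : (e T.left).symm (fun _ => a) = (e T.left).symm (fun _ => b) := by
    rw [← cancel_epi p.left]
    apply (e T'.left).injective
    funext i
    simp only [e]
    rw [AffineSpace.toSpecMvPolyIntEquiv_comp, AffineSpace.toSpecMvPolyIntEquiv_comp,
      Equiv.apply_symm_apply, Equiv.apply_symm_apply]
    exact hab
  exact congrFun ((e T.left).symm.injective h) PUnit.unit

/-- Functions are a sheaf for the fppf topology. -/
theorem exists_fnMap_eq {T' T : Over S} {p : T' ⟶ T} (hp : IsFppfCover p) (s : Fn T')
    (hs : ∀ {T'' : Over S} (a b : T'' ⟶ T'), a ≫ p = b ≫ p → fnMap a s = fnMap b s) :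
    ∃ t : Fn T, fnMap p t = s := by
  have := hp.flat
  have := hp.surj
  have := hp.lfp
  let e := fun T : Scheme.{u} => AffineSpace.toSpecMvPolyIntEquiv (n := PUnit.{u + 1}) (X := T)
  -- An fppf covering is an effective epimorphism, so the morphism to the affine line given by `s`
  -- factors through `p`.
  let d := EffectiveEpi.desc p.left ((e T'.left).symm fun _ => s) (by
    intro Z g₁ g₂ h
    apply (e Z).injective
    funext i
    simp only [e]
    rw [AffineSpace.toSpecMvPolyIntEquiv_comp, AffineSpace.toSpecMvPolyIntEquiv_comp,
      Equiv.apply_symm_apply]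
    have hg : g₂ ≫ T'.hom = g₁ ≫ T'.hom := by
      rw [← Over.w p, reassoc_of% h]
    exact hs (T'' := Over.mk (g₁ ≫ T'.hom)) (Over.homMk g₁ rfl) (Over.homMk g₂ hg)
      (by ext1; exact h))
  refine ⟨e T.left d PUnit.unit, ?_⟩
  have h2 := congrArg (fun m => e T'.left m PUnit.unit)
    (EffectiveEpi.fac p.left ((e T'.left).symm fun _ => s) (by
    intro Z g₁ g₂ h
    apply (e Z).injective
    funext i
    simp only [e]
    rw [AffineSpace.toSpecMvPolyIntEquiv_comp, AffineSpace.toSpecMvPolyIntEquiv_comp,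
      Equiv.apply_symm_apply]
    have hg : g₂ ≫ T'.hom = g₁ ≫ T'.hom := by
      rw [← Over.w p, reassoc_of% h]
    exact hs (T'' := Over.mk (g₁ ≫ T'.hom)) (Over.homMk g₁ rfl) (Over.homMk g₂ hg)
      (by ext1; exact h)))
  simp only [e, Equiv.apply_symm_apply] at h2
  rw [AffineSpace.toSpecMvPolyIntEquiv_comp] at h2
  exact h2

/-- A family of open immersions that covers `T` gives an fppf covering. -/
theorem of_openImmersions {T : Over S} (U : T.left → Over S) (i : ∀ t, U t ⟶ T)
    (hi : ∀ t, IsOpenImmersion (i t).left) (ht : ∀ t, t ∈ Set.range (i t).left) :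
    ∃ (T' : Over S) (p : T' ⟶ T) (l : ∀ t, U t ⟶ T'), IsFppfCover p ∧ (∀ t, l t ≫ p = i t) ∧
      (∀ {W : Over S} (f : ∀ t, U t ⟶ W), ∃ g : T' ⟶ W, ∀ t, l t ≫ g = f t) ∧
      (∀ {W : Over S} (a b : T' ⟶ W), (∀ t, l t ≫ a = l t ≫ b) → a = b) ∧
      (∀ f : ∀ t, Fn (U t), ∃ g : Fn T', ∀ t, fnMap (l t) g = f t) := by
  -- The covering is the coproduct over all points of `T`. The remaining clauses are its universal
  -- property, and its special case for functions, seen as morphisms to the affine line.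
  let q : (∐ fun t => (U t).left) ⟶ T.left := Sigma.desc fun t => (i t).left
  let p : Over.mk (q ≫ T.hom) ⟶ T := Over.homMk q rfl
  refine ⟨_, p, fun t => Over.homMk (Sigma.ι (fun t => (U t).left) t) ?_, ⟨?_, ?_, ?_⟩,
    fun t => ?_, fun {W} f => ?_, fun {W} a b h => ?_, fun f => ?_⟩
  · change Sigma.ι (fun t => (U t).left) t ≫ q ≫ T.hom = _
    rw [Sigma.ι_desc_assoc]
    exact Over.w (i t)
  · have (t : T.left) : Flat (i t).left := inferInstance
    exact inferInstanceAs (Flat (Sigma.desc fun t => (i t).left))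
  · have : IsZariskiLocalAtSource @LocallyOfFinitePresentation.{u} :=
      HasRingHomProperty.instIsZariskiLocalAtSource (Q := RingHom.FinitePresentation)
    exact IsZariskiLocalAtSource.sigmaDesc fun t => inferInstance
  · refine ⟨fun t => ?_⟩
    obtain ⟨x, hx⟩ := ht t
    refine ⟨Sigma.ι (fun t => (U t).left) t x, ?_⟩
    change q _ = t
    rw [← Scheme.Hom.comp_apply, Sigma.ι_desc, hx]
  · ext1
    exact Sigma.ι_desc _ _
  · refine ⟨Over.homMk (Sigma.desc fun t => (f t).left) ?_, fun t => ?_⟩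
    · change (Sigma.desc fun t => (f t).left) ≫ W.hom = q ≫ T.hom
      refine Sigma.hom_ext _ _ fun t => ?_
      rw [Sigma.ι_desc_assoc, Sigma.ι_desc_assoc, Over.w, Over.w]
    · ext1
      exact Sigma.ι_desc _ _
  · ext1
    exact Sigma.hom_ext _ _ fun t => congrArg (fun m => m.left) (h t)
  · let e := fun T : Scheme.{u} => AffineSpace.toSpecMvPolyIntEquiv (n := PUnit.{u + 1}) (X := T)
    let d := Sigma.desc fun t => (e (U t).left).symm fun _ => f t
    refine ⟨e _ d PUnit.unit, fun t => ?_⟩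
    have h1 := congrArg (fun m => e _ m PUnit.unit)
      (Sigma.ι_desc (fun t => (e (U t).left).symm fun _ => f t) t)
    simp only [e, Equiv.apply_symm_apply] at h1
    rw [AffineSpace.toSpecMvPolyIntEquiv_comp] at h1
    exact h1

/-- Roots of units exist after passing to an fppf covering. -/
theorem exists_root {T : Over S} (t : (Fn T)ˣ) {m : ℕ} (hm : m ≠ 0) :
    ∃ (T' : Over S) (p : T' ⟶ T), IsFppfCover p ∧
      ∃ s : (Fn T')ˣ, s ^ m = Units.map (fnMap p : Fn T →* Fn T') t := by
  -- Over the zero ring all units coincide; elsewhere `X ^ m - t` has degree `m`, which makes the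
  -- quotient ring nonzero.
  rcases subsingleton_or_nontrivial (Fn T) with h | h
  · exact ⟨T, 𝟙 T, .id T, 1, Units.ext (Subsingleton.elim _ _)⟩
  -- Adjoining a root of a monic polynomial gives a nonzero free, hence faithfully flat, algebra of
  -- finite presentation over `Fn T`. The covering is its pullback along the canonical morphism from
  -- `T` to the spectrum of its functions.
  let f : Polynomial (Fn T) := Polynomial.X ^ m - Polynomial.C t.1
  have hf : f.Monic := Polynomial.monic_X_pow_sub_C _ hm
  have := hf.free_adjoinRoot
  have := hf.finite_adjoinRoot
  have : Nontrivial (AdjoinRoot f) := by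
    refine ⟨1, 0, fun h => ?_⟩
    rw [← map_one (AdjoinRoot.mk f), AdjoinRoot.mk_eq_zero] at h
    have h1 := hf.eq_one_of_isUnit (isUnit_of_dvd_one h)
    have h2 : f.natDegree = m := Polynomial.natDegree_X_pow_sub_C
    rw [h1, Polynomial.natDegree_one] at h2
    exact hm h2.symm
  have hfp : Algebra.FinitePresentation (Fn T) (AdjoinRoot f) := inferInstance
  let a : CommRingCat.of (Fn T) ⟶ CommRingCat.of (AdjoinRoot f) :=
    CommRingCat.ofHom (algebraMap (Fn T) (AdjoinRoot f))
  have ha : Flat (Spec.map a) ∧ Surjective (Spec.map a) :=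
    (flat_and_surjective_SpecMap_iff a).2 (RingHom.faithfullyFlat_algebraMap_iff.2 inferInstance)
  have := ha.1
  have := ha.2
  have : LocallyOfFinitePresentation (Spec.map a) :=
    (LocallyOfFinitePresentation.SpecMap_iff a).2 (RingHom.finitePresentation_algebraMap.2 hfp)
  let π₁ := pullback.fst T.left.toSpecΓ (Spec.map a)
  let π₂ := pullback.snd T.left.toSpecΓ (Spec.map a)
  let p : Over.mk (π₁ ≫ T.hom) ⟶ T := Over.homMk π₁ rfl
  let x : Fn (Over.mk (π₁ ≫ T.hom)) :=
    π₂.appTop ((Scheme.ΓSpecIso (.of (AdjoinRoot f))).inv (AdjoinRoot.root f))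
  have hx : x ^ m = fnMap p t.1 := by
    have h1 : AdjoinRoot.root f ^ m = a t.1 := by
      have := AdjoinRoot.eval₂_root f
      rw [Polynomial.eval₂_sub, Polynomial.eval₂_pow, Polynomial.eval₂_X, Polynomial.eval₂_C,
        sub_eq_zero] at this
      exact this
    have h2 := congr($(pullback.condition (f := T.left.toSpecΓ) (g := Spec.map a)).appTop
      ((Scheme.ΓSpecIso (.of (Fn T))).inv t.1))
    simp only [Scheme.Hom.comp_appTop, CommRingCat.comp_apply] at h2
    rw [Scheme.toSpecΓ_appTop] at h2
    have h3 : (Scheme.ΓSpecIso Γ(T.left, ⊤)).hom ((Scheme.ΓSpecIso (.of (Fn T))).inv t.1) = t.1 :=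
      congr($((Scheme.ΓSpecIso Γ(T.left, ⊤)).inv_hom_id) t.1)
    have h4 : (Spec.map a).appTop ((Scheme.ΓSpecIso (.of (Fn T))).inv t.1) =
        (Scheme.ΓSpecIso (.of (AdjoinRoot f))).inv (a t.1) :=
      congr($(Scheme.ΓSpecIso_inv_naturality a) t.1).symm
    rw [h3, h4, ← h1, map_pow, map_pow] at h2
    exact h2.symm
  have hu : IsUnit x := (isUnit_pow_iff hm).1 (hx ▸ t.isUnit.map (fnMap p))
  refine ⟨_, p, ⟨?_, ?_, ?_⟩, hu.unit, Units.ext hx⟩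
  · change Flat π₁; infer_instance
  · change LocallyOfFinitePresentation π₁; infer_instance
  · change Surjective π₁; infer_instance

end IsFppfCover

end Covers

/-! ### Group functors, torsors and descent data -/

section Torsors
variable {S : Scheme.{u}}

/-- A functor from `S`-schemes to groups. -/
structure GroupFunctor (S : Scheme.{u}) where
  pts : Over S → Type u
  [group : ∀ T, Group (pts T)]
  res : ∀ {T' T : Over S}, (T' ⟶ T) → pts T →* pts T'

attribute [instance] GroupFunctor.group

/-- An action of a group functor `G` on `Z` such that `π : Z ⟶ Y` is the quotient of `Z` by `G` in
the category of fppf sheaves. -/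
structure QuotientAction (G : GroupFunctor S) {Z Y : Over S} (π : Z ⟶ Y) where
  act : ∀ {T : Over S}, G.pts T → (T ⟶ Z) → (T ⟶ Z)
  one_act : ∀ {T : Over S} (x : T ⟶ Z), act 1 x = x
  mul_act : ∀ {T : Over S} (g h : G.pts T) (x : T ⟶ Z), act (g * h) x = act g (act h x)
  comp_act : ∀ {T' T : Over S} (f : T' ⟶ T) (g : G.pts T) (x : T ⟶ Z),
    f ≫ act g x = act (G.res f g) (f ≫ x)
  invariant : ∀ {T : Over S} (g : G.pts T) (x : T ⟶ Z), act g x ≫ π = x ≫ π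
  lift : ∀ {T : Over S} (y : T ⟶ Y), ∃ (T' : Over S) (p : T' ⟶ T), IsFppfCover p ∧
    ∃ x : T' ⟶ Z, x ≫ π = p ≫ y
  transitive : ∀ {T : Over S} (x x' : T ⟶ Z), x ≫ π = x' ≫ π →
    ∃ (T' : Over S) (p : T' ⟶ T), IsFppfCover p ∧ ∃ g : G.pts T', act g (p ≫ x) = p ≫ x'

/-- A linear representation of a group functor on the trivial bundle with fibre `k^ι`. -/
structure Rep (G : GroupFunctor S) (ι : Type) [Fintype ι] [DecidableEq ι] where
  hom : ∀ {T : Over S}, G.pts T →* GL ι (Fn T)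
  natural : ∀ {T' T : Over S} (f : T' ⟶ T) (g : G.pts T),
    (hom (G.res f g)).1 = (hom g).1.map (fnMap f)

variable {ι : Type} [Fintype ι] [DecidableEq ι]

/-- A descent datum, for a morphism `π : Z ⟶ Y`, on the trivial bundle with fibre `k^ι` on `Z`. -/
structure DescentDatum {Z Y : Over S} (π : Z ⟶ Y) (ι : Type) [Fintype ι] [DecidableEq ι] where
  mat : ∀ {T : Over S} (z z' : T ⟶ Z), z ≫ π = z' ≫ π → Matrix ι ι (Fn T)
  natural : ∀ {T' T : Over S} (f : T' ⟶ T) (z z' : T ⟶ Z) (h : z ≫ π = z' ≫ π),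
    (mat z z' h).map (fnMap f) = mat (f ≫ z) (f ≫ z')
      (by rw [Category.assoc, h, Category.assoc])
  self : ∀ {T : Over S} (z : T ⟶ Z), mat z z rfl = 1
  comp : ∀ {T : Over S} (z z' z'' : T ⟶ Z) (h : z ≫ π = z' ≫ π) (h' : z' ≫ π = z'' ≫ π),
    mat z' z'' h' * mat z z' h = mat z z'' (h.trans h')

theorem IsFppfCover.matrix_map_injective {m n : Type*} {T' T : Over S} {p : T' ⟶ T}
    (hp : IsFppfCover p) {M N : Matrix m n (Fn T)} (h : M.map (fnMap p) = N.map (fnMap p)) :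
    M = N := by
  ext a b
  exact hp.fnMap_injective congr($h a b)

theorem IsFppfCover.exists_matrix_map_eq {m n : Type*} {T' T : Over S} {p : T' ⟶ T}
    (hp : IsFppfCover p) (M : Matrix m n (Fn T'))
    (hM : ∀ {T'' : Over S} (a b : T'' ⟶ T'), a ≫ p = b ≫ p → M.map (fnMap a) = M.map (fnMap b)) :
    ∃ N : Matrix m n (Fn T), N.map (fnMap p) = M := by
  have h : ∀ a b, ∃ t : Fn T, fnMap p t = M a b := fun a b =>
    hp.exists_fnMap_eq (M a b) fun c d hcd => congr($(hM c d hcd) a b)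
  choose N hN using h
  exact ⟨Matrix.of N, by ext a b; exact hN a b⟩

theorem map_fnMap_comp {m n : Type*} {T'' T' T : Over S} (g : T'' ⟶ T') (f : T' ⟶ T)
    (M : Matrix m n (Fn T)) : M.map (fnMap (g ≫ f)) = (M.map (fnMap f)).map (fnMap g) := rfl

namespace QuotientAction
variable {G : GroupFunctor S} {Z Y : Over S} {π : Z ⟶ Y} (𝒜 : QuotientAction G π) (ρ : Rep G ι)

/-- The stabilisers of all points act trivially in the representation `ρ`. -/
def IsHonest : Prop := ∀ ⦃T : Over S⦄ (g : G.pts T) (z : T ⟶ Z), 𝒜.act g z = z → ρ.hom g = 1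

variable {𝒜 ρ}

/-- Two group elements with the same effect on `z` differ by an element of the stabiliser. -/
theorem IsHonest.hom_eq (hρ : 𝒜.IsHonest ρ) {T : Over S} {g g' : G.pts T} {z : T ⟶ Z}
    (h : 𝒜.act g z = 𝒜.act g' z) : ρ.hom g = ρ.hom g' := by
  have h1 : 𝒜.act (g'⁻¹ * g) z = z := by
    rw [𝒜.mul_act, h, ← 𝒜.mul_act, inv_mul_cancel, 𝒜.one_act]
  have h2 := hρ _ _ h1
  rw [map_mul, map_inv, inv_mul_eq_one] at h2
  exact h2.symm

/-- Fppf-locally `z' = g z`. The element `g` is not unique, but `ρ(g)` is by `hom_eq`, so this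
matrix descends to `T`. -/
theorem IsHonest.exists_mat (hρ : 𝒜.IsHonest ρ) {T : Over S} (z z' : T ⟶ Z)
    (h : z ≫ π = z' ≫ π) : ∃ C : Matrix ι ι (Fn T), ∀ {T' : Over S} (f : T' ⟶ T) (g : G.pts T'),
      𝒜.act g (f ≫ z) = f ≫ z' → C.map (fnMap f) = (ρ.hom g).1 := by
  obtain ⟨T', p, hp, g, hg⟩ := 𝒜.transitive z z' h
  obtain ⟨C, hC⟩ := hp.exists_matrix_map_eq (ρ.hom g).1 (by
    intro T'' a b hab
    rw [← ρ.natural, ← ρ.natural]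
    refine congrArg Units.val (hρ.hom_eq (z := (a ≫ p) ≫ z) ?_)
    conv_rhs => rw [hab]
    rw [Category.assoc, Category.assoc, ← 𝒜.comp_act, ← 𝒜.comp_act, hg, reassoc_of% hab])
  refine ⟨C, fun {U} f g' hg' => ?_⟩
  obtain ⟨U', q, f', hq, hf'⟩ := hp.exists_base_change f
  refine hq.matrix_map_injective ?_
  rw [← map_fnMap_comp, ← hf', map_fnMap_comp, hC, ← ρ.natural, ← ρ.natural]
  refine congrArg Units.val (hρ.hom_eq (z := (f' ≫ p) ≫ z) ?_)
  conv_rhs => rw [hf']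
  rw [Category.assoc, Category.assoc, ← 𝒜.comp_act, ← 𝒜.comp_act, hg, hg', reassoc_of% hf']

/-- The descent datum given by a representation in which stabilisers act trivially. -/
def IsHonest.datum (hρ : 𝒜.IsHonest ρ) : DescentDatum π ι where
  mat z z' h := (hρ.exists_mat z z' h).choose
  natural f z z' h := by
    obtain ⟨T', p, hp, g, hg⟩ := 𝒜.transitive (f ≫ z) (f ≫ z')
      (by rw [Category.assoc, h, Category.assoc])
    refine hp.matrix_map_injective ?_
    rw [(hρ.exists_mat (f ≫ z) (f ≫ z') (by rw [Category.assoc, h, Category.assoc])).choose_spec p g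
      hg, ← map_fnMap_comp]
    refine (hρ.exists_mat z z' h).choose_spec (p ≫ f) g ?_
    simpa only [Category.assoc] using hg
  self {T} z := by
    have := (hρ.exists_mat z z rfl).choose_spec (𝟙 T) 1 (𝒜.one_act _)
    rw [map_one] at this
    ext a b
    rw [← fnMap_id_apply ((hρ.exists_mat z z rfl).choose a b)]
    exact congr($this a b)
  comp z z' z'' h h' := by
    obtain ⟨T', p, hp, g, hg⟩ := 𝒜.transitive z z' h
    obtain ⟨T'', q, hq, g', hg'⟩ := 𝒜.transitive (p ≫ z') (p ≫ z'')
      (by rw [Category.assoc, h', Category.assoc])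
    have e1 : 𝒜.act (G.res q g) ((q ≫ p) ≫ z) = (q ≫ p) ≫ z' := by
      rw [Category.assoc, ← 𝒜.comp_act, hg, Category.assoc]
    have e2 : 𝒜.act g' ((q ≫ p) ≫ z') = (q ≫ p) ≫ z'' := by
      rw [Category.assoc, hg', Category.assoc]
    refine (hq.comp hp).matrix_map_injective ?_
    rw [Matrix.map_mul, (hρ.exists_mat z z' h).choose_spec (q ≫ p) (G.res q g) e1,
      (hρ.exists_mat z' z'' h').choose_spec (q ≫ p) g' e2,
      (hρ.exists_mat z z'' (h.trans h')).choose_spec (q ≫ p) (g' * G.res q g) (by rw [𝒜.mul_act, e1, e2]),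
      map_mul, Units.val_mul]

theorem IsHonest.datum_mat (hρ : 𝒜.IsHonest ρ) {T : Over S} (z z' : T ⟶ Z)
    (h : z ≫ π = z' ≫ π) (g : G.pts T) (hg : 𝒜.act g z = z') :
    hρ.datum.mat z z' h = (ρ.hom g).1 := by
  have := (hρ.exists_mat z z' h).choose_spec (𝟙 T) g
    (by rw [Category.id_comp, Category.id_comp, hg])
  ext a b
  rw [← this]
  exact (fnMap_id_apply _).symm

end QuotientAction

/-! ### Equivariant functions -/

section Equivariant
variable {Z Y : Over S} {π : Z ⟶ Y}

/-- The value at a point `z` of a function on `π⁻¹(V)`. -/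
def evalAt {V : Y.left.Opens} {T : Over S} (z : T ⟶ Z) (hz : ⊤ ≤ z.left ⁻¹ᵁ (π.left ⁻¹ᵁ V)) :
    Γ(Z.left, π.left ⁻¹ᵁ V) →+* Fn T :=
  (z.left.appLE (π.left ⁻¹ᵁ V) ⊤ hz).hom

theorem preimage_comp_top {V : Y.left.Opens} {T T' : Over S} (f : T' ⟶ T) {z : T ⟶ Z}
    (hz : ⊤ ≤ z.left ⁻¹ᵁ (π.left ⁻¹ᵁ V)) : ⊤ ≤ (f ≫ z).left ⁻¹ᵁ (π.left ⁻¹ᵁ V) :=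
  fun _ _ => hz trivial

theorem fnMap_evalAt {V : Y.left.Opens} {T T' : Over S} (f : T' ⟶ T) (z : T ⟶ Z)
    (hz : ⊤ ≤ z.left ⁻¹ᵁ (π.left ⁻¹ᵁ V)) (s : Γ(Z.left, π.left ⁻¹ᵁ V)) :
    fnMap f (evalAt z hz s) = evalAt (f ≫ z) (preimage_comp_top f hz) s := by
  have h := Scheme.Hom.appLE_comp_appLE f.left z.left (π.left ⁻¹ᵁ V) ⊤ ⊤ hz le_top
  have h2 : f.left.appLE ⊤ ⊤ le_top = f.left.appTop := by
    rw [Scheme.Hom.appTop, Scheme.Hom.app_eq_appLE]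
    rfl
  rw [h2] at h
  exact congr($h s)

theorem evalAt_resPreimage {V V' : Y.left.Opens} (i : V' ≤ V) {T : Over S} (z : T ⟶ Z)
    (hz : ⊤ ≤ z.left ⁻¹ᵁ (π.left ⁻¹ᵁ V')) (s : Γ(Z.left, π.left ⁻¹ᵁ V)) :
    evalAt z hz (resPreimage π i s) = evalAt z
      (hz.trans (z.left.preimage_mono (π.left.preimage_mono i))) s :=
  appLE_resPreimage i z hz s

/-- A vector of functions on `π⁻¹(V)` that is compatible with the descent datum. -/
def DescentDatum.IsEquivariantOver (C : DescentDatum π ι) (V : Y.left.Opens)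
    (M : ι → Γ(Z.left, π.left ⁻¹ᵁ V)) : Prop :=
  ∀ (T : Over S) (z z' : T ⟶ Z) (h : z ≫ π = z' ≫ π) (hz : ⊤ ≤ z.left ⁻¹ᵁ (π.left ⁻¹ᵁ V))
    (hz' : ⊤ ≤ z'.left ⁻¹ᵁ (π.left ⁻¹ᵁ V)),
      evalAt z' hz' ∘ M = C.mat z z' h *ᵥ (evalAt z hz ∘ M)

/-- A vector `M` of functions on `π⁻¹(V)` such that `M(g z) = ρ(g) M(z)`. -/
def QuotientAction.IsEquivariantOver {G : GroupFunctor S} (𝒜 : QuotientAction G π) (ρ : Rep G ι)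
    (V : Y.left.Opens) (M : ι → Γ(Z.left, π.left ⁻¹ᵁ V)) : Prop :=
  ∀ (T : Over S) (z z' : T ⟶ Z) (g : G.pts T), 𝒜.act g z = z' →
    ∀ (hz : ⊤ ≤ z.left ⁻¹ᵁ (π.left ⁻¹ᵁ V)) (hz' : ⊤ ≤ z'.left ⁻¹ᵁ (π.left ⁻¹ᵁ V)),
      evalAt z' hz' ∘ M = (ρ.hom g).1 *ᵥ (evalAt z hz ∘ M)

theorem map_mulVec_fnMap {ι : Type*} [Fintype ι] {T' T : Over S} (f : T' ⟶ T) (C : Matrix ι ι (Fn T)) (v : ι → Fn T) :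
    fnMap f ∘ (C *ᵥ v) = C.map (fnMap f) *ᵥ (fnMap f ∘ v) := by
  ext a
  exact RingHom.map_mulVec (fnMap f) C v a

/-- Points in one fibre of `π` are fppf-locally conjugate, and equality of functions can be tested
on a covering. -/
theorem QuotientAction.IsHonest.isEquivariantOver_iff {G : GroupFunctor S}
    {𝒜 : QuotientAction G π} {ρ : Rep G ι} (hρ : 𝒜.IsHonest ρ) (V : Y.left.Opens)
    (M : ι → Γ(Z.left, π.left ⁻¹ᵁ V)) :
    hρ.datum.IsEquivariantOver V M ↔ 𝒜.IsEquivariantOver ρ V M := by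
  refine ⟨fun hM T z z' g hg hz hz' => ?_, fun hM T z z' h hz hz' => ?_⟩
  · have h : z ≫ π = z' ≫ π := by rw [← hg, 𝒜.invariant]
    rw [hM T z z' h hz hz', hρ.datum_mat z z' h g hg]
  · obtain ⟨T', p, hp, g, hg⟩ := 𝒜.transitive z z' h
    have h1 : fnMap p ∘ (evalAt z' hz' ∘ M) =
        fnMap p ∘ (hρ.datum.mat z z' h *ᵥ (evalAt z hz ∘ M)) := by
      have h2 := hM T' _ _ g hg (preimage_comp_top p hz) (preimage_comp_top p hz')
      rw [map_mulVec_fnMap, hρ.datum.natural, hρ.datum_mat _ _ _ g hg]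
      have h3 : ∀ (w : T ⟶ Z) (hw : ⊤ ≤ w.left ⁻¹ᵁ (π.left ⁻¹ᵁ V)),
          fnMap p ∘ (evalAt w hw ∘ M) = evalAt (p ≫ w) (preimage_comp_top p hw) ∘ M :=
        fun w hw => funext fun a => fnMap_evalAt p w hw (M a)
      rw [h3, h3]
      exact h2
    exact funext fun a => hp.fnMap_injective (congrFun h1 a)

end Equivariant
end Torsors

/-! ### Descent for modules over a field -/

section FieldDescent
variable {K : Type*} [Field K] {B : Type*} [CommRing B] [Algebra K B]
  {ι : Type} [Fintype ι]

/-- The vectors that are invariant under a descent datum. -/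
def invariants (C : Matrix ι ι (B ⊗[K] B)) : Submodule K (ι → B) where
  carrier := {v | C *ᵥ (fun a => v a ⊗ₜ 1) = fun a => 1 ⊗ₜ v a}
  zero_mem' := by
    ext a
    simp [Matrix.mulVec, dotProduct]
  add_mem' := by
    intro v w hv hw
    simp only [Set.mem_ofPred_eq, Pi.add_apply, TensorProduct.add_tmul, TensorProduct.tmul_add] at *
    change C *ᵥ ((fun a => v a ⊗ₜ 1) + fun a => w a ⊗ₜ 1) = _
    rw [Matrix.mulVec_add, hv, hw]
    rfl
  smul_mem' := by
    intro c v hv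
    simp only [Set.mem_ofPred_eq, Pi.smul_apply, TensorProduct.tmul_smul] at *
    change C *ᵥ (c • fun a => v a ⊗ₜ 1) = _
    rw [Matrix.mulVec_smul, hv]
    rfl

theorem mem_invariants {C : Matrix ι ι (B ⊗[K] B)} {v : ι → B} :
    v ∈ invariants C ↔ C *ᵥ (fun a => v a ⊗ₜ 1) = fun a => 1 ⊗ₜ v a := Iff.rfl

/-- Linearly independent elements remain linearly independent after extension of scalars. -/
theorem eq_zero_of_sum_tmul_eq_zero {M N : Type*} [AddCommGroup M] [Module K M] [AddCommGroup N]
    [Module K N] {I : Type*} {v : I → N} (hv : LinearIndependent K v) (s : Finset I) (c : I → M)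
    (h : ∑ i ∈ s, c i ⊗ₜ[K] v i = 0) : ∀ i ∈ s, c i = 0 := by
  classical
  intro i hi
  -- A linear left inverse of the linear combination map yields functionals dual to the family `v`,
  -- which are applied to the second tensor factor.
  obtain ⟨g, hg⟩ := (Finsupp.linearCombination K v).exists_leftInverse_of_injective
    (LinearMap.ker_eq_bot.2 hv)
  have hf : ∀ i', ((Finsupp.lapply i : (I →₀ K) →ₗ[K] K) ∘ₗ g) (v i') =
      if i' = i then 1 else 0 := by
    intro i'
    have := congr($hg (Finsupp.single i' 1))
    simp only [LinearMap.comp_apply, Finsupp.linearCombination_single, one_smul,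
      LinearMap.id_apply] at this ⊢
    rw [this, Finsupp.lapply_apply, Finsupp.single_apply]
  have h1 := congrArg (fun t => TensorProduct.rid K M
    (((Finsupp.lapply i : (I →₀ K) →ₗ[K] K) ∘ₗ g).lTensor M t)) h
  simp only [map_sum, LinearMap.lTensor_tmul, hf, TensorProduct.rid_tmul, map_zero, ite_smul,
    one_smul, zero_smul] at h1
  rwa [Finset.sum_ite_eq' s i, if_pos hi] at h1

/-- Applying `C` to a relation `∑ c i • v i = 0` turns it into `∑ c i ⊗ v i = 0`, where the
independence over `K` can be used. -/
theorem linearIndependent_of_invariants {C : Matrix ι ι (B ⊗[K] B)} {I : Type*}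
    {v : I → ι → B} (hv : LinearIndependent K v) (hC : ∀ i, v i ∈ invariants C) :
    LinearIndependent B v := by
  rw [linearIndependent_iff']
  intro s c hc
  have h1 : ∀ a, ∑ i ∈ s, c i ⊗ₜ[K] v i a = 0 := by
    intro a
    have h2 : C *ᵥ (fun a => (∑ i ∈ s, c i • v i) a ⊗ₜ[K] (1 : B)) =
        fun a => ∑ i ∈ s, c i ⊗ₜ[K] v i a := by
      have : (fun a => (∑ i ∈ s, c i • v i) a ⊗ₜ[K] (1 : B)) =
          ∑ i ∈ s, (c i ⊗ₜ[K] (1 : B)) • fun a => v i a ⊗ₜ[K] (1 : B) := by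
        ext a
        simp [Finset.sum_apply, TensorProduct.sum_tmul]
      rw [this, Matrix.mulVec_sum]
      ext a
      simp only [Matrix.mulVec_smul, mem_invariants.1 (hC _)]
      simp [Finset.sum_apply]
    rw [hc] at h2
    rw [← congrFun h2 a]
    simp [Matrix.mulVec, dotProduct]
  refine eq_zero_of_sum_tmul_eq_zero hv s c ?_
  classical
  apply (TensorProduct.piRight K K B fun _ : ι => B).injective
  ext a
  simp only [map_sum, Finset.sum_apply, map_zero, Pi.zero_apply]
  simpa using h1 a

/-- Descent of vector spaces: `C` is the matrix of an isomorphism from the pullback along the first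
projection to the pullback along the second one. -/
theorem exists_basis_invariants [DecidableEq ι] [Nontrivial B] {C : Matrix ι ι (B ⊗[K] B)}
    (h1 : C.map (Algebra.TensorProduct.lmul' K (S := B)) = 1)
    (h2 : C.map (Algebra.TensorProduct.includeRight : B ⊗[K] B →ₐ[K] B ⊗[K] (B ⊗[K] B)) *
      C.map (Algebra.TensorProduct.map (AlgHom.id K B)
        (Algebra.TensorProduct.includeLeft : B →ₐ[K] B ⊗[K] B)) =
      C.map (Algebra.TensorProduct.map (AlgHom.id K B)
        (Algebra.TensorProduct.includeRight : B →ₐ[K] B ⊗[K] B))) :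
    ∃ (b : Module.Basis ι K (invariants C)),
      LinearIndependent B (fun i => (b i : ι → B)) ∧
      Submodule.span B (Set.range fun i => (b i : ι → B)) = ⊤ := by
  -- Expand `C (v ⊗ 1) = ∑ β k ⊗ n k` in a `K`-basis `β` of `B`. Restriction to the diagonal
  -- expresses `v` as a combination of the vectors `n k`, and the cocycle condition makes each `n k`
  -- invariant.
  have key : ∀ v : ι → B, v ∈ Submodule.span B (invariants C : Set (ι → B)) := by
    intro v
    classical
    let β := Module.Basis.ofVectorSpace K B
    let θ := C *ᵥ fun a => v a ⊗ₜ[K] (1 : B)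
    let e := TensorProduct.equivFinsuppOfBasisLeft (N := B) β
    let s := Finset.univ.biUnion fun a => (e (θ a)).support
    let n := fun k a => e (θ a) k
    have hθ : ∀ a, θ a = ∑ k ∈ s, β k ⊗ₜ[K] n k a := by
      intro a
      have h3 : e.symm (e (θ a)) = _ := TensorProduct.equivFinsuppOfBasisLeft_symm_apply β _
      rw [e.symm_apply_apply] at h3
      refine h3.trans (Finset.sum_subset
        (Finset.subset_biUnion_of_mem (fun a => (e (θ a)).support) (Finset.mem_univ a)) ?_)
      intro k _ hk
      rw [Finsupp.notMem_support_iff.1 hk]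
      exact TensorProduct.tmul_zero _ _
    have hmap : ∀ {R' : Type _} [CommRing R'] [Algebra K R'] (f : B ⊗[K] B →ₐ[K] R') (a : ι),
        (C.map f *ᵥ fun a => f (v a ⊗ₜ 1)) a = ∑ k ∈ s, f (β k ⊗ₜ n k a) := by
      intro R' _ _ f a
      rw [← map_sum, ← hθ]
      exact (RingHom.map_mulVec (f : B ⊗[K] B →+* R') C _ a).symm
    have hv : v = ∑ k ∈ s, β k • n k := by
      ext a
      have h3 := hmap (Algebra.TensorProduct.lmul' K (S := B)) a
      rw [h1] at h3
      simpa [Finset.sum_apply] using h3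
    rw [hv]
    refine Submodule.sum_mem _ fun k hk => Submodule.smul_mem _ _ (Submodule.subset_span ?_)
    -- The cocycle condition applied to `v ⊗ 1 ⊗ 1` reads `∑ β k ⊗ C (n k ⊗ 1) = ∑ β k ⊗ 1 ⊗ n k`;
    -- now compare coefficients of the independent family `β`.
    refine funext fun a => ?_
    rw [← sub_eq_zero]
    refine eq_zero_of_sum_tmul_eq_zero β.linearIndependent s
      (fun k => (C *ᵥ fun a => n k a ⊗ₜ[K] (1 : B)) a - 1 ⊗ₜ n k a) ?_ k hk
    apply (TensorProduct.comm K _ _).injective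
    simp only [map_sum, TensorProduct.comm_tmul, TensorProduct.tmul_sub, Finset.sum_sub_distrib,
      map_zero, sub_eq_zero]
    have h3 := congr($h2 *ᵥ (fun a => v a ⊗ₜ[K] ((1 : B) ⊗ₜ[K] (1 : B))))
    rw [← Matrix.mulVec_mulVec] at h3
    have h4 := funext (hmap (Algebra.TensorProduct.map (AlgHom.id K B)
        (Algebra.TensorProduct.includeLeft : B →ₐ[K] B ⊗[K] B)))
    have h5 := funext (hmap (Algebra.TensorProduct.map (AlgHom.id K B)
        (Algebra.TensorProduct.includeRight : B →ₐ[K] B ⊗[K] B)))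
    simp only [Algebra.TensorProduct.map_tmul, AlgHom.id_apply, map_one,
      Algebra.TensorProduct.includeLeft_apply, Algebra.TensorProduct.includeRight_apply,
      Algebra.TensorProduct.one_def] at h4 h5
    rw [h4, h5] at h3
    refine Eq.trans ?_ (congrFun h3 a)
    simp only [Matrix.mulVec, dotProduct, TensorProduct.tmul_sum, Matrix.map_apply,
      Algebra.TensorProduct.includeRight_apply, Finset.mul_sum]
    rw [Finset.sum_comm]
    refine Finset.sum_congr rfl fun c _ => Finset.sum_congr rfl fun k _ => ?_
    rw [Algebra.TensorProduct.tmul_mul_tmul, one_mul]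
  -- A `K`-basis of the invariants is also a `B`-basis of `ι → B`, so its index set is in bijection
  -- with `ι`.
  let b0 := Module.Basis.ofVectorSpace K (invariants C)
  have hli : LinearIndependent B fun i => (b0 i : ι → B) :=
    linearIndependent_of_invariants
      (b0.linearIndependent.map' (invariants C).subtype (Submodule.ker_subtype _)) fun i => (b0 i).2
  have hsp : ⊤ ≤ Submodule.span B (Set.range fun i => (b0 i : ι → B)) := by
    intro v _
    refine Submodule.span_le.2 ?_ (key v)
    intro w hw
    have h3 := congrArg (invariants C).subtype (b0.linearCombination_repr ⟨w, hw⟩)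
    rw [Finsupp.linearCombination_apply, Finsupp.sum, map_sum] at h3
    rw [← show _ = w from h3]
    refine Submodule.sum_mem _ fun i _ => ?_
    rw [map_smul, ← algebraMap_smul B]
    exact Submodule.smul_mem _ _ (Submodule.subset_span ⟨i, rfl⟩)
  let b1 := Module.Basis.mk hli hsp
  let e := b1.indexEquiv (Pi.basisFun B ι)
  refine ⟨b0.reindex e, ?_, ?_⟩
  · simp only [Module.Basis.reindex_apply]
    exact hli.comp _ e.symm.injective
  · simp only [Module.Basis.reindex_apply]
    rw [eq_top_iff]
    refine hsp.trans (Submodule.span_mono ?_)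
    rintro _ ⟨i, rfl⟩
    exact ⟨e i, by simp⟩

end FieldDescent

/-! ### Points with values in rings -/

section RingPoints
variable {S : Scheme.{u}} {Z Y : Over S} {π : Z ⟶ Y} {ι : Type} [Fintype ι] [DecidableEq ι]

/-- The functions on the spectrum of `A`. -/
def specFn (A : Type u) [CommRing A] : Γ(Spec (.of A), ⊤) ≃+* A :=
  (Scheme.ΓSpecIso (.of A)).commRingCatIsoToRingEquiv

/-- The morphism of spectra given by a ring homomorphism. -/
abbrev specMap {A B : Type u} [CommRing A] [CommRing B] (φ : A →+* B) :
    Spec (.of B) ⟶ Spec (.of A) := Spec.map (CommRingCat.ofHom φ)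

theorem specFn_appTop {A B : Type u} [CommRing A] [CommRing B] (φ : A →+* B)
    (a : Γ(Spec (.of A), ⊤)) : specFn B ((specMap φ).appTop a) = φ (specFn A a) :=
  congr($(Scheme.ΓSpecIso_naturality (CommRingCat.ofHom φ)) a)

/-- The `S`-scheme `Spec A` attached to an `A`-valued point. -/
abbrev ptOver {A : Type u} [CommRing A] (a : Spec (.of A) ⟶ Z.left) : Over S :=
  Over.mk (a ≫ Z.hom)

/-- An `A`-valued point as a morphism of `S`-schemes. -/
abbrev ptHom {A : Type u} [CommRing A] (a : Spec (.of A) ⟶ Z.left) : ptOver a ⟶ Z :=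
  Over.homMk a rfl

/-- A second `A`-valued point with the same image in `Y`. -/
abbrev ptHom' {A : Type u} [CommRing A] {a b : Spec (.of A) ⟶ Z.left}
    (h : a ≫ π.left = b ≫ π.left) : ptOver a ⟶ Z :=
  Over.homMk b (by
    change b ≫ Z.hom = a ≫ Z.hom
    rw [← Over.w π, reassoc_of% h])

namespace DescentDatum
variable (C : DescentDatum π ι)

theorem ptHom_comp {A : Type u} [CommRing A] {a b : Spec (.of A) ⟶ Z.left}
    (h : a ≫ π.left = b ≫ π.left) : ptHom a ≫ π = ptHom' h ≫ π := by
  ext1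
  exact h

/-- The matrix of a descent datum at a pair of `A`-valued points. -/
def ringMat {A : Type u} [CommRing A] (a b : Spec (.of A) ⟶ Z.left)
    (h : a ≫ π.left = b ≫ π.left) : Matrix ι ι A :=
  (C.mat (ptHom a) (ptHom' h) (ptHom_comp h)).map (specFn A)

theorem ringMat_self {A : Type u} [CommRing A] (a : Spec (.of A) ⟶ Z.left) :
    C.ringMat a a rfl = 1 := by
  have := C.self (ptHom a)
  rw [ringMat]
  rw [this]
  exact (specFn A).toRingHom.mapMatrix.map_one

theorem ringMat_comp {A : Type u} [CommRing A] (a b c : Spec (.of A) ⟶ Z.left)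
    (h : a ≫ π.left = b ≫ π.left) (h' : b ≫ π.left = c ≫ π.left) :
    C.ringMat b c h' * C.ringMat a b h = C.ringMat a c (h.trans h') := by
  have hab : a ≫ Z.hom = b ≫ Z.hom := by rw [← Over.w π, reassoc_of% h]
  -- The matrices at `(a, b)` and at `(b, c)` are formed over `Spec A` with two structure morphisms
  -- to `S` that agree only propositionally. Generalising over the structure morphism identifies
  -- them.
  have key : ∀ (f : Spec (.of A) ⟶ S) (hf : a ≫ Z.hom = f) (hf' : b ≫ Z.hom = f)
      (hf'' : c ≫ Z.hom = f), C.ringMat b c h' =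
      (C.mat (T := Over.mk f) (Over.homMk b hf') (Over.homMk c hf'')
        (by ext1; exact h')).map (specFn A) := by
    rintro _ _ rfl _
    rfl
  rw [key (a ≫ Z.hom) rfl hab.symm (by rw [← Over.w π, ← reassoc_of% h', ← reassoc_of% h])]
  rw [ringMat, ringMat, ← C.comp (ptHom a) (ptHom' h) (ptHom' (h.trans h'))
    (ptHom_comp h) (by ext1; exact h')]
  exact ((specFn A).toRingHom.mapMatrix.map_mul _ _).symm

theorem ringMat_map {A B : Type u} [CommRing A] [CommRing B] (φ : A →+* B)
    (a b : Spec (.of A) ⟶ Z.left) (h : a ≫ π.left = b ≫ π.left) :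
    (C.ringMat a b h).map φ = C.ringMat (specMap φ ≫ a) (specMap φ ≫ b)
      (by rw [Category.assoc, h, Category.assoc]) := by
  have h1 := C.natural (T' := ptOver (specMap φ ≫ a)) (T := ptOver a) (Over.homMk (specMap φ)
    (Category.assoc _ _ _).symm) (ptHom a) (ptHom' h) (ptHom_comp h)
  have h2 := congrArg (fun M => M.map (specFn B)) h1
  refine Eq.trans ?_ h2
  ext i j
  exact (specFn_appTop φ _).symm

theorem ringMat_congr {A : Type u} [CommRing A] {a a' b b' : Spec (.of A) ⟶ Z.left}
    (ha : a = a') (hb : b = b') (h : a ≫ π.left = b ≫ π.left) :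
    C.ringMat a b h = C.ringMat a' b' (by rw [← ha, h, hb]) := by
  subst ha hb
  rfl

theorem includeLeft_specMap {K : Type u} [Field K] {A : Type u} [CommRing A]
    [Algebra K A] {y : Spec (.of K) ⟶ Y.left} {x : Spec (.of A) ⟶ Z.left}
    (hx : x ≫ π.left = specMap (algebraMap K A) ≫ y) :
    (specMap (Algebra.TensorProduct.includeLeftRingHom : A →+* A ⊗[K] A) ≫ x) ≫ π.left =
      (specMap (Algebra.TensorProduct.includeRight : A →ₐ[K] A ⊗[K] A).toRingHom ≫ x) ≫
        π.left := by
  rw [Category.assoc, Category.assoc, hx, ← Spec.map_comp_assoc, ← Spec.map_comp_assoc,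
    ← CommRingCat.ofHom_comp, ← CommRingCat.ofHom_comp]
  congr 3
  ext c
  simp

/-- The matrix comparing the two pullbacks of an `A`-valued point to `A ⊗ A`. -/
def tensorMat {K : Type u} [Field K] {A : Type u} [CommRing A]
    [Algebra K A] {y : Spec (.of K) ⟶ Y.left} {x : Spec (.of A) ⟶ Z.left}
    (hx : x ≫ π.left = specMap (algebraMap K A) ≫ y) : Matrix ι ι (A ⊗[K] A) :=
  C.ringMat _ _ (includeLeft_specMap hx)

theorem specMap_comp {A B D : Type u} [CommRing A] [CommRing B] [CommRing D] (φ : A →+* B)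
    (ψ : B →+* D) : specMap ψ ≫ specMap φ = specMap (ψ.comp φ) := by
  rw [← Spec.map_comp, ← CommRingCat.ofHom_comp]

/-- The hypotheses of `exists_basis_invariants` are the unit and cocycle laws of the descent datum,
for the diagonal of `A` and for the three maps from `A` to the triple tensor product. -/
theorem exists_basis_tensorMat {K : Type u} [Field K] {A : Type u} [CommRing A]
    [Nontrivial A] [Algebra K A] {y : Spec (.of K) ⟶ Y.left} {x : Spec (.of A) ⟶ Z.left}
    (hx : x ≫ π.left = specMap (algebraMap K A) ≫ y) :
    ∃ (b : Module.Basis ι K (invariants (C.tensorMat hx))),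
      LinearIndependent A (fun i => (b i : ι → A)) ∧
      Submodule.span A (Set.range fun i => (b i : ι → A)) = ⊤ := by
  -- A ring map out of `A ⊗ A` is a pair of ring maps out of `A`; the image of the matrix is the
  -- value of the datum at the corresponding pair of points.
  have hc : ∀ {D : Type u} [CommRing D] (φ : A ⊗[K] A →+* D) (φ₁ φ₂ : A →+* D)
      (h₁ : φ.comp Algebra.TensorProduct.includeLeftRingHom = φ₁)
      (h₂ : φ.comp (Algebra.TensorProduct.includeRight : A →ₐ[K] A ⊗[K] A).toRingHom = φ₂),
      ∃ h, (C.tensorMat hx).map φ = C.ringMat (specMap φ₁ ≫ x) (specMap φ₂ ≫ x) h := by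
    rintro D _ φ _ _ rfl rfl
    refine ⟨?_, ?_⟩
    · rw [← specMap_comp, ← specMap_comp, Category.assoc, Category.assoc, Category.assoc,
        Category.assoc]
      congr 1
      simpa only [Category.assoc] using includeLeft_specMap hx
    · rw [tensorMat, ringMat_map]
      exact C.ringMat_congr (by rw [← specMap_comp, Category.assoc])
        (by rw [← specMap_comp, Category.assoc]) _
  refine exists_basis_invariants ?_ ?_
  · obtain ⟨h, e⟩ := hc (Algebra.TensorProduct.lmul' K (S := A)).toRingHom (.id A) (.id A)
      (by ext; simp) (by ext; simp)
    exact e.trans (C.ringMat_self _)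
  · let i₁ : A →+* A ⊗[K] (A ⊗[K] A) := Algebra.TensorProduct.includeLeftRingHom
    let r : A ⊗[K] A →+* A ⊗[K] (A ⊗[K] A) :=
      (Algebra.TensorProduct.includeRight : A ⊗[K] A →ₐ[K] A ⊗[K] (A ⊗[K] A)).toRingHom
    let i₂ := r.comp Algebra.TensorProduct.includeLeftRingHom
    let i₃ := r.comp (Algebra.TensorProduct.includeRight : A →ₐ[K] A ⊗[K] A).toRingHom
    obtain ⟨h, e⟩ := hc r i₂ i₃ rfl rfl
    obtain ⟨h', e'⟩ := hc (Algebra.TensorProduct.map (AlgHom.id K A)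
        (Algebra.TensorProduct.includeLeft : A →ₐ[K] A ⊗[K] A)).toRingHom i₁ i₂
        (by ext a; simp [i₁, Algebra.TensorProduct.one_def])
        (by ext a; simp [i₂, r])
    obtain ⟨h'', e''⟩ := hc (Algebra.TensorProduct.map (AlgHom.id K A)
        (Algebra.TensorProduct.includeRight : A →ₐ[K] A ⊗[K] A)).toRingHom i₁ i₃
        (by ext a; simp [i₁, Algebra.TensorProduct.one_def])
        (by ext a; simp [i₃, r])
    exact ((congr($e * $e')).trans (C.ringMat_comp _ _ _ h' h)).trans e''.symm

end DescentDatum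
end RingPoints

/-! ### Gluing of equivariant functions -/

section Spreading
variable {S : Scheme.{u}} {Z Y : Over S} {π : Z ⟶ Y} {ι : Type} [Fintype ι] [DecidableEq ι]

open Limits

/-- The image of a flat morphism locally of finite presentation. -/
def flatImage {X Y : Scheme.{u}} (f : X ⟶ Y) [Flat f] [LocallyOfFinitePresentation f] : Y.Opens :=
  ⟨Set.range f, f.isOpenMap.isOpen_range⟩

theorem exists_factor_open {T : Over S} (U : Z.left.Opens) (z : T ⟶ Z) (hz : ⊤ ≤ z.left ⁻¹ᵁ U) :
    ∃ l : T ⟶ Over.mk (U.ι ≫ Z.hom), l ≫ Over.homMk U.ι rfl = z := by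
  have hr : Set.range z.left ⊆ Set.range U.ι := by
    rintro _ ⟨t, rfl⟩
    rw [Scheme.Opens.range_ι]
    exact hz (Set.mem_univ t)
  refine ⟨Over.homMk (IsOpenImmersion.lift U.ι z.left hr) ?_, ?_⟩
  · change IsOpenImmersion.lift U.ι z.left hr ≫ U.ι ≫ Z.hom = T.hom
    rw [IsOpenImmersion.lift_fac_assoc, Over.w]
  · ext1
    exact IsOpenImmersion.lift_fac _ _ _

/-- The covering is the fibre product of `T` and `T₁` over `Y`; its projection to `T` is surjective
because `z` lands over the image of `y`. -/
theorem exists_cover_preimage {T₁ : Over S} (y : T₁ ⟶ Y) [Flat y.left]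
    [LocallyOfFinitePresentation y.left] {T : Over S} (z : T ⟶ Z)
    (hz : ⊤ ≤ z.left ⁻¹ᵁ (π.left ⁻¹ᵁ flatImage y.left)) :
    ∃ (T' : Over S) (p : T' ⟶ T) (t : T' ⟶ T₁), IsFppfCover p ∧ (p ≫ z) ≫ π = t ≫ y := by
  let p := pullback.fst (z ≫ π).left y.left
  refine ⟨Over.mk (p ≫ T.hom), Over.homMk p rfl,
    Over.homMk (pullback.snd (z ≫ π).left y.left) ?_, ⟨?_, ?_, ?_⟩, ?_⟩
  · change pullback.snd (z ≫ π).left y.left ≫ T₁.hom = p ≫ T.hom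
    rw [← Over.w y, ← Over.w (z ≫ π), ← pullback.condition_assoc]
  · change Flat p; infer_instance
  · change LocallyOfFinitePresentation p; infer_instance
  · refine ⟨fun t => ?_⟩
    obtain ⟨s, hs⟩ : (z ≫ π).left t ∈ Set.range y.left := hz (Set.mem_univ t)
    obtain ⟨w, hw, -⟩ := Scheme.Pullback.exists_preimage_pullback t s hs.symm
    exact ⟨w, hw⟩
  · ext1
    exact pullback.condition (f := (z ≫ π).left) (g := y.left)

/-- Gluing of functions on the preimage of an open set along an fppf covering. -/
theorem exists_glue {T₁ : Over S} (y : T₁ ⟶ Y) [Flat y.left]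
    [LocallyOfFinitePresentation y.left]
    (N : ∀ {T : Over S} (z : T ⟶ Z) (t : T ⟶ T₁), z ≫ π = t ≫ y → Fn T)
    (natural : ∀ {T' T : Over S} (f : T' ⟶ T) (z : T ⟶ Z) (t : T ⟶ T₁) (h : z ≫ π = t ≫ y),
      fnMap f (N z t h) = N (f ≫ z) (f ≫ t) (by rw [Category.assoc, h, Category.assoc]))
    (indep : ∀ {T : Over S} (z : T ⟶ Z) (t t' : T ⟶ T₁) (h : z ≫ π = t ≫ y)
      (h' : z ≫ π = t' ≫ y), N z t h = N z t' h') :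
    ∃ M : Γ(Z.left, π.left ⁻¹ᵁ flatImage y.left), ∀ {T : Over S} (z : T ⟶ Z)
      (hz : ⊤ ≤ z.left ⁻¹ᵁ (π.left ⁻¹ᵁ flatImage y.left)) (t : T ⟶ T₁) (h : z ≫ π = t ≫ y),
      evalAt z hz M = N z t h := by
  let U : Z.left.Opens := π.left ⁻¹ᵁ flatImage y.left
  -- It suffices to treat the universal point, the inclusion of `U = π⁻¹(V)`. It lifts to `T₁` on a
  -- covering, and independence of the lift is the descent condition for the value there.
  let z₀ : Over.mk (U.ι ≫ Z.hom) ⟶ Z := Over.homMk U.ι rfl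
  have hz₀ : ⊤ ≤ z₀.left ⁻¹ᵁ (π.left ⁻¹ᵁ flatImage y.left) := by
    change ⊤ ≤ U.ι ⁻¹ᵁ U
    rw [Scheme.Opens.ι_preimage_self]
  obtain ⟨T', p, t₀, hp, ht₀⟩ := exists_cover_preimage y z₀ hz₀
  obtain ⟨M₀, hM₀⟩ := hp.exists_fnMap_eq (N (p ≫ z₀) t₀ ht₀) (by
    intro T'' a b hab
    rw [natural, natural]
    have key : ∀ (w w' : T'' ⟶ Z) (h : w ≫ π = (a ≫ t₀) ≫ y) (h' : w' ≫ π = (b ≫ t₀) ≫ y),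
        w = w' → N w (a ≫ t₀) h = N w' (b ≫ t₀) h' := by
      rintro w _ h h' rfl
      exact indep _ _ _ _ _
    exact key _ _ _ _ (by rw [reassoc_of% hab]))
  have hM : ∃ M, evalAt z₀ hz₀ M = M₀ := by
    refine ⟨U.topIso.hom M₀, ?_⟩
    have h1 : evalAt z₀ hz₀ = U.topIso.inv.hom := by
      rw [evalAt]
      congr 1
      exact Scheme.Opens.ι_appLE U U ⊤ hz₀
    rw [h1]
    exact congr($(U.topIso.hom_inv_id) M₀)
  obtain ⟨M, hM⟩ := hM
  refine ⟨M, fun {T} z hz t h => ?_⟩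
  obtain ⟨l, rfl⟩ := exists_factor_open U z hz
  obtain ⟨T₂, q, l', hq, hl'⟩ := hp.exists_base_change l
  refine hq.fnMap_injective ?_
  have h2 : evalAt (l ≫ z₀) hz M = fnMap l M₀ := by rw [← hM, fnMap_evalAt]
  refine (congrArg _ h2).trans ?_
  rw [← fnMap_comp_apply, ← hl', fnMap_comp_apply, hM₀, natural, natural]
  have key : ∀ (w w' : T₂ ⟶ Z) (h : w ≫ π = (l' ≫ t₀) ≫ y) (h' : w' ≫ π = (q ≫ t) ≫ y),
      w = w' → N w (l' ≫ t₀) h = N w' (q ≫ t) h' := by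
    rintro w _ h h' rfl
    exact indep _ _ _ _ _
  exact key _ _ _ _ (by rw [reassoc_of% hl'])

end Spreading

/-! ### Sections over an fppf neighbourhood of the generic point -/

section LocalSections
variable {S : Scheme.{u}} {Z Y : Over S} {π : Z ⟶ Y} {ι : Type} [Fintype ι] [DecidableEq ι]

open Limits

/-- Inverting denominators is faithful on tensor squares of flat algebras. -/
theorem tensorSquare_injective {R K B : Type*} [CommRing R] [Field K] [Algebra R K]
    [IsFractionRing R K] [CommRing B] [Algebra R B] [Module.Flat R B] :
    Function.Injective (Algebra.TensorProduct.lift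
      (((Algebra.TensorProduct.includeLeft : K ⊗[R] B →ₐ[K] _).restrictScalars R).comp
        (Algebra.TensorProduct.includeRight : B →ₐ[R] K ⊗[R] B))
      (((Algebra.TensorProduct.includeRight : K ⊗[R] B →ₐ[K] _).restrictScalars R).comp
        (Algebra.TensorProduct.includeRight : B →ₐ[R] K ⊗[R] B)) (fun _ _ => Commute.all _ _) :
      B ⊗[R] B →ₐ[R] (K ⊗[R] B) ⊗[K] (K ⊗[R] B)) := by
  -- As `B ⊗ B` is flat over `R`, it embeds into its base change to `K`, which is the tensor square
  -- of `K ⊗ B` over `K`.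
  have h1 : Function.Injective (Algebra.TensorProduct.includeRight :
      B ⊗[R] B →ₐ[R] K ⊗[R] (B ⊗[R] B)) :=
    Algebra.TensorProduct.includeRight_injective (IsFractionRing.injective R K)
  let e := TensorProduct.AlgebraTensorModule.distribBaseChange R K B B
  have h2 := e.injective.comp h1
  convert! h2 using 1
  ext t
  induction t with
  | zero => simp
  | add x y hx hy => rw [map_add, hx, hy]; simp [map_add]
  | tmul x y =>
    simp [e]

theorem exists_smul_eq_one_tmul {R K B : Type*} [CommRing R] [IsDomain R] [Field K] [Algebra R K]
    [IsFractionRing R K] [CommRing B] [Algebra R B] (v : K ⊗[R] B) :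
    ∃ (c : R) (b : B), c ≠ 0 ∧ c • v = 1 ⊗ₜ b := by
  induction v with
  | zero => exact ⟨1, 0, one_ne_zero, by simp⟩
  | tmul k y =>
    obtain ⟨a, s, hs, rfl⟩ := IsFractionRing.div_surjective (A := R) k
    refine ⟨s, a • y, nonZeroDivisors.ne_zero hs, ?_⟩
    have hs' : algebraMap R K s ≠ 0 :=
      IsFractionRing.to_map_ne_zero_of_mem_nonZeroDivisors hs
    rw [TensorProduct.smul_tmul', Algebra.smul_def, mul_div_cancel₀ _ hs',
      Algebra.algebraMap_eq_smul_one, TensorProduct.smul_tmul]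
  | add x y hx hy =>
    obtain ⟨c, b, hc, hb⟩ := hx
    obtain ⟨c', b', hc', hb'⟩ := hy
    refine ⟨c' * c, c' • b + c • b', mul_ne_zero hc' hc, ?_⟩
    rw [smul_add, mul_smul, hb, mul_comm, mul_smul, hb', TensorProduct.tmul_add,
      TensorProduct.tmul_smul, TensorProduct.tmul_smul]

/-- Clearing denominators. -/
theorem exists_clear_denominators {R K B : Type*} [CommRing R] [IsDomain R] [Field K] [Algebra R K]
    [IsFractionRing R K] [CommRing B] [Algebra R B] {I : Type*} [Fintype I] (v : I → K ⊗[R] B) :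
    ∃ (c : R) (b : I → B), c ≠ 0 ∧ ∀ i, c • v i = 1 ⊗ₜ b i := by
  classical
  choose c b hc hb using fun i => exists_smul_eq_one_tmul (v i)
  refine ⟨∏ i, c i, fun i => (∏ j ∈ Finset.univ.erase i, c j) • b i,
    Finset.prod_ne_zero_iff.2 fun i _ => hc i, fun i => ?_⟩
  rw [← Finset.prod_erase_mul _ _ (Finset.mem_univ i), mul_smul, hb, TensorProduct.tmul_smul]

variable (π) in
/-- A section of `π` over a flat affine scheme `Spec B` of finite presentation over an affine
neighbourhood `Spec R` of the generic point of `Y`. -/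
structure LocalSection [IsIntegral Y.left] where
  R : Type u
  B : Type u
  [commRingR : CommRing R]
  [isDomain : IsDomain R]
  [algebraK : Algebra R Y.left.functionField]
  [isFractionRing : IsFractionRing R Y.left.functionField]
  [commRing : CommRing B]
  [nontrivial : Nontrivial B]
  [algebra : Algebra R B]
  [flat_algebra : Module.Flat R B]
  y : Spec (.of R) ⟶ Y.left
  [mono : Mono y]
  y_generic : specMap (algebraMap R Y.left.functionField) ≫ y =
    Y.left.fromSpecStalk (genericPoint Y.left)
  x : Spec (.of B) ⟶ Z.left
  w : x ≫ π.left = specMap (algebraMap R B) ≫ y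
  [flat : Flat (x ≫ π.left)]
  [lfp : LocallyOfFinitePresentation (x ≫ π.left)]

attribute [instance] LocalSection.commRingR LocalSection.isDomain LocalSection.algebraK
  LocalSection.isFractionRing LocalSection.commRing LocalSection.nontrivial LocalSection.algebra
  LocalSection.flat_algebra LocalSection.mono LocalSection.flat LocalSection.lfp

/-- Take an affine open `V` around the generic point of `Y`, and an affine open `W` over `V` around
a point of the covering above it. Then `R` is the coordinate ring of `V`, a domain with fraction
field `k(Y)`, and `B` is that of `W`. -/
theorem exists_localSection [IsIntegral Y.left]
    (h : ∃ (T : Over S) (p : T ⟶ Y), IsFppfCover p ∧ ∃ x : T ⟶ Z, x ≫ π = p) :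
    Nonempty (LocalSection π) := by
  obtain ⟨T, p, hp, x, hx⟩ := h
  have := hp.flat
  have := hp.lfp
  have := hp.surj
  obtain ⟨t, ht⟩ := p.left.surjective (genericPoint Y.left)
  obtain ⟨_, ⟨V, hV, rfl⟩, hηV, -⟩ :=
    Y.left.isBasis_affineOpens.exists_subset_of_mem_open (Set.mem_univ (genericPoint Y.left))
      isOpen_univ
  obtain ⟨_, ⟨W, hW, rfl⟩, htW, hWV⟩ :=
    T.left.isBasis_affineOpens.exists_subset_of_mem_open
      (show t ∈ p.left ⁻¹ᵁ V by change p.left t ∈ V; rw [ht]; exact hηV) (p.left ⁻¹ᵁ V).2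
  have hV : IsAffineOpen V := hV
  have hW : IsAffineOpen W := hW
  have hw : (hW.fromSpec ≫ x.left) ≫ π.left =
      Spec.map (p.left.appLE V W hWV) ≫ hV.fromSpec := by
    rw [IsAffineOpen.SpecMap_appLE_fromSpec _ hV hW hWV, ← hx, Category.assoc, Over.comp_left]
  have hw' : (hW.fromSpec ≫ x.left) ≫ π.left = hW.fromSpec ≫ p.left := by
    rw [← hx, Category.assoc, Over.comp_left]
  have : Nonempty W := ⟨⟨t, htW⟩⟩
  have : Nonempty V := ⟨⟨_, hηV⟩⟩
  let : Algebra Γ(Y.left, V) Γ(T.left, W) := (p.left.appLE V W hWV).hom.toAlgebra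
  exact ⟨{
    R := Γ(Y.left, V)
    B := Γ(T.left, W)
    isFractionRing := functionField_isFractionRing_of_isAffineOpen Y.left V hV
    flat_algebra := HasRingHomProperty.appLE @Flat p.left inferInstance ⟨V, hV⟩ ⟨W, hW⟩ hWV
    y := hV.fromSpec
    mono := inferInstanceAs (Mono hV.fromSpec)
    y_generic := by
      rw [← hV.fromSpecStalk_eq_fromSpecStalk hηV]
      rfl
    x := hW.fromSpec ≫ x.left
    w := hw
    flat := by
      rw [hw']
      exact MorphismProperty.comp_mem _ _ _ (inferInstanceAs (Flat hW.fromSpec)) hp.flat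
    lfp := by
      rw [hw']
      exact MorphismProperty.comp_mem _ _ _
        (inferInstanceAs (LocallyOfFinitePresentation hW.fromSpec)) hp.lfp }⟩

namespace LocalSection
variable [IsIntegral Y.left] (σ : LocalSection π)

/-- The coordinate ring of the fibre of `Spec B` over the generic point of `Y`. -/
abbrev BK : Type u := Y.left.functionField ⊗[σ.R] σ.B

theorem includeRight_injective : Function.Injective
    (Algebra.TensorProduct.includeRight : σ.B →ₐ[σ.R] σ.BK) :=
  Algebra.TensorProduct.includeRight_injective (IsFractionRing.injective σ.R Y.left.functionField)

instance : Nontrivial σ.BK := σ.includeRight_injective.nontrivial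

/-- The point over the generic point of `Y` with values in `K ⊗ B`. -/
def genericPt : Spec (.of σ.BK) ⟶ Z.left :=
  specMap (Algebra.TensorProduct.includeRight : σ.B →ₐ[σ.R] σ.BK).toRingHom ≫ σ.x

theorem genericPt_comp : σ.genericPt ≫ π.left =
    specMap (algebraMap Y.left.functionField σ.BK) ≫
      Y.left.fromSpecStalk (genericPoint Y.left) := by
  rw [genericPt, Category.assoc, σ.w, ← σ.y_generic, ← Category.assoc,
    ← Category.assoc, DescentDatum.specMap_comp, DescentDatum.specMap_comp]
  refine congrArg (fun f => specMap f ≫ σ.y) (RingHom.ext fun r => ?_)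
  simp only [RingHom.comp_apply, AlgHom.toRingHom_eq_coe, RingHom.coe_coe, AlgHom.commutes]
  rw [← IsScalarTower.algebraMap_apply]

theorem includeLeft_comp : (specMap (Algebra.TensorProduct.includeLeftRingHom :
      σ.B →+* σ.B ⊗[σ.R] σ.B) ≫ σ.x) ≫ π.left =
    (specMap (Algebra.TensorProduct.includeRight :
      σ.B →ₐ[σ.R] σ.B ⊗[σ.R] σ.B).toRingHom ≫ σ.x) ≫ π.left := by
  rw [Category.assoc, Category.assoc, σ.w, ← Category.assoc,
    ← Category.assoc, DescentDatum.specMap_comp, DescentDatum.specMap_comp]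
  refine congrArg (fun f => specMap f ≫ σ.y) (RingHom.ext fun r => ?_)
  simp only [RingHom.comp_apply, AlgHom.toRingHom_eq_coe, RingHom.coe_coe, AlgHom.commutes,
    Algebra.TensorProduct.includeLeftRingHom_apply, Algebra.TensorProduct.algebraMap_apply]

/-- Vectors of functions on `Spec B` that satisfy the equivariance condition and form a basis of
the invariants over the generic point. -/
theorem exists_family (C : DescentDatum π ι) :
    ∃ (b : ι → ι → σ.B)
      (β : Module.Basis ι Y.left.functionField (invariants (C.tensorMat σ.genericPt_comp))),
      (∀ i, (β i : ι → σ.BK) = fun a => 1 ⊗ₜ b i a) ∧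
      (∃ Q : Matrix ι ι σ.BK, Q * Matrix.of (fun i a => 1 ⊗ₜ b i a) = 1) ∧
      ∀ i, C.ringMat _ _ σ.includeLeft_comp *ᵥ (fun a => b i a ⊗ₜ 1) = fun a => 1 ⊗ₜ b i a := by
  obtain ⟨β₀, -, hβ₀⟩ := C.exists_basis_tensorMat σ.genericPt_comp
  -- Multiplication by the common denominator `c`, a unit of `k(Y)`, keeps the family a basis of the
  -- invariants and moves its entries into `B`.
  obtain ⟨c, b, hc, hb⟩ := exists_clear_denominators (R := σ.R)
    fun i : ι × ι => (β₀ i.1 : ι → σ.BK) i.2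
  have hc' : algebraMap σ.R Y.left.functionField c ≠ 0 := by
    simpa using (IsFractionRing.injective σ.R Y.left.functionField).ne hc
  let β := β₀.isUnitSMul (w := fun _ => algebraMap σ.R Y.left.functionField c) fun _ => hc'.isUnit
  have hβ' : ∀ i, β i = algebraMap σ.R Y.left.functionField c • β₀ i := fun i =>
    Module.Basis.isUnitSMul_apply _ _
  have hβ : ∀ i, (β i : ι → σ.BK) = fun a => 1 ⊗ₜ b (i, a) := by
    intro i
    ext a
    rw [← hb (i, a), hβ', ← algebraMap_smul Y.left.functionField c]
    rfl
  refine ⟨fun i a => b (i, a), β, hβ, ?_, fun i => ?_⟩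
  -- The invariants span the whole module over `K ⊗ B`. Expressing the standard basis vectors
  -- through `β₀` and dividing by `c` gives the rows of `Q`.
  · have h1 : ∀ a, ∃ q : ι → σ.BK, ∑ i, q i • (β₀ i : ι → σ.BK) = Pi.single a 1 := fun a =>
      (Submodule.mem_span_range_iff_exists_fun _).1 (hβ₀ ▸ Submodule.mem_top)
    choose q hq using h1
    refine ⟨Matrix.of fun a i =>
      algebraMap _ σ.BK (algebraMap σ.R Y.left.functionField c)⁻¹ * q a i, ?_⟩
    ext a a'
    rw [Matrix.one_eq_pi_single, ← hq, Matrix.mul_apply, Finset.sum_apply]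
    refine Finset.sum_congr rfl fun i _ => ?_
    rw [Matrix.of_apply, Matrix.of_apply, ← congrFun (hβ i) a', hβ']
    change _ * (algebraMap σ.R Y.left.functionField c • (β₀ i : ι → σ.BK) a') = _
    rw [Algebra.smul_def, mul_mul_mul_comm, ← map_mul, inv_mul_cancel₀ hc', map_one, one_mul]
    rfl
  -- The identity is known over the generic point, and `B ⊗ B` embeds into the generic tensor square
  -- by `tensorSquare_injective`.
  · let μ : σ.B ⊗[σ.R] σ.B →ₐ[σ.R] σ.BK ⊗[Y.left.functionField] σ.BK :=
      Algebra.TensorProduct.lift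
        (((Algebra.TensorProduct.includeLeft :
          σ.BK →ₐ[Y.left.functionField] _).restrictScalars σ.R).comp
          (Algebra.TensorProduct.includeRight : σ.B →ₐ[σ.R] σ.BK))
        (((Algebra.TensorProduct.includeRight :
          σ.BK →ₐ[Y.left.functionField] _).restrictScalars σ.R).comp
          (Algebra.TensorProduct.includeRight : σ.B →ₐ[σ.R] σ.BK)) (fun _ _ => Commute.all _ _)
    have hμ : Function.Injective μ := tensorSquare_injective
    have h1 : (C.ringMat _ _ σ.includeLeft_comp).map μ = C.tensorMat σ.genericPt_comp := by
      refine (C.ringMat_map μ.toRingHom _ _ _).trans (C.ringMat_congr ?_ ?_ _)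
      · rw [genericPt, ← Category.assoc, ← Category.assoc, DescentDatum.specMap_comp,
          DescentDatum.specMap_comp]
        refine congrArg (fun f => specMap f ≫ σ.x) (RingHom.ext fun r => ?_)
        simp [μ, Algebra.TensorProduct.one_def]
      · rw [genericPt, ← Category.assoc, ← Category.assoc, DescentDatum.specMap_comp,
          DescentDatum.specMap_comp]
        refine congrArg (fun f => specMap f ≫ σ.x) (RingHom.ext fun r => ?_)
        simp [μ, Algebra.TensorProduct.one_def]
    have h2 := mem_invariants.1 (β i).2
    rw [hβ, ← h1] at h2
    refine funext fun a => hμ ?_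
    have h3 := congrFun h2 a
    refine (RingHom.map_mulVec μ.toRingHom _ _ a).trans (Eq.trans ?_ (h3.trans ?_))
    · refine congrFun (congrArg _ (funext fun a => ?_)) a
      simp [μ, Algebra.TensorProduct.one_def]
    · simp [μ, Algebra.TensorProduct.one_def]

end LocalSection
end LocalSections

/-! ### Forms of vector spaces over the function field of the quotient -/

section Forms
variable {S : Scheme.{u}} {Z Y : Over S} {π : Z ⟶ Y} {ι : Type} [Fintype ι] [DecidableEq ι]

/-- The value of a function on `π⁻¹(V)` at a ring-valued point. -/
def ringEval {V : Y.left.Opens} {A : Type u} [CommRing A] (a : Spec (.of A) ⟶ Z.left)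
    (h : ⊤ ≤ a ⁻¹ᵁ (π.left ⁻¹ᵁ V)) : Γ(Z.left, π.left ⁻¹ᵁ V) →+* A :=
  (specFn A : Γ(Spec (.of A), ⊤) →+* A).comp (evalAt (ptHom a) h)

theorem ringEval_map {V : Y.left.Opens} {A B : Type u} [CommRing A] [CommRing B] (φ : A →+* B)
    (a : Spec (.of A) ⟶ Z.left) (h : ⊤ ≤ a ⁻¹ᵁ (π.left ⁻¹ᵁ V)) {b : Spec (.of B) ⟶ Z.left}
    (hb : specMap φ ≫ a = b) (h' : ⊤ ≤ b ⁻¹ᵁ (π.left ⁻¹ᵁ V)) (s : Γ(Z.left, π.left ⁻¹ᵁ V)) :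
    φ (ringEval a h s) = ringEval b h' s := by
  subst hb
  have h1 := fnMap_evalAt (T' := ptOver (specMap φ ≫ a)) (T := ptOver a) (Over.homMk (specMap φ)
    (Category.assoc _ _ _).symm) (ptHom a) h s
  refine Eq.trans ?_ (congrArg (specFn B) h1)
  exact (specFn_appTop φ _).symm

theorem DescentDatum.IsEquivariantOver.ringEval {C : DescentDatum π ι} {V : Y.left.Opens}
    {M : ι → Γ(Z.left, π.left ⁻¹ᵁ V)} (hM : C.IsEquivariantOver V M) {A : Type u} [CommRing A]
    (a b : Spec (.of A) ⟶ Z.left) (h : a ≫ π.left = b ≫ π.left)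
    (ha : ⊤ ≤ a ⁻¹ᵁ (π.left ⁻¹ᵁ V)) (hb : ⊤ ≤ b ⁻¹ᵁ (π.left ⁻¹ᵁ V)) :
    ringEval b hb ∘ M = C.ringMat a b h *ᵥ (ringEval a ha ∘ M) := by
  have h1 := hM (ptOver a) (ptHom a) (ptHom' h) (DescentDatum.ptHom_comp h) ha hb
  ext i
  refine (congrArg (specFn A) (congrFun h1 i)).trans ?_
  exact RingHom.map_mulVec (specFn A : Γ(Spec (.of A), ⊤) →+* A) _ _ i

theorem evalAt_app {V : Y.left.Opens} {T : Over S} {z z' : T ⟶ Z} (h : z ≫ π = z' ≫ π)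
    (hz : ⊤ ≤ z.left ⁻¹ᵁ (π.left ⁻¹ᵁ V)) (hz' : ⊤ ≤ z'.left ⁻¹ᵁ (π.left ⁻¹ᵁ V))
    (s : Γ(Y.left, V)) : evalAt z hz (π.left.app V s) = evalAt z' hz' (π.left.app V s) := by
  have key : ∀ (w : T ⟶ Z) (hw : ⊤ ≤ w.left ⁻¹ᵁ (π.left ⁻¹ᵁ V)),
      evalAt w hw (π.left.app V s) = (w ≫ π).left.appLE V ⊤ hw s := fun w hw =>
    congr($(Scheme.Hom.comp_appLE w.left π.left V ⊤ hw) s).symm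
  rw [key, key]
  congr 3
  rw [h]

theorem DescentDatum.IsEquivariantOver.res {C : DescentDatum π ι} {V V' : Y.left.Opens}
    {M : ι → Γ(Z.left, π.left ⁻¹ᵁ V)} (hM : C.IsEquivariantOver V M) (i : V' ≤ V) :
    C.IsEquivariantOver V' (resPreimage π i ∘ M) := by
  intro T z z' h hz hz'
  have h1 : ∀ (w : T ⟶ Z) (hw : ⊤ ≤ w.left ⁻¹ᵁ (π.left ⁻¹ᵁ V')),
      evalAt w hw ∘ resPreimage π i ∘ M = evalAt w
        (hw.trans (w.left.preimage_mono (π.left.preimage_mono i))) ∘ M :=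
    fun w hw => funext fun a => evalAt_resPreimage i w hw (M a)
  rw [h1, h1]
  exact hM T z z' h _ _

variable [IsIntegral Y.left]

/-- The spectrum of the stalk hits only points specialising to the generic point, and these lie in
every open set containing it. -/
theorem fromSpecStalk_preimage {V : Y.left.Opens} (hV : genericPoint Y.left ∈ V) {A : Scheme.{u}}
    {a : A ⟶ Z.left} {f : A ⟶ Spec Y.left.functionField}
    (ha : a ≫ π.left = f ≫ Y.left.fromSpecStalk (genericPoint Y.left)) :
    ⊤ ≤ a ⁻¹ᵁ (π.left ⁻¹ᵁ V) := by
  intro t _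
  have h1 : (a ≫ π.left) t ∈ Set.range (Y.left.fromSpecStalk (genericPoint Y.left)) := by
    rw [ha]
    exact ⟨f t, rfl⟩
  rw [Scheme.range_fromSpecStalk] at h1
  exact (show (a ≫ π.left) t ⤳ genericPoint Y.left from h1).mem_open V.isOpen hV

/-- An `L`-valued point of `Z` lying over the generic point of `Y`. -/
structure GenericPt (π : Z ⟶ Y) (A : Type u) [CommRing A] [Algebra Y.left.functionField A] where
  pt : Spec (.of A) ⟶ Z.left
  w : pt ≫ π.left = specMap (algebraMap Y.left.functionField A) ≫
    Y.left.fromSpecStalk (genericPoint Y.left)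

namespace GenericPt
variable {A : Type u} [CommRing A] [Algebra Y.left.functionField A] (z : GenericPt π A)

/-- The value of a function at a point over the generic point. -/
def eval {V : Y.left.Opens} (hV : genericPoint Y.left ∈ V) : Γ(Z.left, π.left ⁻¹ᵁ V) →+* A :=
  ringEval z.pt (fromSpecStalk_preimage hV z.w)

theorem eval_res {V V' : Y.left.Opens} (i : V' ≤ V) (hV' : genericPoint Y.left ∈ V')
    (s : Γ(Z.left, π.left ⁻¹ᵁ V)) : z.eval hV' (resPreimage π i s) = z.eval (i hV') s :=
  congrArg (specFn A) (evalAt_resPreimage i (ptHom z.pt) _ s)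

theorem eval_app {V : Y.left.Opens} (hV : genericPoint Y.left ∈ V) (s : Γ(Y.left, V)) :
    z.eval hV (π.left.app V s) = algebraMap Y.left.functionField A (germ V hV s) := by
  have h1 : z.pt.appLE (π.left ⁻¹ᵁ V) ⊤ (fromSpecStalk_preimage hV z.w) (π.left.app V s) =
      (z.pt ≫ π.left).appLE V ⊤ (fromSpecStalk_preimage hV z.w) s :=
    congr($(Scheme.Hom.comp_appLE z.pt π.left V ⊤ (fromSpecStalk_preimage hV z.w)) s).symm
  refine (congrArg (specFn A) h1).trans ?_
  have key : ∀ (f : Spec (.of A) ⟶ Y.left) (hf : ⊤ ≤ f ⁻¹ᵁ V)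
      (e : f = specMap (algebraMap Y.left.functionField A) ≫
        Y.left.fromSpecStalk (genericPoint Y.left)),
      specFn A (f.appLE V ⊤ hf s) = algebraMap Y.left.functionField A (germ V hV s) := by
    rintro _ hf rfl
    have h2 : (specMap (algebraMap Y.left.functionField A) ≫
        Y.left.fromSpecStalk (genericPoint Y.left)).appLE V ⊤ hf =
        Y.left.presheaf.germ V _ hV ≫ (Scheme.ΓSpecIso _).inv ≫
          (specMap (algebraMap Y.left.functionField A)).appTop := by
      rw [Scheme.Hom.comp_appLE, Scheme.fromSpecStalk_app hV, Category.assoc, Category.assoc]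
      refine congrArg _ (congrArg _ ((Scheme.Hom.map_appLE
        (specMap (algebraMap Y.left.functionField A)) (V := ⊤)
        (U := (Y.left.fromSpecStalk (genericPoint Y.left)) ⁻¹ᵁ V) (U' := ⊤) hf
        (homOfLE le_top).op).trans ?_))
      rw [Scheme.Hom.appTop, Scheme.Hom.app_eq_appLE]
      rfl
    rw [h2]
    refine (specFn_appTop (algebraMap Y.left.functionField A) _).trans (congrArg _ ?_)
    exact congr($((Scheme.ΓSpecIso _).inv_hom_id) (germ V hV s))
  exact key _ _ z.w

theorem exists_germ_eq (c : Y.left.functionField) :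
    ∃ (V : Y.left.Opens) (hV : genericPoint Y.left ∈ V) (s : Γ(Y.left, V)), germ V hV s = c := by
  obtain ⟨V, hV, s, rfl⟩ := Y.left.presheaf.exists_germ_eq c
  exact ⟨V, hV, s, rfl⟩

/-- Change of the ring of values. -/
def map {B : Type u} [CommRing B] [Algebra Y.left.functionField B]
    (f : A →ₐ[Y.left.functionField] B) : GenericPt π B where
  pt := specMap f.toRingHom ≫ z.pt
  w := by
    rw [Category.assoc, z.w, ← Category.assoc, DescentDatum.specMap_comp]
    congr 3
    exact f.comp_algebraMap

theorem eval_map {B : Type u} [CommRing B] [Algebra Y.left.functionField B]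
    (f : A →ₐ[Y.left.functionField] B) {V : Y.left.Opens} (hV : genericPoint Y.left ∈ V)
    (s : Γ(Z.left, π.left ⁻¹ᵁ V)) : (z.map f).eval hV s = f (z.eval hV s) :=
  (ringEval_map f.toRingHom z.pt _ rfl _ s).symm

end GenericPt

/-- The values, at a point over the generic point of `Y`, of the vectors of functions on preimages
of open sets that are compatible with the descent datum. -/
def DescentDatum.forms (C : DescentDatum π ι) {A : Type u} [CommRing A]
    [Algebra Y.left.functionField A] (z₀ : GenericPt π A) :
    Submodule Y.left.functionField (ι → A) where
  carrier := {v | ∃ (V : Y.left.Opens) (hV : genericPoint Y.left ∈ V)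
    (M : ι → Γ(Z.left, π.left ⁻¹ᵁ V)), C.IsEquivariantOver V M ∧ v = z₀.eval hV ∘ M}
  zero_mem' := by
    refine ⟨⊤, trivial, 0, fun T z z' h hz hz' => ?_, ?_⟩
    · have h1 : ∀ (w : T ⟶ Z) (hw : ⊤ ≤ w.left ⁻¹ᵁ (π.left ⁻¹ᵁ ⊤)),
          evalAt w hw ∘ (0 : ι → Γ(Z.left, π.left ⁻¹ᵁ ⊤)) = 0 :=
        fun w hw => funext fun a => map_zero _
      rw [h1, h1, Matrix.mulVec_zero]
    · exact funext fun a => (map_zero _).symm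
  add_mem' := by
    rintro _ _ ⟨V, hV, M, hM, rfl⟩ ⟨W, hW, N, hN, rfl⟩
    have hM' := hM.res (inf_le_left : V ⊓ W ≤ V)
    have hN' := hN.res (inf_le_right : V ⊓ W ≤ W)
    refine ⟨V ⊓ W, ⟨hV, hW⟩, resPreimage π inf_le_left ∘ M + resPreimage π inf_le_right ∘ N,
      fun T z z' h hz hz' => ?_, ?_⟩
    · have h1 : ∀ (w : T ⟶ Z) (hw : ⊤ ≤ w.left ⁻¹ᵁ (π.left ⁻¹ᵁ (V ⊓ W))) (a b),
          evalAt w hw ∘ (a + b) = evalAt w hw ∘ a + evalAt w hw ∘ (b : ι → _) :=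
        fun w hw a b => funext fun _ => map_add _ _ _
      rw [h1, h1, Matrix.mulVec_add, hM' T z z' h hz hz', hN' T z z' h hz hz']
    · ext a
      simp only [Function.comp_apply, Pi.add_apply, map_add]
      rw [z₀.eval_res inf_le_left ⟨hV, hW⟩, z₀.eval_res inf_le_right ⟨hV, hW⟩]
  smul_mem' := by
    rintro c _ ⟨V, hV, M, hM, rfl⟩
    obtain ⟨W, hW, s, rfl⟩ := GenericPt.exists_germ_eq c
    have hM' := hM.res (inf_le_left : V ⊓ W ≤ V)
    let s' : Γ(Z.left, π.left ⁻¹ᵁ (V ⊓ W)) := resPreimage π inf_le_right (π.left.app W s)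
    refine ⟨V ⊓ W, ⟨hV, hW⟩, s' • (resPreimage π inf_le_left ∘ M),
      fun T z z' h hz hz' => ?_, ?_⟩
    · have h1 : ∀ (w : T ⟶ Z) (hw : ⊤ ≤ w.left ⁻¹ᵁ (π.left ⁻¹ᵁ (V ⊓ W))) (a),
          evalAt w hw ∘ (s' • a) = evalAt w hw s' • (evalAt w hw ∘ (a : ι → _)) :=
        fun w hw a => funext fun _ => map_mul _ _ _
      have h2 : evalAt z' hz' s' = evalAt z hz s' := by
        simp only [s']
        rw [evalAt_resPreimage, evalAt_resPreimage]
        exact evalAt_app h.symm _ _ s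
      rw [h1, h1, Matrix.mulVec_smul, hM' T z z' h hz hz', h2]
    · ext a
      change germ W hW s • z₀.eval hV (M a) = z₀.eval _ (s' * resPreimage π inf_le_left (M a))
      rw [map_mul, z₀.eval_res inf_le_left ⟨hV, hW⟩]
      simp only [s']
      rw [z₀.eval_res inf_le_right ⟨hV, hW⟩, z₀.eval_app, Algebra.smul_def]

end Forms

/-! ### Descent of vector spaces to the function field of the quotient -/

section Descent
variable {S : Scheme.{u}} {Z Y : Over S} {π : Z ⟶ Y} {ι : Type} [Fintype ι] [DecidableEq ι]

open Limits

theorem DescentDatum.mat_congr (C : DescentDatum π ι) {T : Over S} {x x' y y' : T ⟶ Z} (hx : x = x')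
    (hy : y = y') (h : x ≫ π = y ≫ π) (h' : x' ≫ π = y' ≫ π) : C.mat x y h = C.mat x' y' h' := by
  subst hx hy
  rfl

namespace LocalSection
variable [IsIntegral Y.left] (σ : LocalSection π) (C : DescentDatum π ι)

/-- The morphism from the source of a local section to `Y`. -/
abbrev toBase : ptOver σ.x ⟶ Y := ptHom σ.x ≫ π

instance : Flat σ.toBase.left := σ.flat
instance : LocallyOfFinitePresentation σ.toBase.left := σ.lfp

/-- The image is open and nonempty. -/
theorem mem_flatImage : genericPoint Y.left ∈ flatImage σ.toBase.left := by
  obtain ⟨p⟩ : Nonempty (Spec (.of σ.B)) := inferInstanceAs (Nonempty (PrimeSpectrum σ.B))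
  have h1 : σ.toBase.left p ∈ flatImage σ.toBase.left := ⟨p, rfl⟩
  exact ((genericPoint_spec Y.left).mem_open_set_iff (flatImage σ.toBase.left).isOpen).2
    ⟨_, trivial, h1⟩

/-- Because `Spec R ⟶ Y` is a monomorphism, two points of `Spec B` that agree in `Y` already agree
in `Spec R`, so they define a point of the fibre product `Spec (B ⊗ B)`. -/
theorem exists_tensor_point {T : Over S} (t t' : T ⟶ ptOver σ.x)
    (h : t ≫ σ.toBase = t' ≫ σ.toBase) :
    ∃ f : T ⟶ ptOver (specMap (Algebra.TensorProduct.includeLeftRingHom :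
      σ.B →+* σ.B ⊗[σ.R] σ.B) ≫ σ.x),
      f.left ≫ specMap (Algebra.TensorProduct.includeLeftRingHom :
        σ.B →+* σ.B ⊗[σ.R] σ.B) = t.left ∧
      f.left ≫ specMap (Algebra.TensorProduct.includeRight :
        σ.B →ₐ[σ.R] σ.B ⊗[σ.R] σ.B).toRingHom = t'.left := by
  have h1 : t.left ≫ specMap (algebraMap σ.R σ.B) = t'.left ≫ specMap (algebraMap σ.R σ.B) := by
    rw [← cancel_mono σ.y, Category.assoc, Category.assoc, ← σ.w]
    exact congrArg (fun m => m.left) h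
  let g := pullback.lift t.left t'.left h1 ≫ (pullbackSpecIso σ.R σ.B σ.B).hom
  have hl : g ≫ specMap (Algebra.TensorProduct.includeLeftRingHom :
      σ.B →+* σ.B ⊗[σ.R] σ.B) = t.left := by
    rw [Category.assoc, pullbackSpecIso_hom_fst, pullback.lift_fst]
  refine ⟨Over.homMk g ?_, hl, ?_⟩
  · change g ≫ (_ ≫ σ.x) ≫ Z.hom = _
    refine Eq.trans ?_ ((congrArg (· ≫ σ.x ≫ Z.hom) hl).trans (Over.w t))
    simp only [Category.assoc]
  · change g ≫ _ = _
    rw [Category.assoc]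
    erw [pullbackSpecIso_hom_snd]
    rw [pullback.lift_snd]

/-- The vector of functions on a scheme over `Spec B`. -/
def pullVec {T : Over S} (t : T ⟶ ptOver σ.x) (b : ι → σ.B) : ι → Fn T :=
  fun a => fnMap t ((specFn σ.B).symm (b a))

omit [Fintype ι] [DecidableEq ι] in
theorem fnMap_pullVec {T' T : Over S} (f : T' ⟶ T) (t : T ⟶ ptOver σ.x) (b : ι → σ.B) :
    fnMap f ∘ σ.pullVec t b = σ.pullVec (f ≫ t) b := rfl

variable {C σ}

/-- The hypothesis is the case of the two projections from `Spec (B ⊗ B)`; every pair `t`, `t'` is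
pulled back from it by `exists_tensor_point`. -/
theorem mat_mulVec_pullVec {b : ι → σ.B}
    (hb : C.ringMat _ _ σ.includeLeft_comp *ᵥ (fun a => b a ⊗ₜ 1) = fun a => 1 ⊗ₜ b a)
    {T : Over S} (t t' : T ⟶ ptOver σ.x) (h : t ≫ σ.toBase = t' ≫ σ.toBase) :
    C.mat (t ≫ ptHom σ.x) (t' ≫ ptHom σ.x) (by simpa only [Category.assoc] using h) *ᵥ
      σ.pullVec t b = σ.pullVec t' b := by
  obtain ⟨f, hf, hf'⟩ := σ.exists_tensor_point t t' h
  let ψ : σ.B ⊗[σ.R] σ.B →+* Fn T := (fnMap f).comp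
    ((specFn (σ.B ⊗[σ.R] σ.B)).symm : σ.B ⊗[σ.R] σ.B →+* Γ(Spec (.of (σ.B ⊗[σ.R] σ.B)), ⊤))
  have h1 := congrArg (fun v => ψ ∘ v) hb
  have h2 : ∀ {φ : σ.B →+* σ.B ⊗[σ.R] σ.B} {s : T ⟶ ptOver σ.x} (_ : f.left ≫ specMap φ = s.left),
      (ψ ∘ fun a => φ (b a)) = σ.pullVec s b := by
    intro φ s hs
    ext a
    have e1 : (specFn (σ.B ⊗[σ.R] σ.B)).symm (φ (b a)) =
        (specMap φ).appTop ((specFn σ.B).symm (b a)) := by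
      rw [RingEquiv.symm_apply_eq, specFn_appTop, RingEquiv.apply_symm_apply]
    have e2 : f.left.appTop ((specMap φ).appTop ((specFn σ.B).symm (b a))) =
        s.left.appTop ((specFn σ.B).symm (b a)) := by
      rw [← hs, Scheme.Hom.comp_appTop]
      rfl
    exact (congrArg (fnMap f) e1).trans e2
  have h3 : (C.ringMat _ _ σ.includeLeft_comp).map ψ =
      C.mat (t ≫ ptHom σ.x) (t' ≫ ptHom σ.x) (by simpa only [Category.assoc] using h) := by
    have e1 : (C.ringMat _ _ σ.includeLeft_comp).map ψ =
        (C.mat (ptHom _) (ptHom' σ.includeLeft_comp)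
          (DescentDatum.ptHom_comp σ.includeLeft_comp)).map (fnMap f) := by
      ext i j
      exact congrArg (fnMap f) (RingEquiv.symm_apply_apply _ _)
    rw [e1, C.natural]
    exact C.mat_congr (by ext1; exact (Category.assoc _ _ _).symm.trans (congrArg (· ≫ σ.x) hf))
      (by ext1; exact (Category.assoc _ _ _).symm.trans (congrArg (· ≫ σ.x) hf')) _ _
  have h4 : (ψ ∘ (C.ringMat _ _ σ.includeLeft_comp *ᵥ fun a => b a ⊗ₜ 1)) =
      (C.ringMat _ _ σ.includeLeft_comp).map ψ *ᵥ (ψ ∘ fun a => b a ⊗ₜ 1) :=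
    funext fun a => RingHom.map_mulVec ψ _ _ a
  have h5 := h2 hf
  have h6 := h2 hf'
  rw [← h3, ← h5, ← h6]
  exact h4.symm.trans h1

/-- The value at `z` is transported by the descent datum from any point `t` of `Spec B` in the same
fibre. It does not depend on `t` by `mat_mulVec_pullVec`, so `exists_glue` applies although `t`
exists only fppf-locally. -/
theorem exists_extension {b : ι → σ.B}
    (hb : C.ringMat _ _ σ.includeLeft_comp *ᵥ (fun a => b a ⊗ₜ 1) = fun a => 1 ⊗ₜ b a) :
    ∃ M : ι → Γ(Z.left, π.left ⁻¹ᵁ flatImage σ.toBase.left),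
      C.IsEquivariantOver (flatImage σ.toBase.left) M ∧
      ∀ {T : Over S} (z : T ⟶ Z)
        (hz : ⊤ ≤ z.left ⁻¹ᵁ (π.left ⁻¹ᵁ flatImage σ.toBase.left)) (t : T ⟶ ptOver σ.x)
        (h : (t ≫ ptHom σ.x) ≫ π = z ≫ π),
        evalAt z hz ∘ M = C.mat (t ≫ ptHom σ.x) z h *ᵥ σ.pullVec t b := by
  have h1 : ∀ a : ι, ∃ M : Γ(Z.left, π.left ⁻¹ᵁ flatImage σ.toBase.left), ∀ {T : Over S} (z : T ⟶ Z)
      (hz : ⊤ ≤ z.left ⁻¹ᵁ (π.left ⁻¹ᵁ flatImage σ.toBase.left)) (t : T ⟶ ptOver σ.x)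
      (h : z ≫ π = t ≫ σ.toBase),
      evalAt z hz M = (C.mat (t ≫ ptHom σ.x) z (by rw [Category.assoc, h]) *ᵥ σ.pullVec t b) a := by
    intro a
    refine exists_glue σ.toBase (fun {T} z t h => (C.mat (t ≫ ptHom σ.x) z
      (by rw [Category.assoc, h]) *ᵥ σ.pullVec t b) a) ?_ ?_
    · intro T' T f z t h
      have := congrFun (map_mulVec_fnMap f (C.mat (t ≫ ptHom σ.x) z
        (by rw [Category.assoc, h])) (σ.pullVec t b)) a
      refine this.trans ?_
      rw [C.natural, fnMap_pullVec]
      rfl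
    · intro T z t t' h h'
      have h2 : t ≫ σ.toBase = t' ≫ σ.toBase := h.symm.trans h'
      have h3 := mat_mulVec_pullVec hb t t' h2
      rw [← h3, Matrix.mulVec_mulVec, C.comp]
  choose M hM using h1
  have hM' : ∀ {T : Over S} (z : T ⟶ Z)
        (hz : ⊤ ≤ z.left ⁻¹ᵁ (π.left ⁻¹ᵁ flatImage σ.toBase.left)) (t : T ⟶ ptOver σ.x)
        (h : (t ≫ ptHom σ.x) ≫ π = z ≫ π),
        evalAt z hz ∘ M = C.mat (t ≫ ptHom σ.x) z h *ᵥ σ.pullVec t b := by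
    intro T z hz t h
    exact funext fun a => hM a z hz t (by rw [← h, Category.assoc])
  refine ⟨M, fun T z z' h hz hz' => ?_, hM'⟩
  obtain ⟨T', p, t, hp, ht⟩ := exists_cover_preimage σ.toBase z hz
  have ht1 : (t ≫ ptHom σ.x) ≫ π = (p ≫ z) ≫ π := by rw [ht, Category.assoc]
  have ht2 : (p ≫ z) ≫ π = (p ≫ z') ≫ π := by rw [Category.assoc, h, Category.assoc]
  have h1 : ∀ (w : T ⟶ Z) (hw : ⊤ ≤ w.left ⁻¹ᵁ (π.left ⁻¹ᵁ flatImage σ.toBase.left)),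
      fnMap p ∘ evalAt w hw ∘ M = evalAt (p ≫ w) (preimage_comp_top p hw) ∘ M :=
    fun w hw => funext fun a => fnMap_evalAt p w hw (M a)
  refine funext fun a => hp.fnMap_injective (congrFun (?_ : fnMap p ∘ _ = fnMap p ∘ _) a)
  rw [map_mulVec_fnMap, h1, h1, C.natural, hM' _ _ t ht1, hM' _ _ t (ht1.trans ht2),
    Matrix.mulVec_mulVec, C.comp]

end LocalSection

variable [IsIntegral Y.left]

theorem DescentDatum.IsEquivariantOver.eval {C : DescentDatum π ι} {V : Y.left.Opens}
    {M : ι → Γ(Z.left, π.left ⁻¹ᵁ V)} (hM : C.IsEquivariantOver V M)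
    (hV : genericPoint Y.left ∈ V) {A : Type u} [CommRing A] [Algebra Y.left.functionField A]
    (z z' : GenericPt π A) :
    z'.eval hV ∘ M = C.ringMat z.pt z'.pt (z.w.trans z'.w.symm) *ᵥ (z.eval hV ∘ M) :=
  hM.ringEval _ _ _ _ _

namespace LocalSection
variable (σ : LocalSection π)

/-- The local section over the generic point of `Y`. -/
abbrev atGeneric : GenericPt π σ.BK := ⟨σ.genericPt, σ.genericPt_comp⟩

variable {C : DescentDatum π ι} {σ}

/-- This is equivariance at the two pullbacks of the generic point to the tensor square of `K ⊗ B`.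
-/
theorem eval_mem_invariants {V : Y.left.Opens} {M : ι → Γ(Z.left, π.left ⁻¹ᵁ V)}
    (hM : C.IsEquivariantOver V M) (hV : genericPoint Y.left ∈ V) :
    (σ.atGeneric.eval hV ∘ M) ∈ invariants (C.tensorMat σ.genericPt_comp) := by
  have h1 := hM.eval hV (σ.atGeneric.map (Algebra.TensorProduct.includeLeft :
      σ.BK →ₐ[Y.left.functionField] σ.BK ⊗[Y.left.functionField] σ.BK))
    (σ.atGeneric.map (Algebra.TensorProduct.includeRight :
      σ.BK →ₐ[Y.left.functionField] σ.BK ⊗[Y.left.functionField] σ.BK))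
  have h2 : ∀ f : σ.BK →ₐ[Y.left.functionField] σ.BK ⊗[Y.left.functionField] σ.BK,
      (σ.atGeneric.map f).eval hV ∘ M = fun a => f (σ.atGeneric.eval hV (M a)) :=
    fun f => funext fun a => σ.atGeneric.eval_map f hV (M a)
  rw [h2, h2] at h1
  exact h1.symm

/-- At the tautological point the transport is from the point to itself, so the descent datum
contributes the identity matrix. -/
theorem atGeneric_eval {b : ι → σ.B} {M : ι → Γ(Z.left, π.left ⁻¹ᵁ flatImage σ.toBase.left)}
    (hM : ∀ {T : Over S} (z : T ⟶ Z)
        (hz : ⊤ ≤ z.left ⁻¹ᵁ (π.left ⁻¹ᵁ flatImage σ.toBase.left)) (t : T ⟶ ptOver σ.x)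
        (h : (t ≫ ptHom σ.x) ≫ π = z ≫ π),
        evalAt z hz ∘ M = C.mat (t ≫ ptHom σ.x) z h *ᵥ σ.pullVec t b) :
    σ.atGeneric.eval σ.mem_flatImage ∘ M = fun a => 1 ⊗ₜ b a := by
  let t : ptOver σ.genericPt ⟶ ptOver σ.x := Over.homMk (specMap
    (Algebra.TensorProduct.includeRight : σ.B →ₐ[σ.R] σ.BK).toRingHom) (Category.assoc _ _ _).symm
  have h1 := hM (ptHom σ.genericPt) (fromSpecStalk_preimage σ.mem_flatImage σ.genericPt_comp) t rfl
  have h2 : C.mat (t ≫ ptHom σ.x) (ptHom σ.genericPt) rfl = 1 := C.self _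
  rw [h2, Matrix.one_mulVec] at h1
  ext a
  refine (congrArg (specFn σ.BK) (congrFun h1 a)).trans ?_
  refine (specFn_appTop _ _).trans ?_
  rw [RingEquiv.apply_symm_apply]
  rfl

end LocalSection

/-- The forms of a descent datum over a field `L` containing the function field `K` of `Y` are a
`K`-structure on the `L`-vector space `L^ι`. -/
theorem DescentDatum.exists_basis_forms (C : DescentDatum π ι)
    (lift : ∃ (T : Over S) (p : T ⟶ Y), IsFppfCover p ∧ ∃ x : T ⟶ Z, x ≫ π = p)
    {L : Type u} [Field L] [Algebra Y.left.functionField L] (z₀ : GenericPt π L) :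
    ∃ b : Module.Basis ι Y.left.functionField (C.forms z₀),
      LinearIndependent L fun i => (b i : ι → L) := by
  obtain ⟨σ⟩ := exists_localSection lift
  obtain ⟨b, β, hβ, ⟨Q, hQ⟩, hb⟩ := σ.exists_family C
  choose M hM hM' using fun i => LocalSection.exists_extension (hb i)
  let hη := σ.mem_flatImage
  -- The point `z₀` and the local section become comparable over `Ω`, where the invertible matrix
  -- `D` of the descent datum carries values at one to values at the other.
  let Ω := L ⊗[Y.left.functionField] σ.BK
  let f₁ : L →ₐ[Y.left.functionField] Ω := Algebra.TensorProduct.includeLeft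
  let f₂ : σ.BK →ₐ[Y.left.functionField] Ω := Algebra.TensorProduct.includeRight
  have hf₁ : Function.Injective f₁ := Algebra.TensorProduct.includeLeft_injective (S := L)
    (FaithfulSMul.algebraMap_injective Y.left.functionField σ.BK)
  have : Nontrivial Ω := hf₁.nontrivial
  let z₁ := z₀.map f₁
  let z₂ := σ.atGeneric.map f₂
  let D : Matrix ι ι Ω := C.ringMat z₂.pt z₁.pt (z₂.w.trans z₁.w.symm)
  let D' : Matrix ι ι Ω := C.ringMat z₁.pt z₂.pt (z₁.w.trans z₂.w.symm)
  have hD : D' * D = 1 := (C.ringMat_comp _ _ _ _ _).trans (C.ringMat_self _)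
  have hDu : IsUnit D.det := by
    refine IsUnit.of_mul_eq_one_right D'.det ?_
    rw [← Matrix.det_mul, hD, Matrix.det_one]
  have key : ∀ {V : Y.left.Opens} {N : ι → Γ(Z.left, π.left ⁻¹ᵁ V)} (_ : C.IsEquivariantOver V N)
      (hV : genericPoint Y.left ∈ V),
      f₁ ∘ z₀.eval hV ∘ N = D *ᵥ (f₂ ∘ σ.atGeneric.eval hV ∘ N) := by
    intro V N hN hV
    have h1 := hN.eval hV z₂ z₁
    have h2 : z₁.eval hV ∘ N = f₁ ∘ z₀.eval hV ∘ N := funext fun a => z₀.eval_map f₁ hV (N a)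
    have h3 : z₂.eval hV ∘ N = f₂ ∘ σ.atGeneric.eval hV ∘ N :=
      funext fun a => σ.atGeneric.eval_map f₂ hV (N a)
    rw [h2, h3] at h1
    exact h1
  let m : ι → ι → L := fun i => z₀.eval hη ∘ M i
  have hm : ∀ i, f₁ ∘ m i = D *ᵥ (f₂ ∘ (β i : ι → σ.BK)) := by
    intro i
    rw [hβ, ← LocalSection.atGeneric_eval (hM' i)]
    exact key (hM i) hη
  -- In `Ω` the determinant of the family `m` is the product of the determinant of the basis `β`, a
  -- unit because of `Q`, and that of `D`. As `Ω` is nonzero, the determinant in `L` cannot vanish.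
  have hind : LinearIndependent L m := by
    refine Matrix.linearIndependent_rows_of_det_ne_zero (A := Matrix.of m) fun h0 => ?_
    have h1 : (Matrix.of m).map f₁ = (Matrix.of fun i => (β i : ι → σ.BK)).map f₂ * Dᵀ := by
      ext i a
      refine (congrFun (hm i) a).trans ?_
      simp only [Matrix.mulVec, dotProduct, Matrix.mul_apply, Matrix.transpose_apply]
      exact Finset.sum_congr rfl fun c _ => mul_comm _ _
    have h2 : IsUnit ((Matrix.of fun i => (β i : ι → σ.BK)).map f₂).det := by
      refine IsUnit.of_mul_eq_one_right (Q.map f₂).det ?_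
      rw [← Matrix.det_mul, ← Matrix.map_mul]
      simp only [hβ, hQ]
      rw [Matrix.map_one _ (map_zero _) (map_one _), Matrix.det_one]
    have h3 : ((Matrix.of m).map f₁).det = 0 := by
      have := f₁.map_det (Matrix.of m)
      rw [h0, map_zero] at this
      exact this.symm
    rw [h1, Matrix.det_mul, Matrix.det_transpose] at h3
    exact (h2.mul hDu).ne_zero h3
  let m' : ι → C.forms z₀ := fun i => ⟨m i, _, hη, M i, hM i, rfl⟩
  have hind' : LinearIndependent Y.left.functionField m' := by
    refine LinearIndependent.of_comp (C.forms z₀).subtype ?_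
    exact hind.restrict_scalars' Y.left.functionField
  refine ⟨Module.Basis.mk hind' ?_, ?_⟩
  -- At the local section the form becomes an invariant vector, hence a combination of `β` with
  -- coefficients in `k(Y)`; transport by `D` keeps these coefficients.
  · rintro ⟨_, V, hV, N, hN, rfl⟩ -
    let u : invariants (C.tensorMat σ.genericPt_comp) :=
      ⟨_, LocalSection.eval_mem_invariants (σ := σ) hN hV⟩
    have hu : ∑ i, β.repr u i • (β i : ι → σ.BK) = σ.atGeneric.eval hV ∘ N := by
      have := congrArg Subtype.val (β.sum_repr u)
      rw [Submodule.coe_sum] at this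
      exact this
    have h1 : z₀.eval hV ∘ N = ∑ i, β.repr u i • m i := by
      refine funext fun a => hf₁ ?_
      have h2 := congrFun (key hN hV) a
      refine h2.trans ?_
      rw [← hu]
      have h3 : f₂ ∘ (∑ i, β.repr u i • (β i : ι → σ.BK)) =
          ∑ i, β.repr u i • (f₂ ∘ (β i : ι → σ.BK)) := by
        ext c
        simp only [Function.comp_apply, Finset.sum_apply, Pi.smul_apply, map_sum, map_smul]
      rw [h3, Matrix.mulVec_sum]
      simp only [Matrix.mulVec_smul, ← hm, Finset.sum_apply, Pi.smul_apply, map_sum, map_smul,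
        Function.comp_apply]
    rw [Submodule.mem_span_range_iff_exists_fun]
    refine ⟨β.repr u, Subtype.ext ?_⟩
    rw [Submodule.coe_sum]
    exact h1.symm
  · simp only [Module.Basis.mk_apply]
    exact hind

end Descent

/-! ### Forms of matrix algebras -/

section MatrixForms
open TwistedGrassmannian.Brauer Kronecker

/-- A homomorphism from a simple algebra to a nonzero one is injective, and equality of dimensions
makes it bijective. -/
theorem Brauer.classOf_eq_of_algHom {K : Type u} [Field K] {A B : AlgCat.{u} K} (hA : IsCSA A)
    (hB : IsCSA B) (f : A →ₐ[K] B) (h : Module.finrank K A = Module.finrank K B) :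
    classOf A hA = classOf B hB := by
  have := hA.isSimple
  have := hB.isSimple
  have := hA.finDim
  have := hB.finDim
  have hf : Function.Injective f := f.toRingHom.injective
  have hs : Function.Surjective f :=
    (LinearMap.injective_iff_surjective_of_finrank_eq_finrank (f := f.toLinearMap) h).1 hf
  exact Quotient.sound (equiv_of_algEquiv (AlgEquiv.ofBijective f ⟨hf, hs⟩))

/-- A ring homomorphism over `f` extends to an `L`-algebra homomorphism from `L ⊗ A`, to which
`classOf_eq_of_algHom` applies. -/
theorem Brauer.pullback_classOf {K L : Type u} [Field K] [Field L] (f : K →+* L) {A : AlgCat.{u} K}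
    {B : AlgCat.{u} L} (hA : IsCSA A) (hB : IsCSA B) (g : A →+* B)
    (hg : ∀ (c : K), g (algebraMap K A c) = algebraMap L B (f c))
    (h : Module.finrank K A = Module.finrank L B) :
    pullback f (classOf A hA) = classOf B hB := by
  let _ : Algebra K L := f.toAlgebra
  let _ : Algebra K B := ((algebraMap L B).comp f).toAlgebra' fun c x => Algebra.commutes (f c) x
  have : IsScalarTower K L B := IsScalarTower.of_algebraMap_eq fun _ => rfl
  let g' : A →ₐ[K] B := { g with commutes' := hg }
  let F : L ⊗[K] A →ₐ[L] B := Algebra.TensorProduct.lift (Algebra.ofId L B) g'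
    fun l a => Algebra.commutes l (g a)
  let A' : CSA.{u, u} K :=
    { toAlgCat := A, isCentral := hA.isCentral, isSimple := hA.isSimple, fin_dim := hA.finDim }
  let C := baseChange f A'
  exact classOf_eq_of_algHom (A := C.toAlgCat) ⟨C.isCentral, C.isSimple, C.fin_dim⟩ hB F
    ((Module.finrank_baseChange (R := L) (S := K) (M' := A)).trans h)

theorem Brauer.pullback_id {K : Type u} [Field K] (a : BrauerGroup.{u, u} K) :
    pullback (RingHom.id K) a = a := by
  obtain ⟨A⟩ := a
  exact pullback_classOf (RingHom.id K) (A := A.toAlgCat) (B := A.toAlgCat)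
    ⟨A.isCentral, A.isSimple, A.fin_dim⟩ ⟨A.isCentral, A.isSimple, A.fin_dim⟩
    (RingHom.id A) (fun _ => rfl) rfl

variable {K L : Type u} [Field K] [Field L] [Algebra K L]
  {ι ι' : Type} [Fintype ι] [DecidableEq ι] [Fintype ι'] [DecidableEq ι']
  {A A' B : Type u} [Ring A] [Algebra K A] [Ring A'] [Algebra K A'] [Ring B] [Algebra K B]

/-- The `K`-algebra `A` is a form of the algebra of matrices over the extension `L` of `K`. -/
def IsMatrixForm (i : A →ₐ[K] Matrix ι ι L) : Prop :=
  ∃ b : Module.Basis (ι × ι) K A, LinearIndependent L fun p => i (b p)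

namespace IsMatrixForm
variable {i : A →ₐ[K] Matrix ι ι L}

theorem finrank (h : IsMatrixForm i) : Module.finrank K A = Fintype.card ι ^ 2 := by
  obtain ⟨b, -⟩ := h
  rw [Module.finrank_eq_card_basis b, Fintype.card_prod, sq]

theorem finDim (h : IsMatrixForm i) : FiniteDimensional K A := by
  obtain ⟨b, -⟩ := h
  exact b.finiteDimensional_of_finite

/-- The induced map from `L ⊗ A` sends a basis to an independent family, and both sides have the
same dimension over `L`. -/
theorem exists_algEquiv (h : IsMatrixForm i) :
    ∃ e : L ⊗[K] A ≃ₐ[L] Matrix ι ι L, ∀ a, e (1 ⊗ₜ a) = i a := by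
  obtain ⟨b, hb⟩ := h
  let F : L ⊗[K] A →ₐ[L] Matrix ι ι L := Algebra.TensorProduct.lift (Algebra.ofId L _) i
    fun l a => Algebra.commutes l (i a)
  have hF : ∀ a, F (1 ⊗ₜ a) = i a := fun a =>
    (Algebra.TensorProduct.lift_tmul _ _ _ _ _).trans (by rw [map_one, one_mul])
  let c := b.baseChange L
  have hc : ∀ p, F (c p) = i (b p) := fun p => by
    rw [Module.Basis.baseChange_apply, hF]
  have hcard : Fintype.card (ι × ι) = Module.finrank L (Matrix ι ι L) := by
    rw [Module.finrank_matrix, Module.finrank_self, mul_one, Fintype.card_prod]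
  have hinj : Function.Injective F := by
    refine (LinearMap.ker_eq_bot (f := F.toLinearMap)).1 ?_
    refine LinearMap.ker_eq_bot_of_injective ?_
    have h1 : LinearIndependent L (F.toLinearMap ∘ c) := by
      convert hb using 1
      exact funext hc
    intro x y hxy
    have h2 : c.repr (x - y) = 0 := by
      rw [Fintype.linearIndependent_iff] at h1
      refine Finsupp.ext (h1 (c.repr (x - y)) ?_)
      simp only [Function.comp_apply, ← map_smul, ← map_sum]
      rw [c.sum_repr, map_sub, hxy, sub_self]
    exact sub_eq_zero.1 (c.repr.map_eq_zero_iff.1 h2)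
  have hfd : FiniteDimensional L (L ⊗[K] A) := c.finiteDimensional_of_finite
  have hsurj : Function.Surjective F :=
    (LinearMap.injective_iff_surjective_of_finrank_eq_finrank (f := F.toLinearMap)
      ((Module.finrank_eq_card_basis c).trans hcard)).1 hinj
  exact ⟨AlgEquiv.ofBijective F ⟨hinj, hsurj⟩, hF⟩

theorem injective (h : IsMatrixForm i) : Function.Injective i := by
  obtain ⟨e, he⟩ := h.exists_algEquiv
  intro a b hab
  rw [← he, ← he] at hab
  exact Algebra.TensorProduct.includeRight_injective (A := L)
    (FaithfulSMul.algebraMap_injective K L) (e.injective hab)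

/-- Centrality and simplicity descend along the field extension from the matrix algebra `L ⊗ A`. -/
theorem isCSA [Nonempty ι] (h : IsMatrixForm i) : IsCSA (AlgCat.of K A) := by
  obtain ⟨e, he⟩ := h.exists_algEquiv
  have hinj := h.injective
  have hA : Nontrivial A := by
    refine ⟨0, 1, fun h0 => ?_⟩
    have := congrArg i h0
    rw [map_zero, map_one] at this
    exact zero_ne_one this
  refine ⟨⟨fun z hz => ?_⟩, ?_, h.finDim⟩
  · have h1 : (e (1 ⊗ₜ (show A from z))) ∈ Subalgebra.center L (Matrix ι ι L) := by
      rw [Subalgebra.mem_center_iff]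
      intro M
      obtain ⟨y, rfl⟩ := e.surjective M
      rw [← map_mul, ← map_mul]
      congr 1
      induction y with
      | zero => rw [zero_mul, mul_zero]
      | add x y hx hy => rw [add_mul, mul_add, hx, hy]
      | tmul l a =>
        rw [Algebra.TensorProduct.tmul_mul_tmul, Algebra.TensorProduct.tmul_mul_tmul, mul_one,
          one_mul, Subalgebra.mem_center_iff.1 hz a]
    obtain ⟨l, hl⟩ := (Algebra.IsCentral.mem_center_iff L).1 h1
    have h2 : (1 : L) ⊗ₜ[K] (show A from z) = l ⊗ₜ 1 := by
      refine e.injective (hl.trans ?_)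
      rw [← e.commutes, Algebra.TensorProduct.algebraMap_apply]
      rfl
    -- A `K`-linear functional `g` on `A` with `g 1 = 1`, applied to the second factor of `1 ⊗ z = l
    -- ⊗ 1`, shows that `l` is the image of `g z` and lies in `K`.
    obtain ⟨g, hg⟩ := (LinearMap.toSpanSingleton K A 1).exists_leftInverse_of_injective
      (LinearMap.ker_eq_bot.2 fun a b hab => by
        simp only [LinearMap.toSpanSingleton_apply] at hab
        exact FaithfulSMul.algebraMap_injective K A
          (by rwa [Algebra.algebraMap_eq_smul_one, Algebra.algebraMap_eq_smul_one]))
    have hg1 : g 1 = 1 := by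
      have := congr($hg 1)
      simpa using this
    have h3 := congrArg ((TensorProduct.rid K L) ∘ (g.lTensor L)) h2
    simp only [Function.comp_apply, LinearMap.lTensor_tmul, TensorProduct.rid_tmul, hg1,
      one_smul] at h3
    refine Algebra.mem_bot.2 ⟨g z, hinj ?_⟩
    rw [← he, ← he, h2, ← h3]
    congr 1
    rw [TensorProduct.smul_tmul, Algebra.algebraMap_eq_smul_one]
  · refine ⟨⟨fun I => or_iff_not_imp_right.2 fun hI => ?_⟩⟩
    -- For a proper ideal the quotient map stays a map to a nonzero ring after extension to `L`.
    -- There it is injective by simplicity of `L ⊗ A`, so the ideal is zero.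
    let Q := I.ringCon.Quotient
    let q : A →ₐ[K] Q := I.ringCon.mkₐ K
    have hQ : Nontrivial Q := by
      refine ⟨0, 1, fun h0 => hI ?_⟩
      have h1 : (1 : A) ∈ I := (TwoSidedIdeal.mem_iff I 1).2 ((RingCon.eq _).1 h0.symm)
      rw [eq_top_iff]
      intro x _
      simpa using I.mul_mem_left x _ h1
    have hs : IsSimpleRing (L ⊗[K] A) := IsSimpleRing.of_ringEquiv e.symm.toRingEquiv inferInstance
    have hnt : Nontrivial (L ⊗[K] Q) :=
      (Algebra.TensorProduct.includeRight_injective (R := K) (A := L) (B := Q)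
        (FaithfulSMul.algebraMap_injective K L)).nontrivial
    let F : L ⊗[K] A →ₐ[K] L ⊗[K] Q := Algebra.TensorProduct.map (AlgHom.id K L) q
    have hF : Function.Injective F := F.toRingHom.injective
    rw [eq_bot_iff]
    intro x hx
    have h2 : q x = 0 := (RingCon.eq _).2 ((TwoSidedIdeal.mem_iff I x).1 hx)
    have h3 : F (1 ⊗ₜ x) = 0 := by
      simp only [F, Algebra.TensorProduct.map_tmul, h2, TensorProduct.tmul_zero]
    rw [TwoSidedIdeal.mem_bot]
    refine Algebra.TensorProduct.includeRight_injective (R := K) (A := L) (B := A)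
        (FaithfulSMul.algebraMap_injective K L) (hF (h3.trans ?_))
    simp

/-- If the Kronecker products of matrices in two forms lie in a third one, the class of the third
one is the sum of the classes. -/
theorem classOf_kronecker [Nonempty ι] [Nonempty ι'] {i' : A' →ₐ[K] Matrix ι' ι' L}
    {i'' : B →ₐ[K] Matrix (ι × ι') (ι × ι') L} (h : IsMatrixForm i) (h' : IsMatrixForm i')
    (h'' : IsMatrixForm i'') (hk : ∀ a a', ∃ b, i'' b = i a ⊗ₖ i' a') :
    classOf _ h''.isCSA = classOf _ h.isCSA + classOf _ h'.isCSA := by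
  choose k hk using hk
  have hinj := h''.injective
  -- The maps `a ↦ a ⊗ₖ 1` and `a' ↦ 1 ⊗ₖ a'` have commuting images, so together they give a map
  -- from the tensor product; the dimensions agree.
  let f : A →ₐ[K] B := AlgHom.ofLinearMap
    { toFun := fun a => k a 1
      map_add' := fun a b => hinj (by simp only [map_add, hk, Matrix.add_kronecker])
      map_smul' := fun c a => hinj (by
        simp only [map_smul, hk, Matrix.smul_kronecker, RingHom.id_apply]) }
    (hinj (by simp [hk])) fun a b => hinj (by
      change i'' (k _ _) = i'' (k _ _ * k _ _)
      simp only [map_mul, hk, map_one, ← Matrix.mul_kronecker_mul, mul_one])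
  let g : A' →ₐ[K] B := AlgHom.ofLinearMap
    { toFun := fun a => k 1 a
      map_add' := fun a b => hinj (by simp only [map_add, hk, Matrix.kronecker_add])
      map_smul' := fun c a => hinj (by
        simp only [map_smul, hk, Matrix.kronecker_smul, RingHom.id_apply]) }
    (hinj (by simp [hk])) fun a b => hinj (by
      change i'' (k _ _) = i'' (k _ _ * k _ _)
      simp only [map_mul, hk, map_one, ← Matrix.mul_kronecker_mul, mul_one])
  have hfg : ∀ a b, Commute (f a) (g b) := fun a b => hinj (by
    change i'' (k _ _ * k _ _) = i'' (k _ _ * k _ _)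
    simp only [map_mul, hk, map_one, ← Matrix.mul_kronecker_mul, mul_one, one_mul])
  let hc := h.isCSA
  let hc' := h'.isCSA
  let T := tensor
    { toAlgCat := AlgCat.of K A, isCentral := hc.isCentral, isSimple := hc.isSimple,
      fin_dim := hc.finDim }
    { toAlgCat := AlgCat.of K A', isCentral := hc'.isCentral, isSimple := hc'.isSimple,
      fin_dim := hc'.finDim }
  have := h.finDim
  have := h'.finDim
  refine (classOf_eq_of_algHom (A := T.toAlgCat) ⟨T.isCentral, T.isSimple, T.fin_dim⟩ h''.isCSA
    (Algebra.TensorProduct.lift f g hfg) ?_).symm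
  refine (Module.finrank_tensorProduct (R := K) (S := K) (M := A) (M' := A')).trans ?_
  refine Eq.trans ?_ h''.finrank.symm
  rw [h.finrank, h'.finrank, Fintype.card_prod, mul_pow]

/-- If the transposes of matrices in a form lie in a second one, then the class of the second one
is the negative of the class of the first one. -/
theorem classOf_transpose [Nonempty ι] {i' : A' →ₐ[K] Matrix ι ι L} (h : IsMatrixForm i)
    (h' : IsMatrixForm i') (hk : ∀ a, ∃ b, i' b = (i a)ᵀ) :
    classOf _ h'.isCSA = - classOf _ h.isCSA := by
  choose k hk using hk
  have hinj := h'.injective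
  let f : Aᵐᵒᵖ →ₐ[K] A' := AlgHom.ofLinearMap
    { toFun := fun a => k a.unop
      map_add' := fun a b => hinj (by
        simp only [map_add, hk, MulOpposite.unop_add, Matrix.transpose_add])
      map_smul' := fun c a => hinj (by
        simp only [map_smul, hk, MulOpposite.unop_smul, Matrix.transpose_smul, RingHom.id_apply]) }
    (hinj (by simp [hk])) fun a b => hinj (by
      change i' (k _) = i' (k _ * k _)
      simp only [map_mul, hk, MulOpposite.unop_mul, Matrix.transpose_mul])
  let hc := h.isCSA
  let T := opposite
    { toAlgCat := AlgCat.of K A, isCentral := hc.isCentral, isSimple := hc.isSimple,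
      fin_dim := hc.finDim }
  refine (classOf_eq_of_algHom (A := T.toAlgCat) ⟨T.isCentral, T.isSimple, T.fin_dim⟩ h'.isCSA
    f ?_).symm
  refine (MulOpposite.opLinearEquiv K (M := A)).finrank_eq.symm.trans ?_
  exact h.finrank.trans h'.finrank.symm

/-- A form of the algebra of matrices that acts on a form of the space of vectors is split. -/
theorem classOf_eq_zero [Nonempty ι] (h : IsMatrixForm i) {D : Submodule K (ι → L)}
    (b : Module.Basis ι K D) (hD : ∀ a, ∀ v ∈ D, i a *ᵥ v ∈ D) : classOf _ h.isCSA = 0 := by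
  let f : A →ₐ[K] Module.End K D := AlgHom.ofLinearMap
    { toFun := fun a =>
        { toFun := fun v => ⟨i a *ᵥ v.1, hD a v.1 v.2⟩
          map_add' := fun v w => Subtype.ext (Matrix.mulVec_add _ _ _)
          map_smul' := fun c v => Subtype.ext (Matrix.mulVec_smul _ _ _) }
      map_add' := fun a a' => LinearMap.ext fun v => Subtype.ext (by
        change i (a + a') *ᵥ v.1 = i a *ᵥ v.1 + i a' *ᵥ v.1
        rw [map_add, Matrix.add_mulVec])
      map_smul' := fun c a => LinearMap.ext fun v => Subtype.ext (by
        change i (c • a) *ᵥ v.1 = c • (i a *ᵥ v.1)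
        rw [map_smul, Matrix.smul_mulVec]) }
    (LinearMap.ext fun v => Subtype.ext (by
      change i 1 *ᵥ v.1 = v.1
      rw [map_one, Matrix.one_mulVec]))
    fun a a' => LinearMap.ext fun v => Subtype.ext (by
      change i (a * a') *ᵥ v.1 = i a *ᵥ (i a' *ᵥ v.1)
      rw [map_mul, Matrix.mulVec_mulVec])
  have hsimple := h.isCSA.isSimple
  have := h.finDim
  have : FiniteDimensional K D := b.finiteDimensional_of_finite
  have hnt : Nontrivial (Module.End K D) := (algEquivMatrix b).toEquiv.nontrivial
  have hf : Function.Injective f :=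
    RingHom.injective (show (AlgCat.of K A) →+* Module.End K D from f.toRingHom)
  -- Both sides have dimension the square of `Fintype.card ι`, so the injective map to the
  -- endomorphism algebra is an isomorphism.
  have hfin : Module.finrank K A = Module.finrank K (Module.End K D) := by
    rw [(algEquivMatrix b).toLinearEquiv.finrank_eq, Module.finrank_matrix, Module.finrank_self,
      mul_one, h.finrank, sq]
  have hs : Function.Surjective f :=
    (LinearMap.injective_iff_surjective_of_finrank_eq_finrank (V₂ := Module.End K D)
      (f := f.toLinearMap) hfin).1 hf
  let e : A ≃ₐ[K] Matrix (Fin (Fintype.card ι)) (Fin (Fintype.card ι)) K :=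
    (AlgEquiv.ofBijective f ⟨hf, hs⟩).trans ((algEquivMatrix b).trans
      (Matrix.reindexAlgEquiv K K (Fintype.equivFin ι)))
  exact Quotient.sound ⟨1, 1 * Fintype.card ι, one_ne_zero, by simp,
    ⟨(e.mapMatrix (m := Fin 1)).trans <| (Matrix.compAlgEquiv _ _ K K).trans <|
      Matrix.reindexAlgEquiv K K finProdFinEquiv⟩⟩

end IsMatrixForm
end MatrixForms

/-! ### The Brauer class of a projective representation -/

section Classes
open TwistedGrassmannian.Brauer Kronecker

variable {S : Scheme.{u}} {G : GroupFunctor S} {ι ι' : Type} [Fintype ι] [DecidableEq ι]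
  [Fintype ι'] [DecidableEq ι']

/-- The tensor product of two representations. -/
def Rep.tensor (ρ : Rep G ι) (ρ' : Rep G ι') : Rep G (ι × ι') where
  hom {T} := MonoidHom.mk' (fun g => ⟨(ρ.hom g).1 ⊗ₖ (ρ'.hom g).1, (ρ.hom g⁻¹).1 ⊗ₖ (ρ'.hom g⁻¹).1,
      by rw [← Matrix.mul_kronecker_mul, ← Units.val_mul, ← Units.val_mul, ← map_mul, ← map_mul,
          mul_inv_cancel, map_one, map_one, Units.val_one, Units.val_one, Matrix.one_kronecker_one],
      by rw [← Matrix.mul_kronecker_mul, ← Units.val_mul, ← Units.val_mul, ← map_mul, ← map_mul,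
          inv_mul_cancel, map_one, map_one, Units.val_one, Units.val_one,
          Matrix.one_kronecker_one]⟩) fun g h => Units.ext (by
    change (ρ.hom (g * h)).1 ⊗ₖ (ρ'.hom (g * h)).1 =
      ((ρ.hom g).1 ⊗ₖ (ρ'.hom g).1) * ((ρ.hom h).1 ⊗ₖ (ρ'.hom h).1)
    rw [← Matrix.mul_kronecker_mul, map_mul, map_mul, Units.val_mul, Units.val_mul])
  natural f g := by
    change (ρ.hom (G.res f g)).1 ⊗ₖ (ρ'.hom (G.res f g)).1 =
      ((ρ.hom g).1 ⊗ₖ (ρ'.hom g).1).map (fnMap f)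
    rw [ρ.natural, ρ'.natural]
    ext p q
    simp [Matrix.kroneckerMap_apply]

/-- The dual representation. -/
def Rep.dual (ρ : Rep G ι) : Rep G ι where
  hom {T} := MonoidHom.mk' (fun g => ⟨(ρ.hom g⁻¹).1ᵀ, (ρ.hom g).1ᵀ,
      by rw [← Matrix.transpose_mul, ← Units.val_mul, ← map_mul, mul_inv_cancel, map_one,
          Units.val_one, Matrix.transpose_one],
      by rw [← Matrix.transpose_mul, ← Units.val_mul, ← map_mul, inv_mul_cancel, map_one,
          Units.val_one, Matrix.transpose_one]⟩) fun g h => Units.ext (by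
    change (ρ.hom (g * h)⁻¹).1ᵀ = (ρ.hom g⁻¹).1ᵀ * (ρ.hom h⁻¹).1ᵀ
    rw [← Matrix.transpose_mul, ← Units.val_mul, ← map_mul, _root_.mul_inv_rev])
  natural f g := by
    change (ρ.hom (G.res f g)⁻¹).1ᵀ = (ρ.hom g⁻¹).1ᵀ.map (fnMap f)
    rw [← map_inv, ρ.natural, Matrix.transpose_map]

theorem Rep.tensor_hom (ρ : Rep G ι) (ρ' : Rep G ι') {T : Over S} (g : G.pts T) :
    ((ρ.tensor ρ').hom g).1 = (ρ.hom g).1 ⊗ₖ (ρ'.hom g).1 := rfl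

theorem Rep.dual_hom (ρ : Rep G ι) {T : Over S} (g : G.pts T) :
    (ρ.dual.hom g).1 = (ρ.hom g⁻¹).1ᵀ := rfl

/-- The representation of `G` on matrices by conjugation. -/
abbrev Rep.conj (ρ : Rep G ι) : Rep G (ι × ι) := ρ.tensor ρ.dual

/-- The coefficients of a matrix as a vector. -/
def matVec {R : Type*} (M : Matrix ι ι' R) : ι × ι' → R := fun p => M p.1 p.2

omit [DecidableEq ι] [DecidableEq ι'] in
theorem kronecker_mulVec_matVec {R : Type*} [CommRing R] (g : Matrix ι ι R) (h : Matrix ι' ι' R)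
    (M : Matrix ι ι' R) : (g ⊗ₖ h) *ᵥ matVec M = matVec (g * M * hᵀ) := by
  ext ⟨a, b⟩
  simp only [Matrix.mulVec, dotProduct, matVec, Matrix.kroneckerMap_apply, Matrix.mul_apply,
    Matrix.transpose_apply, Fintype.sum_prod_type, Finset.sum_mul]
  rw [Finset.sum_comm]
  exact Finset.sum_congr rfl fun _ _ => Finset.sum_congr rfl fun _ _ => by ring

variable {Z Y : Over S} {π : Z ⟶ Y} (𝒜 : QuotientAction G π) (ρ : Rep G ι) (ρ' : Rep G ι')

namespace QuotientAction

/-- The stabilisers of all points act by scalars in the representation `ρ`. -/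
def IsProjective : Prop := ∀ ⦃T : Over S⦄ (g : G.pts T) (z : T ⟶ Z), 𝒜.act g z = z →
  ∃ c : (Fn T)ˣ, ρ.hom g = Matrix.GeneralLinearGroup.scalar ι c

/-- A matrix `M` of functions on `π⁻¹(V)` such that `M(g z) = ρ(g) M(z) ρ(g)⁻¹`. -/
def IsConjEquivariantOver (V : Y.left.Opens) (M : Matrix ι ι Γ(Z.left, π.left ⁻¹ᵁ V)) : Prop :=
  ∀ (T : Over S) (z z' : T ⟶ Z) (g : G.pts T), 𝒜.act g z = z' →
    ∀ (hz : ⊤ ≤ z.left ⁻¹ᵁ (π.left ⁻¹ᵁ V)) (hz' : ⊤ ≤ z'.left ⁻¹ᵁ (π.left ⁻¹ᵁ V)),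
      M.map (evalAt z' hz') = (ρ.hom g).1 * M.map (evalAt z hz) * (ρ.hom g⁻¹).1

variable {𝒜 ρ ρ'}

/-- On coefficient vectors, the tensor product of a representation with its dual is conjugation of
matrices. This brings matrix algebras under the descent of vectors. -/
theorem isConjEquivariantOver_iff {V : Y.left.Opens} {M : Matrix ι ι Γ(Z.left, π.left ⁻¹ᵁ V)} :
    𝒜.IsConjEquivariantOver ρ V M ↔ 𝒜.IsEquivariantOver ρ.conj V (matVec M) := by
  have h1 : ∀ {T : Over S} (z : T ⟶ Z) (hz : ⊤ ≤ z.left ⁻¹ᵁ (π.left ⁻¹ᵁ V)),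
      evalAt z hz ∘ matVec M = matVec (M.map (evalAt z hz)) := fun z hz => rfl
  have h2 : ∀ {R : Type u} (M N : Matrix ι ι R), matVec M = matVec N ↔ M = N := fun M N =>
    ⟨fun h => Matrix.ext fun a b => congrFun h (a, b), fun h => h ▸ rfl⟩
  unfold IsConjEquivariantOver IsEquivariantOver
  simp only [h1, Rep.tensor_hom, kronecker_mulVec_matVec, Rep.dual_hom, Matrix.transpose_transpose,
    h2]

theorem scalar_val {R : Type*} [CommRing R] (c : Rˣ) :
    (Matrix.GeneralLinearGroup.scalar ι c).1 = Matrix.scalar ι (c : R) := rfl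

theorem IsHonest.isProjective (h : 𝒜.IsHonest ρ) : 𝒜.IsProjective ρ := fun _ g z hg =>
  ⟨1, by rw [h g z hg, map_one]⟩

theorem IsProjective.tensor (h : 𝒜.IsProjective ρ) (h' : 𝒜.IsProjective ρ') :
    𝒜.IsProjective (ρ.tensor ρ') := by
  intro T g z hg
  obtain ⟨c, hc⟩ := h g z hg
  obtain ⟨d, hd⟩ := h' g z hg
  refine ⟨c * d, Units.ext ?_⟩
  rw [Rep.tensor_hom, hc, hd]
  ext ⟨a, b⟩ ⟨a', b'⟩
  simp only [scalar_val, Matrix.kroneckerMap_apply, Matrix.scalar_apply, Matrix.diagonal_apply,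
    Prod.mk.injEq, Units.val_mul]
  split_ifs <;> simp_all

theorem IsProjective.dual (h : 𝒜.IsProjective ρ) : 𝒜.IsProjective ρ.dual := by
  intro T g z hg
  obtain ⟨c, hc⟩ := h g z hg
  refine ⟨c⁻¹, Units.ext ?_⟩
  rw [Rep.dual_hom, map_inv, hc, ← map_inv, scalar_val, Matrix.scalar_apply,
    Matrix.diagonal_transpose]

/-- Conjugation by a scalar is trivial. Hence projectivity suffices to descend the algebra, although
the vector bundle itself need not descend. -/
theorem IsProjective.conj (h : 𝒜.IsProjective ρ) : 𝒜.IsHonest ρ.conj := by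
  intro T g z hg
  obtain ⟨c, hc⟩ := h g z hg
  refine Units.ext ?_
  rw [Rep.tensor_hom, Rep.dual_hom, map_inv, hc, ← map_inv, scalar_val, scalar_val]
  ext ⟨a, b⟩ ⟨a', b'⟩
  simp only [Matrix.kroneckerMap_apply, Matrix.scalar_apply, Matrix.diagonal_apply,
    Matrix.diagonal_transpose, Matrix.one_apply, Prod.mk.injEq, Units.val_one]
  split_ifs <;> simp_all

theorem IsConjEquivariantOver.res {V V' : Y.left.Opens} {M : Matrix ι ι Γ(Z.left, π.left ⁻¹ᵁ V)}
    (hM : 𝒜.IsConjEquivariantOver ρ V M) (i : V' ≤ V) :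
    𝒜.IsConjEquivariantOver ρ V' (M.map (resPreimage π i)) := by
  intro T z z' g hg hz hz'
  have h1 : ∀ (w : T ⟶ Z) (hw : ⊤ ≤ w.left ⁻¹ᵁ (π.left ⁻¹ᵁ V')),
      (M.map (resPreimage π i)).map (evalAt w hw) = M.map (evalAt w
        (hw.trans (w.left.preimage_mono (π.left.preimage_mono i)))) :=
    fun w hw => Matrix.ext fun a b => evalAt_resPreimage i w hw (M a b)
  rw [h1, h1]
  exact hM T z z' g hg _ _

theorem IsConjEquivariantOver.mul {V : Y.left.Opens} {M N : Matrix ι ι Γ(Z.left, π.left ⁻¹ᵁ V)}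
    (hM : 𝒜.IsConjEquivariantOver ρ V M) (hN : 𝒜.IsConjEquivariantOver ρ V N) :
    𝒜.IsConjEquivariantOver ρ V (M * N) := by
  intro T z z' g hg hz hz'
  rw [Matrix.map_mul, Matrix.map_mul, hM T z z' g hg hz hz', hN T z z' g hg hz hz']
  have h1 : (ρ.hom g⁻¹).1 * (ρ.hom g).1 = 1 := by
    rw [← Units.val_mul, ← map_mul, inv_mul_cancel, map_one, Units.val_one]
  simp only [mul_assoc]
  rw [← mul_assoc (ρ.hom g⁻¹).1 (ρ.hom g).1, h1, one_mul]

theorem isConjEquivariantOver_one (V : Y.left.Opens) :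
    𝒜.IsConjEquivariantOver ρ V (1 : Matrix ι ι Γ(Z.left, π.left ⁻¹ᵁ V)) := by
  intro T z z' g hg hz hz'
  rw [Matrix.map_one _ (map_zero _) (map_one _), Matrix.map_one _ (map_zero _) (map_one _), mul_one,
    ← Units.val_mul, ← map_mul, mul_inv_cancel, map_one, Units.val_one]

theorem IsConjEquivariantOver.kronecker {V : Y.left.Opens}
    {M : Matrix ι ι Γ(Z.left, π.left ⁻¹ᵁ V)} {N : Matrix ι' ι' Γ(Z.left, π.left ⁻¹ᵁ V)}
    (hM : 𝒜.IsConjEquivariantOver ρ V M) (hN : 𝒜.IsConjEquivariantOver ρ' V N) :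
    𝒜.IsConjEquivariantOver (ρ.tensor ρ') V (M ⊗ₖ N) := by
  intro T z z' g hg hz hz'
  have h1 : ∀ (w : T ⟶ Z) (hw : ⊤ ≤ w.left ⁻¹ᵁ (π.left ⁻¹ᵁ V)), (M ⊗ₖ N).map (evalAt w hw) =
      M.map (evalAt w hw) ⊗ₖ N.map (evalAt w hw) := fun w hw => by
    ext a b
    simp [Matrix.kroneckerMap_apply]
  rw [h1, h1, hM T z z' g hg hz hz', hN T z z' g hg hz hz', Rep.tensor_hom, Rep.tensor_hom,
    ← Matrix.mul_kronecker_mul, ← Matrix.mul_kronecker_mul]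

theorem IsConjEquivariantOver.transpose {V : Y.left.Opens}
    {M : Matrix ι ι Γ(Z.left, π.left ⁻¹ᵁ V)} (hM : 𝒜.IsConjEquivariantOver ρ V M) :
    𝒜.IsConjEquivariantOver ρ.dual V Mᵀ := by
  intro T z z' g hg hz hz'
  rw [Rep.dual_hom, Rep.dual_hom, inv_inv, Matrix.transpose_map, Matrix.transpose_map,
    hM T z z' g hg hz hz', Matrix.transpose_mul, Matrix.transpose_mul, mul_assoc]

/-! ### Forms of matrix algebras over the function field and their Brauer classes -/

section Form
variable [IsIntegral Y.left] {L : Type u} [Field L] [Algebra Y.left.functionField L]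
  (z₀ : GenericPt π L)

theorem IsHonest.mem_forms (h : 𝒜.IsHonest ρ) {v : ι → L} : v ∈ h.datum.forms z₀ ↔
    ∃ (V : Y.left.Opens) (hV : genericPoint Y.left ∈ V)
    (M : ι → Γ(Z.left, π.left ⁻¹ᵁ V)), 𝒜.IsEquivariantOver ρ V M ∧ v = z₀.eval hV ∘ M := by
  simp only [← h.isEquivariantOver_iff]
  rfl

/-- The coefficients of matrices as a linear map. -/
def matVecₗ (R A : Type*) [CommRing R] [CommRing A] [Algebra R A] :
    Matrix ι ι A ≃ₗ[R] (ι × ι → A) where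
  toFun M := matVec M
  invFun v := Matrix.of fun a b => v (a, b)
  map_add' _ _ := rfl
  map_smul' _ _ := rfl
  left_inv _ := rfl
  right_inv _ := rfl

theorem IsProjective.mem_comap (h : 𝒜.IsProjective ρ) {a : Matrix ι ι L} :
    matVec a ∈ h.conj.datum.forms z₀ ↔
    ∃ (V : Y.left.Opens) (hV : genericPoint Y.left ∈ V)
    (M : Matrix ι ι Γ(Z.left, π.left ⁻¹ᵁ V)), 𝒜.IsConjEquivariantOver ρ V M ∧
      a = M.map (z₀.eval hV) := by
  rw [h.conj.mem_forms]
  constructor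
  · rintro ⟨V, hV, M, hM, ha⟩
    exact ⟨V, hV, Matrix.of fun a b => M (a, b), isConjEquivariantOver_iff.2 hM,
      Matrix.ext fun a b => congrFun ha (a, b)⟩
  · rintro ⟨V, hV, M, hM, rfl⟩
    exact ⟨V, hV, matVec M, isConjEquivariantOver_iff.1 hM, rfl⟩

omit [Fintype ι] [DecidableEq ι] [Fintype ι'] [DecidableEq ι'] in
theorem map_eval_res {V V' : Y.left.Opens} (i : V' ≤ V) (hV' : genericPoint Y.left ∈ V')
    (M : Matrix ι ι' Γ(Z.left, π.left ⁻¹ᵁ V)) :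
    (M.map (resPreimage π i)).map (z₀.eval hV') = M.map (z₀.eval (i hV')) :=
  Matrix.ext fun a b => z₀.eval_res i hV' (M a b)

/-- The algebra over the function field of `Y` of values at `z₀` of equivariant matrices: the twist
of the algebra of matrices by the torsor `π` and the representation `ρ`. -/
def IsProjective.formAlgebra (h : 𝒜.IsProjective ρ) :
    Subalgebra Y.left.functionField (Matrix ι ι L) :=
  ((h.conj.datum.forms z₀).comap (matVecₗ Y.left.functionField L).toLinearMap).toSubalgebra
    ((h.mem_comap z₀).2 ⟨⊤, trivial, 1, isConjEquivariantOver_one _,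
      (Matrix.map_one _ (map_zero _) (map_one _)).symm⟩)
    (by
      intro a b ha hb
      obtain ⟨V, hV, M, hM, rfl⟩ := (h.mem_comap z₀).1 ha
      obtain ⟨W, hW, N, hN, rfl⟩ := (h.mem_comap z₀).1 hb
      have hVW : genericPoint Y.left ∈ V ⊓ W := ⟨hV, hW⟩
      refine (h.mem_comap z₀ (a := _ * _)).2 ⟨V ⊓ W, hVW, _,
        (hM.res inf_le_left).mul (hN.res inf_le_right), ?_⟩
      rw [Matrix.map_mul, map_eval_res z₀ inf_le_left hVW M,
        map_eval_res z₀ inf_le_right hVW N])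

theorem IsProjective.mem_formAlgebra (h : 𝒜.IsProjective ρ) {a : Matrix ι ι L} :
    a ∈ h.formAlgebra z₀ ↔
    ∃ (V : Y.left.Opens) (hV : genericPoint Y.left ∈ V)
    (M : Matrix ι ι Γ(Z.left, π.left ⁻¹ᵁ V)), 𝒜.IsConjEquivariantOver ρ V M ∧
      a = M.map (z₀.eval hV) :=
  h.mem_comap z₀

omit [AlgebraicGeometry.IsIntegral Y.left] in
theorem exists_lift (𝒜 : QuotientAction G π) :
    ∃ (T : Over S) (p : T ⟶ Y), IsFppfCover p ∧ ∃ x : T ⟶ Z, x ≫ π = p := by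
  obtain ⟨T, p, hp, x, hx⟩ := 𝒜.lift (𝟙 Y)
  exact ⟨T, p, hp, x, by rw [hx, Category.comp_id]⟩

/-- Up to reading matrices as vectors, this is `exists_basis_forms` for the descent datum of the
conjugation representation. -/
theorem IsProjective.isMatrixForm (h : 𝒜.IsProjective ρ) :
    IsMatrixForm (h.formAlgebra z₀).val := by
  obtain ⟨b, hb⟩ := h.conj.datum.exists_basis_forms 𝒜.exists_lift z₀
  let e : h.formAlgebra z₀ ≃ₗ[Y.left.functionField] h.conj.datum.forms z₀ :=
    { toFun := fun a => ⟨matVec a.1, a.2⟩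
      map_add' := fun _ _ => rfl
      map_smul' := fun _ _ => rfl
      invFun := fun v => ⟨Matrix.of fun a b => v.1 (a, b), v.2⟩
      left_inv := fun _ => rfl
      right_inv := fun _ => rfl }
  refine ⟨b.map e.symm, ?_⟩
  refine LinearIndependent.of_comp (matVecₗ (ι := ι) L L).toLinearMap ?_
  exact hb

variable [Nonempty ι] [Nonempty ι']

/-- The Brauer class of the twist of the algebra of matrices by the torsor `π` and the
representation `ρ`. -/
def IsProjective.brauer (h : 𝒜.IsProjective ρ) : BrauerGroup.{u, u} Y.left.functionField :=
  classOf _ (h.isMatrixForm z₀).isCSA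

/-- After restriction to a common open set, Kronecker products of equivariant matrices are
equivariant for the tensor product. -/
theorem IsProjective.brauer_tensor (h : 𝒜.IsProjective ρ) (h' : 𝒜.IsProjective ρ') :
    (h.tensor h').brauer z₀ = h.brauer z₀ + h'.brauer z₀ := by
  refine (h.isMatrixForm z₀).classOf_kronecker (h'.isMatrixForm z₀)
    ((h.tensor h').isMatrixForm z₀) ?_
  rintro ⟨a, ha⟩ ⟨b, hb⟩
  obtain ⟨V, hV, M, hM, rfl⟩ := (h.mem_formAlgebra z₀).1 ha
  obtain ⟨W, hW, N, hN, rfl⟩ := (h'.mem_formAlgebra z₀).1 hb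
  refine ⟨⟨_, ((h.tensor h').mem_formAlgebra z₀).2 ⟨V ⊓ W, ⟨hV, hW⟩, _,
    (hM.res inf_le_left).kronecker (hN.res inf_le_right), rfl⟩⟩, ?_⟩
  change Matrix.map _ _ = M.map (z₀.eval hV) ⊗ₖ N.map (z₀.eval hW)
  rw [← map_eval_res z₀ inf_le_left ⟨hV, hW⟩ M, ← map_eval_res z₀ inf_le_right ⟨hV, hW⟩ N]
  ext a b
  simp [Matrix.kroneckerMap_apply]

/-- Transposition carries equivariant matrices to equivariant matrices for the dual, reversing
products. -/
theorem IsProjective.brauer_dual (h : 𝒜.IsProjective ρ) :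
    h.dual.brauer z₀ = - h.brauer z₀ := by
  refine (h.isMatrixForm z₀).classOf_transpose (h.dual.isMatrixForm z₀) ?_
  rintro ⟨a, ha⟩
  obtain ⟨V, hV, M, hM, rfl⟩ := (h.mem_formAlgebra z₀).1 ha
  exact ⟨⟨_, (h.dual.mem_formAlgebra z₀).2 ⟨V, hV, _, hM.transpose, rfl⟩⟩, rfl⟩

/-- In the honest case the vectors descend as well. An equivariant matrix maps equivariant vectors
to equivariant vectors, so the algebra acts on a `k(Y)`-space of the right dimension and is split.
-/
theorem IsHonest.brauer_eq_zero (h : 𝒜.IsHonest ρ) : h.isProjective.brauer z₀ = 0 := by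
  obtain ⟨b, -⟩ := h.datum.exists_basis_forms 𝒜.exists_lift z₀
  refine (h.isProjective.isMatrixForm z₀).classOf_eq_zero b ?_
  rintro ⟨a, ha⟩ v hv
  obtain ⟨V, hV, M, hM, rfl⟩ := (h.isProjective.mem_formAlgebra z₀).1 ha
  obtain ⟨W, hW, N, hN, rfl⟩ := (h.mem_forms z₀).1 hv
  have hM' := hM.res (inf_le_left : V ⊓ W ≤ V)
  refine (h.mem_forms z₀).2 ⟨V ⊓ W, ⟨hV, hW⟩, M.map (resPreimage π inf_le_left) *ᵥ
    (resPreimage π inf_le_right ∘ N), ?_, ?_⟩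
  · intro T z z' g hg hz hz'
    have h1 : ∀ (w : T ⟶ Z) (hw : ⊤ ≤ w.left ⁻¹ᵁ (π.left ⁻¹ᵁ (V ⊓ W)))
        (A : Matrix ι ι Γ(Z.left, π.left ⁻¹ᵁ (V ⊓ W))) (v : ι → Γ(Z.left, π.left ⁻¹ᵁ (V ⊓ W))),
        evalAt w hw ∘ (A *ᵥ v) = A.map (evalAt w hw) *ᵥ (evalAt w hw ∘ v) :=
      fun w hw A v => funext fun a => RingHom.map_mulVec (evalAt w hw) A v a
    have h2 : ∀ (w : T ⟶ Z) (hw : ⊤ ≤ w.left ⁻¹ᵁ (π.left ⁻¹ᵁ (V ⊓ W))),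
        evalAt w hw ∘ resPreimage π (inf_le_right : V ⊓ W ≤ W) ∘ N = evalAt w
          (hw.trans (w.left.preimage_mono (π.left.preimage_mono inf_le_right))) ∘ N :=
      fun w hw => funext fun a => evalAt_resPreimage inf_le_right w hw (N a)
    rw [h1, h1, hM' T z z' g hg hz hz', h2, h2, hN T z z' g hg
      (hz.trans (z.left.preimage_mono (π.left.preimage_mono inf_le_right))), Matrix.mulVec_mulVec,
      Matrix.mulVec_mulVec, mul_assoc, ← Units.val_mul, ← map_mul, inv_mul_cancel, map_one,
      Units.val_one, mul_one]
  · change M.map (z₀.eval hV) *ᵥ _ = _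
    rw [← map_eval_res z₀ (inf_le_left : V ⊓ W ≤ V) ⟨hV, hW⟩ M]
    have h2 : z₀.eval hW ∘ N =
        z₀.eval (V := V ⊓ W) ⟨hV, hW⟩ ∘ resPreimage π (inf_le_right : V ⊓ W ≤ W) ∘ N :=
      funext fun a => (z₀.eval_res inf_le_right ⟨hV, hW⟩ (N a)).symm
    rw [h2]
    exact funext fun a => (RingHom.map_mulVec _ _ _ a).symm

end Form
end QuotientAction
end Classes

/-! ### Comparison with the generic fibre of the bundle of matrix algebras -/

section Comparison
open TwistedGrassmannian.Brauer

variable {S : Scheme.{u}}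

/-- The group functor `GL_n`. -/
def glFunctor (S : Scheme.{u}) (n : ℕ) : GroupFunctor S where
  pts T := GL (Fin n) (Fn T)
  res f := glMap f

/-- The tautological representation of `GL_n`. -/
def stdRep (S : Scheme.{u}) (n : ℕ) : Rep (glFunctor S n) (Fin n) where
  hom {T} := MonoidHom.id (GL (Fin n) (Fn T))
  natural _ _ := rfl

/-- The action on the source of the quotient morphism. -/
def GLAction.IsQuotient.quotientAction {n : ℕ} {X Y : Over S} {A : GLSchemeAction n X} {π : X ⟶ Y}
    (h : A.IsQuotient π) : QuotientAction (glFunctor S n) π where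
  act g x := A.act g x
  one_act x := A.one_act x
  mul_act g g' x := A.mul_act g g' x
  comp_act f g x := A.comp_act f g x
  invariant g x := h.invariant g x
  lift := h.lift
  transitive := h.transitive

theorem functionFieldMap_id (X : Scheme.{u}) [IsIntegral X] :
    functionFieldMap (𝟙 X) = RingHom.id X.functionField := by
  ext c
  obtain ⟨V, hV, s, rfl⟩ := X.presheaf.exists_germ_eq c
  refine (functionFieldMap_germ (𝟙 X) V hV hV s).trans ?_
  rw [Scheme.Hom.id_app]
  rfl

/-- The generic point of `X`, over the generic point of `Y`. -/
def atGenericPoint {X Y : Over S} [IsIntegral X.left] [IsIntegral Y.left] (π : X ⟶ Y)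
    [IsDominant π.left] :
    letI : Algebra Y.left.functionField X.left.functionField :=
      (functionFieldMap π.left).toAlgebra
    GenericPt π X.left.functionField :=
  letI : Algebra Y.left.functionField X.left.functionField :=
    (functionFieldMap π.left).toAlgebra
  { pt := X.left.fromSpecStalk (genericPoint X.left)
    w := by
      rw [← Scheme.SpecMap_stalkMap_fromSpecStalk,
        ← Scheme.SpecMap_stalkSpecializes_fromSpecStalk
          (specializes_genericPoint π.left), ← Category.assoc, ← Spec.map_comp]
      rfl }

theorem atGenericPoint_eval {X Y : Over S} [IsIntegral X.left] [IsIntegral Y.left] (π : X ⟶ Y)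
    [IsDominant π.left] {V : Y.left.Opens} (hV : genericPoint Y.left ∈ V)
    (s : Γ(X.left, π.left ⁻¹ᵁ V)) :
    letI : Algebra Y.left.functionField X.left.functionField :=
      (functionFieldMap π.left).toAlgebra
    (atGenericPoint π).eval hV s =
      germ (π.left ⁻¹ᵁ V) (genericPoint_mem_preimage π.left hV) s := by
  let _ : Algebra Y.left.functionField X.left.functionField :=
      (functionFieldMap π.left).toAlgebra
  have hU := genericPoint_mem_preimage π.left hV
  have h1 : (X.left.fromSpecStalk (genericPoint X.left)).appLE (π.left ⁻¹ᵁ V) ⊤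
      (fromSpecStalk_preimage hV (atGenericPoint π).w) =
      X.left.presheaf.germ _ _ hU ≫ (Scheme.ΓSpecIso _).inv := by
    rw [Scheme.Hom.appLE, Scheme.fromSpecStalk_app hU, Category.assoc, Category.assoc,
      ← Functor.map_comp]
    refine congrArg _ ((congrArg _ ?_).trans (Category.comp_id _))
    exact (Spec X.left.functionField).presheaf.map_id (op ⊤)
  refine (congrArg (specFn X.left.functionField) congr($h1 s)).trans ?_
  exact congr($((Scheme.ΓSpecIso _).inv_hom_id) (germ (π.left ⁻¹ᵁ V) hU s))

/-! ### The generic fibre of the associated bundle as a form of a matrix algebra -/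

section Generic
variable {n : ℕ} {X Y : Over S} [IsIntegral X.left] [IsIntegral Y.left] {A : GLSchemeAction n X}
  {π : X ⟶ Y} (h : A.IsQuotient π)
  (hs : ∀ {T : Over S} (g : GL (Fin n) (Fn T)) (x : T ⟶ X), A.act g x = x →
    ∃ t : (Fn T)ˣ, g = scalarPt n t)

include hs

omit [AlgebraicGeometry.IsIntegral X.left] [AlgebraicGeometry.IsIntegral Y.left] in
theorem GLAction.IsQuotient.isProjective : h.quotientAction.IsProjective (stdRep S n) :=
  fun _ g x hg => hs g x hg

/-- For `z₀` the generic point of `X`, evaluation is taking germs, so the generic fibre is literally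
the form algebra at `z₀`. -/
theorem GLAction.IsQuotient.isMatrixForm :
    haveI := h.isDominant
    letI : Algebra Y.left.functionField X.left.functionField :=
      (functionFieldMap π.left).toAlgebra
    IsMatrixForm (A.genericSubalgebra π h.isInvariant).val := by
  have := h.isDominant
  let _ : Algebra Y.left.functionField X.left.functionField :=
    (functionFieldMap π.left).toAlgebra
  have h1 : A.genericSubalgebra π h.isInvariant =
      (h.isProjective hs).formAlgebra (atGenericPoint π) := by
    ext a
    rw [QuotientAction.IsProjective.mem_formAlgebra]
    refine exists_congr fun V => exists_congr fun hV => exists_congr fun M => and_congr Iff.rfl ?_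
    have h2 : M.map ((atGenericPoint π).eval hV) =
        M.map (germ (π.left ⁻¹ᵁ V) (genericPoint_mem_preimage π.left hV)) :=
      Matrix.ext fun i j => atGenericPoint_eval π hV (M i j)
    rw [h2]
  have h3 := (h.isProjective hs).isMatrixForm (atGenericPoint π)
  rw [← h1] at h3
  exact h3

theorem GLAction.IsQuotient.isCSA (hn : 0 < n) :
    IsCSA (A.genericAlgebra π h.isInvariant) := by
  have : Nonempty (Fin n) := ⟨⟨0, hn⟩⟩
  have := h.isDominant
  let _ : Algebra Y.left.functionField X.left.functionField :=
    (functionFieldMap π.left).toAlgebra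
  exact (h.isMatrixForm hs).isCSA

theorem GLAction.IsQuotient.finrank_genericAlgebra :
    Module.finrank Y.left.functionField (A.genericAlgebra π h.isInvariant) = n ^ 2 := by
  have := h.isDominant
  let _ : Algebra Y.left.functionField X.left.functionField :=
    (functionFieldMap π.left).toAlgebra
  have h1 := (h.isMatrixForm hs).finrank
  rw [Fintype.card_fin] at h1
  exact h1

end Generic

/-! ### Functoriality under equivariant morphisms of quotients -/

section Pullback
variable {Z Y Z' Y' : Over S} {π : Z ⟶ Y} {π' : Z' ⟶ Y'} {φ : Y ⟶ Y'} {ψ : Z ⟶ Z'}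

theorem le_preimage (hψ : ψ ≫ π' = π ≫ φ) (V : Y'.left.Opens) :
    π.left ⁻¹ᵁ (φ.left ⁻¹ᵁ V) ≤ ψ.left ⁻¹ᵁ (π'.left ⁻¹ᵁ V) := by
  have h1 : ψ.left ≫ π'.left = π.left ≫ φ.left := congrArg (fun f => f.left) hψ
  rw [← Scheme.Hom.comp_preimage, ← Scheme.Hom.comp_preimage, h1]

/-- Pullback of functions on preimages of open sets. -/
def pullFn (hψ : ψ ≫ π' = π ≫ φ) (V : Y'.left.Opens) :
    Γ(Z'.left, π'.left ⁻¹ᵁ V) →+* Γ(Z.left, π.left ⁻¹ᵁ (φ.left ⁻¹ᵁ V)) :=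
  (ψ.left.appLE _ _ (le_preimage hψ V)).hom

theorem evalAt_pullFn (hψ : ψ ≫ π' = π ≫ φ) (V : Y'.left.Opens) {T : Over S} (z : T ⟶ Z)
    (hz : ⊤ ≤ z.left ⁻¹ᵁ (π.left ⁻¹ᵁ (φ.left ⁻¹ᵁ V)))
    (hz' : ⊤ ≤ (z ≫ ψ).left ⁻¹ᵁ (π'.left ⁻¹ᵁ V)) (s : Γ(Z'.left, π'.left ⁻¹ᵁ V)) :
    evalAt z hz (pullFn hψ V s) = evalAt (z ≫ ψ) hz' s :=
  congr($(Scheme.Hom.appLE_comp_appLE z.left ψ.left _ _ _ (le_preimage hψ V) hz) s)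

theorem pullFn_res (hψ : ψ ≫ π' = π ≫ φ) {V V' : Y'.left.Opens} (i : V' ≤ V)
    (s : Γ(Z'.left, π'.left ⁻¹ᵁ V)) : pullFn hψ V' (resPreimage π' i s) =
      resPreimage π (φ.left.preimage_mono i) (pullFn hψ V s) := by
  have h1 := Scheme.Hom.map_appLE ψ.left (le_preimage hψ V')
    (homOfLE (π'.left.preimage_mono i)).op
  have h2 := Scheme.Hom.appLE_map ψ.left (le_preimage hψ V)
    (homOfLE (π.left.preimage_mono (φ.left.preimage_mono i))).op
  exact congr($(h1.trans h2.symm) s)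

theorem pullFn_app (hψ : ψ ≫ π' = π ≫ φ) (V : Y'.left.Opens) (s : Γ(Y'.left, V)) :
    pullFn hψ V (π'.left.app V s) = π.left.app _ (φ.left.app V s) := by
  have h1 : ψ.left ≫ π'.left = π.left ≫ φ.left := congrArg (fun f => f.left) hψ
  have h2 := Scheme.Hom.comp_appLE ψ.left π'.left V _ (le_preimage hψ V)
  have h3 : (ψ.left ≫ π'.left).appLE V (π.left ⁻¹ᵁ (φ.left ⁻¹ᵁ V)) (le_preimage hψ V) =
      φ.left.app V ≫ π.left.app _ := by
    have key : ∀ (f : Z.left ⟶ Y'.left) (e : f = π.left ≫ φ.left)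
        (hf : π.left ⁻¹ᵁ (φ.left ⁻¹ᵁ V) ≤ f ⁻¹ᵁ V),
        f.appLE V _ hf = φ.left.app V ≫ π.left.app _ := by
      rintro _ rfl hf
      rw [← Scheme.Hom.comp_app, Scheme.Hom.app_eq_appLE]
      rfl
    exact key _ h1 _
  exact congr($(h2.symm.trans h3) s)

variable [IsIntegral Y.left] [IsIntegral Z'.left] [IsIntegral Y'.left] [IsDominant φ.left]

/-- The image of `z₀` in `Z'` need not be the generic point, so a germ there has no value at `z₀` by
itself. But `Z'` is integral, so functions with equal germs agree on the preimage of `V ⊓ W`, which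
contains the image of `z₀`. -/
theorem eval_pullFn_congr [IsDominant π'.left] (hψ : ψ ≫ π' = π ≫ φ) {L : Type u} [Field L]
    [Algebra Y.left.functionField L] (z₀ : GenericPt π L) {V W : Y'.left.Opens}
    (hV : genericPoint Y'.left ∈ V) (hW : genericPoint Y'.left ∈ W)
    (s : Γ(Z'.left, π'.left ⁻¹ᵁ V)) (t : Γ(Z'.left, π'.left ⁻¹ᵁ W))
    (h : germ (π'.left ⁻¹ᵁ V) (genericPoint_mem_preimage π'.left hV) s =
      germ (π'.left ⁻¹ᵁ W) (genericPoint_mem_preimage π'.left hW) t) :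
    z₀.eval (genericPoint_mem_preimage φ.left hV) (pullFn hψ V s) =
      z₀.eval (genericPoint_mem_preimage φ.left hW) (pullFn hψ W t) := by
  have hVW : genericPoint Y'.left ∈ V ⊓ W := ⟨hV, hW⟩
  have h1 : resPreimage π' (inf_le_left : V ⊓ W ≤ V) s =
      resPreimage π' (inf_le_right : V ⊓ W ≤ W) t := by
    have : Nonempty (π'.left ⁻¹ᵁ (V ⊓ W) : Z'.left.Opens) :=
      ⟨⟨_, genericPoint_mem_preimage π'.left hVW⟩⟩
    refine germ_injective_of_isIntegral Z'.left (genericPoint Z'.left)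
      (genericPoint_mem_preimage π'.left hVW) ?_
    refine (germ_res (homOfLE (π'.left.preimage_mono inf_le_left))
      (genericPoint_mem_preimage π'.left hVW) s).trans (h.trans ?_)
    exact (germ_res (homOfLE (π'.left.preimage_mono inf_le_right))
      (genericPoint_mem_preimage π'.left hVW) t).symm
  have h2 := congrArg (fun r => z₀.eval (genericPoint_mem_preimage φ.left hVW) (pullFn hψ _ r)) h1
  simp only [pullFn_res] at h2
  rw [z₀.eval_res _ (genericPoint_mem_preimage φ.left hVW),
    z₀.eval_res _ (genericPoint_mem_preimage φ.left hVW)] at h2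
  exact h2

/-- Functoriality of the Brauer classes of torsors. -/
theorem brauer_eq_pullback {G : GroupFunctor S} {𝒜 : QuotientAction G π} {n : ℕ} [Nonempty (Fin n)]
    {ρ : Rep G (Fin n)} (hρ : 𝒜.IsProjective ρ) {L : Type u} [Field L]
    [Algebra Y.left.functionField L] (z₀ : GenericPt π L)
    {A' : GLSchemeAction n Z'} (h' : A'.IsQuotient π')
    (hs : ∀ {T : Over S} (g : GL (Fin n) (Fn T)) (x : T ⟶ Z'), A'.act g x = x →
      ∃ t : (Fn T)ˣ, g = scalarPt n t)
    (csa : IsCSA (A'.genericAlgebra π' h'.isInvariant))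
    (hψ : ψ ≫ π' = π ≫ φ)
    (hact : ∀ {T : Over S} (g : G.pts T) (z : T ⟶ Z),
      𝒜.act g z ≫ ψ = (show T ⟶ Z' from A'.act (ρ.hom g) (z ≫ ψ))) :
    hρ.brauer z₀ = pullback (functionFieldMap φ.left) (classOf _ csa) := by
  have := h'.isDominant
  let _ : Algebra Y'.left.functionField Z'.left.functionField :=
    (functionFieldMap π'.left).toAlgebra
  have hV' : ∀ {V : Y'.left.Opens}, genericPoint Y'.left ∈ V →
      genericPoint Y.left ∈ φ.left ⁻¹ᵁ V := fun hV => genericPoint_mem_preimage φ.left hV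
  let ev : ∀ {V : Y'.left.Opens} (hV : genericPoint Y'.left ∈ V),
      Γ(Z'.left, π'.left ⁻¹ᵁ V) →+* L := fun {V} hV => (z₀.eval (hV' hV)).comp (pullFn hψ V)
  have hev : ∀ {V W : Y'.left.Opens} (hV : genericPoint Y'.left ∈ V) (hW : genericPoint Y'.left ∈ W)
      {M : Matrix (Fin n) (Fin n) Γ(Z'.left, π'.left ⁻¹ᵁ V)}
      {N : Matrix (Fin n) (Fin n) Γ(Z'.left, π'.left ⁻¹ᵁ W)},
      M.map (germ (π'.left ⁻¹ᵁ V) (genericPoint_mem_preimage π'.left hV)) =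
        N.map (germ (π'.left ⁻¹ᵁ W) (genericPoint_mem_preimage π'.left hW)) →
      M.map (ev hV) = N.map (ev hW) := fun hV hW M N hMN =>
    Matrix.ext fun i j => eval_pullFn_congr hψ z₀ hV hW _ _ congr($hMN i j)
  have hmem : ∀ {V : Y'.left.Opens} (hV : genericPoint Y'.left ∈ V)
      {M : Matrix (Fin n) (Fin n) Γ(Z'.left, π'.left ⁻¹ᵁ V)}, A'.IsEquivariantOver π' V M →
      M.map (ev hV) ∈ hρ.formAlgebra z₀ := by
    intro V hV M hM
    refine (hρ.mem_formAlgebra z₀).2 ⟨φ.left ⁻¹ᵁ V, hV' hV, M.map (pullFn hψ V), ?_, rfl⟩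
    intro T z z' g hg hz hz'
    have h1 : ∀ (w : T ⟶ Z) (hw : ⊤ ≤ w.left ⁻¹ᵁ (π.left ⁻¹ᵁ (φ.left ⁻¹ᵁ V))),
        ⊤ ≤ (w ≫ ψ).left ⁻¹ᵁ (π'.left ⁻¹ᵁ V) := fun w hw =>
      hw.trans (w.left.preimage_mono (le_preimage hψ V))
    have h2 : ∀ (w : T ⟶ Z) (hw : ⊤ ≤ w.left ⁻¹ᵁ (π.left ⁻¹ᵁ (φ.left ⁻¹ᵁ V))),
        (M.map (pullFn hψ V)).map (evalAt w hw) = M.map (evalAt (w ≫ ψ) (h1 w hw)) :=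
      fun w hw => Matrix.ext fun i j => evalAt_pullFn hψ V w hw (h1 w hw) (M i j)
    rw [h2, h2, map_inv]
    exact hM T (z ≫ ψ) (z' ≫ ψ) (ρ.hom g) (by rw [← hg]; exact (hact g z).symm) _ _
  -- The homomorphism `g` below sends a germ to the value of a chosen representative; `hev` makes it
  -- independent of the choice, and compatibility with the ring operations is checked on
  -- intersections of the open sets.
  choose V hV M hM ha using fun a : A'.genericSubalgebra π' h'.isInvariant => a.2
  have key : ∀ (a : A'.genericSubalgebra π' h'.isInvariant) {W : Y'.left.Opens}
      (hW : genericPoint Y'.left ∈ W) (N : Matrix (Fin n) (Fin n) Γ(Z'.left, π'.left ⁻¹ᵁ W)),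
      a.1 = N.map (germ (π'.left ⁻¹ᵁ W) (genericPoint_mem_preimage π'.left hW)) →
      (M a).map (ev (hV a)) = N.map (ev hW) := fun a W hW N hN =>
    hev (hV a) hW ((ha a).symm.trans hN)
  have hgr : ∀ {W W' : Y'.left.Opens} (i : W' ≤ W) (hW' : genericPoint Y'.left ∈ W')
      (N : Matrix (Fin n) (Fin n) Γ(Z'.left, π'.left ⁻¹ᵁ W)),
      (N.map (resPreimage π' i)).map (germ _ (genericPoint_mem_preimage π'.left hW')) =
        N.map (germ _ (genericPoint_mem_preimage π'.left (i hW'))) := fun i hW' N =>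
    Matrix.ext fun a b => germ_res (homOfLE (π'.left.preimage_mono i)) _ (N a b)
  have hevr : ∀ {W W' : Y'.left.Opens} (i : W' ≤ W) (hW' : genericPoint Y'.left ∈ W')
      (N : Matrix (Fin n) (Fin n) Γ(Z'.left, π'.left ⁻¹ᵁ W)),
      (N.map (resPreimage π' i)).map (ev hW') = N.map (ev (i hW')) := fun i hW' N =>
    hev hW' (i hW') (hgr i hW' N)
  have hI : ∀ a b, genericPoint Y'.left ∈ V a ⊓ V b := fun a b => ⟨hV a, hV b⟩
  let g : A'.genericSubalgebra π' h'.isInvariant →+* hρ.formAlgebra z₀ :=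
    { toFun := fun a => ⟨(M a).map (ev (hV a)), hmem (hV a) (hM a)⟩
      map_one' := Subtype.ext (by
        refine (key 1 (W := ⊤) trivial 1 ?_).trans ?_
        · exact (Matrix.map_one _ (map_zero _) (map_one _)).symm
        · exact Matrix.map_one _ (map_zero _) (map_one _))
      map_zero' := Subtype.ext (by
        refine (key 0 (W := ⊤) trivial 0 ?_).trans ?_
        · exact (Matrix.map_zero _ (map_zero _)).symm
        · exact Matrix.map_zero _ (map_zero _))
      map_add' := fun a b => Subtype.ext (by
        refine (key (a + b) (hI a b) ((M a).map (resPreimage π' inf_le_left) +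
          (M b).map (resPreimage π' inf_le_right)) ?_).trans ?_
        · rw [Matrix.map_add _ (map_add _), hgr _ (hI a b), hgr _ (hI a b), ← ha, ← ha]
          rfl
        · rw [Matrix.map_add _ (map_add _), hevr _ (hI a b), hevr _ (hI a b)]
          rfl)
      map_mul' := fun a b => Subtype.ext (by
        refine (key (a * b) (hI a b) ((M a).map (resPreimage π' inf_le_left) *
          (M b).map (resPreimage π' inf_le_right)) ?_).trans ?_
        · rw [Matrix.map_mul, hgr _ (hI a b), hgr _ (hI a b), ← ha, ← ha]
          rfl
        · rw [Matrix.map_mul, hevr _ (hI a b), hevr _ (hI a b)]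
          rfl) }
  refine (pullback_classOf (functionFieldMap φ.left) csa (hρ.isMatrixForm z₀).isCSA g ?_ ?_).symm
  · intro c
    obtain ⟨W, hW, s, rfl⟩ := Y'.left.presheaf.exists_germ_eq c
    refine Subtype.ext ((key _ hW (Matrix.scalar (Fin n) (π'.left.app W s)) ?_).trans ?_)
    · have h1 := functionFieldMap_germ π'.left W hW (genericPoint_mem_preimage π'.left hW) s
      ext a b
      change (algebraMap _ (Matrix (Fin n) (Fin n) _) _) a b = _
      rw [Matrix.algebraMap_matrix_apply, Matrix.map_apply, Matrix.scalar_apply,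
        Matrix.diagonal_apply]
      split_ifs
      · exact h1
      · exact (map_zero _).symm
    · have h1 : ev hW (π'.left.app W s) =
          algebraMap _ L (functionFieldMap φ.left (germ W hW s)) := by
        refine (congrArg (z₀.eval (hV' hW)) (pullFn_app hψ W s)).trans ?_
        rw [z₀.eval_app (hV' hW), functionFieldMap_germ φ.left W hW (hV' hW)]
      ext a b
      change _ = (algebraMap _ (Matrix (Fin n) (Fin n) L) _) a b
      rw [Matrix.algebraMap_matrix_apply, Matrix.map_apply, Matrix.scalar_apply,
        Matrix.diagonal_apply]
      split_ifs
      · exact h1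
      · exact map_zero _
  · refine (h'.finrank_genericAlgebra hs).trans ?_
    refine Eq.trans ?_ (hρ.isMatrixForm z₀).finrank.symm
    rw [Fintype.card_fin]

end Pullback
end Comparison

/-! ### Frames of sub-bundles -/

section Frames
variable {S : Scheme.{u}}

theorem glMap_scalarPt {n : ℕ} {T' T : Over S} (f : T' ⟶ T) (t : (Fn T)ˣ) :
    glMap f (scalarPt n t) = scalarPt n (Units.map (fnMap f : Fn T →* Fn T') t) := by
  ext a b
  change fnMap f (Matrix.scalar (Fin n) (t : Fn T) a b) = Matrix.scalar (Fin n) (fnMap f t) a b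
  simp only [Matrix.scalar_apply, Matrix.diagonal_apply]
  split_ifs
  · rfl
  · exact map_zero _

theorem scalar_change {R M : Type*} [CommRing R] [AddCommGroup M] [Module R M] {j : ℕ}
    (t : R) (v : Fin j → M) (l : Fin j) :
    ∑ m, Matrix.scalar (Fin j) t l m • v m = t • v l := by
  simp [Matrix.diagonal_apply]

namespace VBundle
variable {X : Over S} {r : ℕ} {P : VBundle X r} {j : ℕ}

theorem linearIndependent_of_isFrame {T : Over S} {x : T ⟶ X} {v : Fin j → P.Sect x}
    (hv : P.IsFrame v) : LinearIndependent (Fn T) v := by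
  have h1 := hv (𝟙 T) x (Category.id_comp x)
  simpa only [pull_id] using h1

namespace FrPoint

theorem span_frame_self {T : Over S} (s : P.FrPoint j T) :
    s.sub (𝟙 T) s.base (Category.id_comp _) = Submodule.span (Fn T) (Set.range s.frame) := by
  have h1 := s.span_frame (𝟙 T) s.base (Category.id_comp _)
  simpa only [pull_id] using h1

theorem changeFrame_mul {T : Over S} (g h : GL (Fin j) (Fn T)) (s : P.FrPoint j T) :
    s.changeFrame (g * h) = (s.changeFrame h).changeFrame g :=
  (P.contravariantAction j).mul_act g h s

theorem eq_one_of_changeFrame {T : Over S} {g : GL (Fin j) (Fn T)} {s : P.FrPoint j T}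
    (h : s.changeFrame g = s) : g = 1 := by
  have h1 : ∀ l, ∑ m, g.1 l m • s.frame m = s.frame l := fun l =>
    Subtype.ext (congrArg (fun a : P.FrPoint j T => (a.frame l).1) h)
  have h2 := Fintype.linearIndependent_iff.1 (linearIndependent_of_isFrame s.isFrame)
  ext l m
  have h3 := h2 (fun m => g.1 l m - (1 : Matrix (Fin j) (Fin j) (Fn T)) l m) (by
    simp only [sub_smul, Finset.sum_sub_distrib]
    rw [h1, one_change, sub_self]) m
  exact sub_eq_zero.1 h3

/-- Two frames of one sub-bundle span the same module, so each is expressed through the other. -/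
theorem exists_changeFrame {T : Over S} (a b : P.FrPoint j T) (h : a.toGrPoint = b.toGrPoint) :
    ∃ g : GL (Fin j) (Fn T), a.changeFrame g = b := by
  obtain ⟨s, v, hv, hv'⟩ := a
  obtain ⟨s', w, hw, hw'⟩ := b
  obtain rfl : s = s' := h
  have h1 := span_frame_self ⟨s, v, hv, hv'⟩
  have h2 := span_frame_self ⟨s, w, hw, hw'⟩
  have key : ∀ {v w : Fin j → P.Sect s.base},
      Submodule.span (Fn T) (Set.range v) = Submodule.span (Fn T) (Set.range w) →
      ∃ g : Matrix (Fin j) (Fin j) (Fn T), ∀ l, ∑ m, g l m • v m = w l := by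
    intro v w h
    choose g hg using fun l => (Submodule.mem_span_range_iff_exists_fun (Fn T)).1
      (h.symm ▸ Submodule.subset_span ⟨l, rfl⟩ : w l ∈ Submodule.span (Fn T) (Set.range v))
    exact ⟨Matrix.of g, hg⟩
  obtain ⟨g, hg⟩ := key (h1.symm.trans h2)
  obtain ⟨g', hg'⟩ := key (h2.symm.trans h1)
  -- The transition matrices are mutually inverse because coefficients with respect to a frame are
  -- unique.
  have inv : ∀ {v w : Fin j → P.Sect s.base} {g g' : Matrix (Fin j) (Fin j) (Fn T)},
      P.IsFrame w → (∀ l, ∑ m, g l m • v m = w l) → (∀ l, ∑ m, g' l m • w m = v l) →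
      g * g' = 1 := by
    intro v w g g' hw hg hg'
    have h3 := Fintype.linearIndependent_iff.1 (linearIndependent_of_isFrame hw)
    ext l m
    have h4 := h3 (fun m => (g * g') l m - (1 : Matrix (Fin j) (Fin j) (Fn T)) l m) (by
      simp only [sub_smul, Finset.sum_sub_distrib]
      rw [one_change, change_change]
      simp only [hg', hg, sub_self]) m
    exact sub_eq_zero.1 h4
  exact ⟨⟨g, g', inv hw hg hg', inv hv hg' hg⟩,
    FrPoint.ext' rfl fun l => congrArg Subtype.val (hg l)⟩

end FrPoint

theorem GrPoint.exists_frPoint {T : Over S} (s : P.GrPoint j T) (t : T.left) :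
    ∃ (U : Over S) (i : U ⟶ T), IsOpenImmersion i.left ∧ t ∈ Set.range i.left ∧
      ∃ e : P.FrPoint j U, e.toGrPoint = s.pullback i := by
  obtain ⟨U, i, hi, ht, v, hv, hs⟩ := s.exists_frame t
  exact ⟨U, i, hi, ht, ⟨s.pullback i, v, hv, fun f y h => hs f y h⟩, rfl⟩

/-- Local coefficients are unique, and remain so after every base change since a frame stays
independent. They therefore agree on overlaps and descend to `T`. This gives the locality axiom for
the sub-bundle spanned by a frame. -/
theorem mem_span_of_local {T : Over S} {x : T ⟶ X} {v : Fin j → P.Sect x} (hv : P.IsFrame v)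
    (u : P.Sect x) (hu : ∀ t : T.left, ∃ (U : Over S) (i : U ⟶ T), IsOpenImmersion i.left ∧
      t ∈ Set.range i.left ∧ P.pull i rfl u ∈
        Submodule.span (Fn U) (Set.range fun l => P.pull i rfl (v l))) :
    u ∈ Submodule.span (Fn T) (Set.range v) := by
  choose U i hi ht hu using hu
  choose c hc using fun t => (Submodule.mem_span_range_iff_exists_fun _).1 (hu t)
  obtain ⟨T', p, l, hp, hl, -, hext, hglue⟩ := IsFppfCover.of_openImmersions U i hi ht
  choose c' hc' using fun m => hglue fun t => c t m
  have h1 : P.pull p rfl u = ∑ m, c' m • P.pull p rfl (v m) := by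
    refine Subtype.ext (hext _ _ fun t => ?_)
    have h2 : P.pull (l t) rfl (P.pull p rfl u) =
        P.pull (l t) rfl (∑ m, c' m • P.pull p rfl (v m)) := by
      simp only [pull_sum, pull_smul, pull_pull, hc']
      have key : ∀ {f : U t ⟶ T} (_ : f = i t) {y : U t ⟶ X} (h : f ≫ x = y),
          P.pull f h u = ∑ m, c t m • P.pull f h (v m) := by
        rintro _ rfl _ rfl
        exact (hc t).symm
      exact key (hl t) _
    exact congrArg Subtype.val h2
  have h3 : ∀ m, ∃ d : Fn T, fnMap p d = c' m := by
    intro m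
    refine hp.exists_fnMap_eq (c' m) fun {T''} a b hab => ?_
    have key : ∀ (f : T'' ⟶ T') {y : T'' ⟶ X} (h : (f ≫ p) ≫ x = y),
        P.pull (f ≫ p) h u = ∑ m, fnMap f (c' m) • P.pull (f ≫ p) h (v m) := by
      rintro f _ rfl
      have h4 := congrArg (P.pull f (Category.assoc _ _ _).symm) h1
      simpa only [pull_sum, pull_smul, pull_pull] using h4
    have key' : ∀ (g : T'' ⟶ T) (_ : a ≫ p = g) (_ : b ≫ p = g),
        ∑ m, fnMap a (c' m) • P.pull g rfl (v m) = ∑ m, fnMap b (c' m) • P.pull g rfl (v m) := by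
      rintro _ rfl h
      rw [← key a rfl]
      have h5 := key b (y := (a ≫ p) ≫ x) (by rw [h])
      simp only [h] at h5
      exact h5
    have h6 := Fintype.linearIndependent_iff.1 (hv (a ≫ p) _ rfl)
      (fun m => fnMap a (c' m) - fnMap b (c' m)) (by
      simp only [sub_smul, Finset.sum_sub_distrib]
      rw [key' _ rfl hab.symm, sub_self]) m
    exact sub_eq_zero.1 h6
  choose d hd using h3
  refine (Submodule.mem_span_range_iff_exists_fun _).2 ⟨d, Subtype.ext ?_⟩
  have := hp.epi
  rw [← cancel_epi p]
  have h7 : P.pull p rfl (∑ m, d m • v m) = P.pull p rfl u := by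
    simp only [pull_sum, pull_smul, hd, h1]
  exact congrArg Subtype.val h7

/-- The sub-bundle spanned by a partial frame. -/
def FrPoint.ofFrame {T : Over S} {x : T ⟶ X} (v : Fin j → P.Sect x) (hv : P.IsFrame v) :
    P.FrPoint j T where
  base := x
  sub {T'} f y h := Submodule.span (Fn T') (Set.range fun l => P.pull f h (v l))
  pull_mem {T'' T'} g f y h z h' u hu := by
    obtain ⟨c, rfl⟩ := (Submodule.mem_span_range_iff_exists_fun _).1 hu
    rw [P.pull_sum]
    refine Submodule.sum_mem _ fun l _ => ?_
    rw [P.pull_smul, P.pull_pull]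
    exact Submodule.smul_mem _ _ (Submodule.subset_span ⟨l, rfl⟩)
  local_mem f y h u hu := by
    refine mem_span_of_local (hv.pull f h) u fun t => ?_
    obtain ⟨U, i, hi, ht, hm⟩ := hu t
    refine ⟨U, i, hi, ht, ?_⟩
    simp only [pull_pull]
    exact hm
  exists_frame t := by
    refine ⟨T, 𝟙 T, ?_, ⟨t, rfl⟩, fun l => P.pull (𝟙 T) rfl (v l), hv.pull _ _, fun f y h => ?_⟩
    · rw [Over.id_left]
      infer_instance
    · simp only [pull_pull]
  frame := v
  isFrame := hv
  span_frame f y h := rfl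

namespace WeightStructure
variable {n : ℕ} {A : GLSchemeAction n X} {w : ℤ} (E : WeightStructure A P w) (hA : A.IsFreePGL)

include hA in
-- On the fibres of `P` the scalar acts as multiplication by a unit, which preserves every
-- submodule.
theorem actGr_scalar {T : Over S} (t : (Fn T)ˣ) (s : P.GrPoint j T) :
    E.actGr (scalarPt n t) s = s := by
  refine GrPoint.ext' (hA.scalar_act t s.base) fun {T'} f y ha hb => ?_
  ext v
  let c : (Fn T')ˣ := (Units.map (fnMap f : Fn T →* Fn T') t)⁻¹
  have h1 : (glMap f (scalarPt n t))⁻¹ = scalarPt n c := by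
    rw [glMap_scalarPt, ← map_inv]
  refine (E.mem_actSub (s := s) ha hb (v' := ((c ^ w : (Fn T')ˣ) : Fn T') • v) ?_).trans ?_
  · rw [h1, E.scalar_act]
  · exact Submodule.smul_mem_iff_of_isUnit _ (Units.isUnit _)

include hA in
-- Here the weight enters: scalars of `GL_n` move frames exactly as scalars of `GL_j` do, through
-- the `w`-th power.
theorem actFr_scalar {T : Over S} (t : (Fn T)ˣ) (s : P.FrPoint j T) :
    E.actFr (scalarPt n t) s = s.changeFrame (scalarPt j (t ^ w)) := by
  refine FrPoint.ext' (E.actGr_scalar hA t s.toGrPoint) fun l => ?_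
  refine (E.scalar_act t s.base (s.frame l)).trans (congrArg Subtype.val ?_)
  exact (scalar_change (M := P.Sect s.base) _ s.frame l).symm

theorem actFr_changeFrame {T : Over S} (g : GL (Fin n) (Fn T)) (h : GL (Fin j) (Fn T))
    (s : P.FrPoint j T) : E.actFr g (s.changeFrame h) = (E.actFr g s).changeFrame h := by
  refine FrPoint.ext' rfl fun l => congrArg Subtype.val ?_
  change E.fibreEquiv g rfl (∑ m, h.1 l m • s.frame m) =
    ∑ m, h.1 l m • E.fibreEquiv g rfl (s.frame m)
  rw [map_sum]
  simp only [map_smul]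

include hA in
-- Freeness on `X` makes `g` a scalar `t`, which multiplies the frame by `t ^ w`; since `GL_j` acts
-- freely on frames, `h` must undo precisely this. The exponent `-w` is the source of the factor in
-- the theorem.
theorem stabilizer_frame {T : Over S} {g : GL (Fin n) (Fn T)} {h : GL (Fin j) (Fn T)}
    {s : P.FrPoint j T} (e : (E.actFr g s).changeFrame h = s) :
    ∃ t : (Fn T)ˣ, g = scalarPt n t ∧ h = scalarPt j (t ^ (-w)) := by
  obtain ⟨t, rfl⟩ := hA.stabilizer g s.base (congrArg (fun a : P.FrPoint j T => a.base) e)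
  refine ⟨t, rfl, ?_⟩
  rw [E.actFr_scalar hA, ← FrPoint.changeFrame_mul] at e
  rw [_root_.zpow_neg]
  exact (eq_inv_of_mul_eq_one_left (FrPoint.eq_one_of_changeFrame e)).trans
    (map_inv (Matrix.GeneralLinearGroup.scalar (Fin j)) _).symm

include hA in
-- An element fixing a sub-bundle fixes the underlying point of `X`.
theorem isFreePGL_grAction (j : ℕ) : (E.grAction (P := P) j).IsFreePGL where
  scalar_act t s := E.actGr_scalar hA t s
  stabilizer g s e := hA.stabilizer g s.base (congrArg (fun a : P.GrPoint j _ => a.base) e)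

end WeightStructure
end VBundle

theorem GLAction.IsFreePGL.ofRepresentable {n : ℕ} {F : (Over S)ᵒᵖ ⥤ Type v} {X : Over S}
    {A : GLAction n F} (hA : A.IsFreePGL) (h : F.RepresentableBy X) :
    (A.ofRepresentable h).IsFreePGL where
  scalar_act t x := by
    change h.homEquiv.symm _ = _
    rw [hA.scalar_act, Equiv.symm_apply_apply]
  stabilizer g x e := hA.stabilizer g (h.homEquiv x) (h.homEquiv.symm_apply_eq.1 e)

end Frames

/-! ### The frame bundle as a torsor over the quotient of the Grassmannian bundle -/

section FrameTorsor
variable {S : Scheme.{u}}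

/-- The group functor `GL_n × GL_j`. -/
def glProdFunctor (S : Scheme.{u}) (n j : ℕ) : GroupFunctor S where
  pts T := GL (Fin n) (Fn T) × GL (Fin j) (Fn T)
  res f := MonoidHom.prodMap (glMap f) (glMap f)

/-- The tautological representation of the first factor. -/
def fstRep (S : Scheme.{u}) (n j : ℕ) : Rep (glProdFunctor S n j) (Fin n) where
  hom {T} := MonoidHom.fst (GL (Fin n) (Fn T)) (GL (Fin j) (Fn T))
  natural _ _ := rfl

/-- The tautological representation of the second factor. -/
def sndRep (S : Scheme.{u}) (n j : ℕ) : Rep (glProdFunctor S n j) (Fin j) where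
  hom {T} := MonoidHom.snd (GL (Fin n) (Fn T)) (GL (Fin j) (Fn T))
  natural _ _ := rfl

namespace VBundle
variable {X : Over S} {r : ℕ} {P : VBundle X r} {j : ℕ} {Gr Fr : Over S}
  (hGr : (P.grassmannian j).RepresentableBy Gr) (hFr : (P.frameBundle j).RepresentableBy Fr)

/-- The sub-bundle given by a point of the Grassmannian bundle. -/
def grPoint {T : Over S} : (T ⟶ Gr) ≃ P.GrPoint j T := hGr.homEquiv

/-- The sub-bundle with a frame given by a point of the frame bundle. -/
def frPoint {T : Over S} : (T ⟶ Fr) ≃ P.FrPoint j T := hFr.homEquiv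

theorem grPoint_comp {T' T : Over S} (f : T' ⟶ T) (x : T ⟶ Gr) :
    grPoint hGr (f ≫ x) = (grPoint hGr x).pullback f := hGr.homEquiv_comp f x

theorem frPoint_comp {T' T : Over S} (f : T' ⟶ T) (x : T ⟶ Fr) :
    frPoint hFr (f ≫ x) = (frPoint hFr x).pullback f := hFr.homEquiv_comp f x

theorem grPoint_base {T : Over S} (x : T ⟶ Gr) : (grPoint hGr x).base = x ≫ grProj hGr := by
  have h1 := grPoint_comp hGr x (𝟙 Gr)
  rw [Category.comp_id] at h1
  rw [h1]
  rfl

theorem grPoint_frProj {T : Over S} (x : T ⟶ Fr) :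
    grPoint hGr (x ≫ frProj hGr hFr) = (frPoint hFr x).toGrPoint := by
  have h1 := frPoint_comp hFr x (𝟙 Fr)
  rw [Category.comp_id] at h1
  rw [h1, grPoint_comp]
  exact congrArg (GrPoint.pullback x) (hGr.homEquiv.apply_symm_apply _)

theorem symm_frProj {T : Over S} (s : P.FrPoint j T) :
    (frPoint hFr).symm s ≫ frProj hGr hFr = (grPoint hGr).symm s.toGrPoint := by
  rw [Equiv.eq_symm_apply, grPoint_frProj, Equiv.apply_symm_apply]

namespace WeightStructure
variable {n : ℕ} {A : GLSchemeAction n X} {w : ℤ} (E : WeightStructure A P w) (hA : A.IsFreePGL)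
  {Q : Over S} {q : Gr ⟶ Q} (hq : ((E.grAction j).ofRepresentable hGr).IsQuotient q)

/-- The action of `GL_n × GL_j` on points of the frame bundle. -/
def pairAct {T : Over S} (g : GL (Fin n) (Fn T) × GL (Fin j) (Fn T)) (x : T ⟶ Fr) : T ⟶ Fr :=
  (frPoint hFr).symm ((E.actFr g.1 (frPoint hFr x)).changeFrame g.2)

theorem frPoint_pairAct {T : Over S} (g : GL (Fin n) (Fn T) × GL (Fin j) (Fn T)) (x : T ⟶ Fr) :
    frPoint hFr (E.pairAct hFr g x) = (E.actFr g.1 (frPoint hFr x)).changeFrame g.2 :=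
  Equiv.apply_symm_apply _ _

theorem pairAct_eq {T : Over S} (g : GL (Fin n) (Fn T)) (h : GL (Fin j) (Fn T)) (x : T ⟶ Fr) :
    E.pairAct hFr (g, h) x = ((P.contravariantAction j).ofRepresentable hFr).act h
      (((E.frAction j).ofRepresentable hFr).act g x) := by
  change _ = (frPoint hFr).symm (FrPoint.changeFrame h
    (frPoint hFr ((frPoint hFr).symm (E.actFr g (frPoint hFr x)))))
  rw [Equiv.apply_symm_apply]
  rfl

theorem pairAct_frProj {T : Over S} (g : GL (Fin n) (Fn T) × GL (Fin j) (Fn T)) (x : T ⟶ Fr) :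
    E.pairAct hFr g x ≫ frProj hGr hFr =
      (show T ⟶ Gr from ((E.grAction j).ofRepresentable hGr).act g.1 (x ≫ frProj hGr hFr)) := by
  refine (grPoint hGr).injective ?_
  rw [grPoint_frProj, frPoint_pairAct]
  refine Eq.trans ?_ (Equiv.apply_symm_apply (grPoint hGr) _).symm
  change E.actGr g.1 (frPoint hFr x).toGrPoint = E.actGr g.1 (grPoint hGr (x ≫ frProj hGr hFr))
  rw [grPoint_frProj]

include hq in
-- Lift to `Gr` on an fppf covering, then choose frames of the sub-bundle on Zariski open sets.
theorem exists_lift_frames {T : Over S} (y : T ⟶ Q) : ∃ (T' : Over S) (p : T' ⟶ T),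
    IsFppfCover p ∧ ∃ x : T' ⟶ Fr, x ≫ frProj hGr hFr ≫ q = p ≫ y := by
  obtain ⟨T', p, hp, x, hx⟩ := hq.lift y
  choose U i hi ht e he using (grPoint hGr x).exists_frPoint
  obtain ⟨T'', p', l, hp', hl, hglue, hext, -⟩ := IsFppfCover.of_openImmersions U i hi ht
  obtain ⟨z, hz⟩ := hglue fun t => (frPoint hFr).symm (e t)
  refine ⟨T'', p' ≫ p, hp'.comp hp, z, ?_⟩
  have h1 : z ≫ frProj hGr hFr = p' ≫ x := by
    refine hext _ _ fun t => ?_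
    rw [← Category.assoc, hz, symm_frProj, he, ← grPoint_comp, Equiv.symm_apply_apply,
      ← Category.assoc, hl]
  rw [← Category.assoc, h1, Category.assoc, hx, Category.assoc]

include hq in
-- The factor `GL_n` makes the sub-bundles equal fppf-locally; then `GL_j` matches the frames.
theorem exists_pairAct {T : Over S} (x x' : T ⟶ Fr)
    (h : x ≫ frProj hGr hFr ≫ q = x' ≫ frProj hGr hFr ≫ q) :
    ∃ (T' : Over S) (p : T' ⟶ T), IsFppfCover p ∧
      ∃ g : GL (Fin n) (Fn T') × GL (Fin j) (Fn T'), E.pairAct hFr g (p ≫ x) = p ≫ x' := by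
  rw [← Category.assoc, ← Category.assoc] at h
  obtain ⟨T', p, hp, g, hg⟩ := hq.transitive _ _ h
  have h1 : (E.actFr g (frPoint hFr (p ≫ x))).toGrPoint = (frPoint hFr (p ≫ x')).toGrPoint := by
    rw [← grPoint_frProj hGr, Category.assoc]
    refine Eq.trans ?_ (congrArg (grPoint hGr) hg)
    refine Eq.trans ?_ (Equiv.apply_symm_apply (grPoint hGr) _).symm
    change E.actGr g (frPoint hFr (p ≫ x)).toGrPoint =
      E.actGr g (grPoint hGr (p ≫ x ≫ frProj hGr hFr))
    rw [← grPoint_frProj hGr, Category.assoc]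
  obtain ⟨h', hh'⟩ := FrPoint.exists_changeFrame _ _ h1
  exact ⟨T', p, hp, (g, h'), (Equiv.symm_apply_eq _).2 hh'⟩

theorem pairAct_one {T : Over S} (x : T ⟶ Fr) : E.pairAct hFr 1 x = x := by
  refine (Equiv.symm_apply_eq _).2 ?_
  refine ((P.contravariantAction j).one_act _).trans ?_
  exact (E.frAction j).one_act (frPoint hFr x)

theorem pairAct_mul {T : Over S} (g h : GL (Fin n) (Fn T) × GL (Fin j) (Fn T)) (x : T ⟶ Fr) :
    E.pairAct hFr (g * h) x = E.pairAct hFr g (E.pairAct hFr h x) := by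
  refine (Equiv.symm_apply_eq _).2 ?_
  rw [frPoint_pairAct, frPoint_pairAct]
  have h1 : E.actFr (g * h).1 (frPoint hFr x) = E.actFr g.1 (E.actFr h.1 (frPoint hFr x)) :=
    (E.frAction j).mul_act _ _ _
  rw [h1, actFr_changeFrame]
  exact FrPoint.changeFrame_mul g.2 h.2 _

theorem comp_pairAct {T' T : Over S} (f : T' ⟶ T) (g : GL (Fin n) (Fn T) × GL (Fin j) (Fn T))
    (x : T ⟶ Fr) :
    f ≫ E.pairAct hFr g x = E.pairAct hFr (glMap f g.1, glMap f g.2) (f ≫ x) := by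
  refine (frPoint hFr).injective ?_
  rw [frPoint_comp, frPoint_pairAct, frPoint_pairAct, frPoint_comp]
  refine ((P.contravariantAction j).map_act f g.2 _).trans ?_
  exact congrArg (FrPoint.changeFrame (glMap f g.2)) ((E.frAction j).map_act f g.1 _)

include hq in
theorem pairAct_invariant {T : Over S} (g : GL (Fin n) (Fn T) × GL (Fin j) (Fn T)) (x : T ⟶ Fr) :
    E.pairAct hFr g x ≫ frProj hGr hFr ≫ q = x ≫ frProj hGr hFr ≫ q := by
  rw [← Category.assoc, pairAct_frProj, ← Category.assoc]
  exact hq.invariant g.1 _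

/-- The frame bundle `Fr`, with the action of `GL_n × GL_j`, over the quotient of `Gr`. -/
def frameAction : QuotientAction (glProdFunctor S n j) (frProj hGr hFr ≫ q) where
  act g x := E.pairAct hFr g x
  one_act x := E.pairAct_one hFr x
  mul_act g h x := E.pairAct_mul hFr g h x
  comp_act f g x := E.comp_pairAct hFr f g x
  invariant g x := E.pairAct_invariant hGr hFr hq g x
  lift y := E.exists_lift_frames hGr hFr hq y
  transitive x x' h := E.exists_pairAct hGr hFr hq x x' h

include hA in
theorem stabilizer_frameAction {T : Over S} {g : GL (Fin n) (Fn T) × GL (Fin j) (Fn T)}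
    {x : T ⟶ Fr} (h : E.pairAct hFr g x = x) :
    ∃ t : (Fn T)ˣ, g.1 = scalarPt n t ∧ g.2 = scalarPt j (t ^ (-w)) :=
  E.stabilizer_frame hA ((Equiv.symm_apply_eq _).1 h)

include hA in
theorem isProjective_fstRep : (E.frameAction hGr hFr hq).IsProjective (fstRep S n j) := by
  intro T g x h
  obtain ⟨t, ht, -⟩ := E.stabilizer_frameAction hFr hA h
  exact ⟨t, ht⟩

include hA in
theorem isProjective_sndRep : (E.frameAction hGr hFr hq).IsProjective (sndRep S n j) := by
  intro T g x h
  obtain ⟨t, -, ht⟩ := E.stabilizer_frameAction hFr hA h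
  exact ⟨_, ht⟩

end WeightStructure
end VBundle

/-! ### Powers of a projective representation -/

section Powers
variable {G : GroupFunctor S} {Z Y : Over S} {π : Z ⟶ Y} {𝒜 : QuotientAction G π} {n : ℕ}
  [Nonempty (Fin n)] {ρ : Rep G (Fin n)} (hρ : 𝒜.IsProjective ρ) [IsIntegral Y.left] {L : Type u}
  [Field L] [Algebra Y.left.functionField L] (z₀ : GenericPt π L)

/-- A projective representation whose central character on stabilisers is the `m`-th power of the
one of `ρ` and whose Brauer class is `m` times the one of `ρ`. -/
structure IsPower (m : ℤ) {ι : Type} [Fintype ι] [DecidableEq ι] [Nonempty ι] (σ : Rep G ι) :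
    Prop where
  isProjective : 𝒜.IsProjective σ
  character : ∀ {T : Over S} (g : G.pts T) (z : T ⟶ Z), 𝒜.act g z = z → ∀ t : (Fn T)ˣ,
    ρ.hom g = Matrix.GeneralLinearGroup.scalar _ t →
      σ.hom g = Matrix.GeneralLinearGroup.scalar _ (t ^ m)
  brauer_eq : isProjective.brauer z₀ = m • hρ.brauer z₀

variable {hρ z₀}

open Kronecker in
theorem kronecker_scalar {R : Type*} [CommRing R] {ι ι' : Type} [Fintype ι] [DecidableEq ι]
    [Fintype ι'] [DecidableEq ι'] (c d : Rˣ) :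
    (Matrix.GeneralLinearGroup.scalar ι c).1 ⊗ₖ (Matrix.GeneralLinearGroup.scalar ι' d).1 =
      (Matrix.GeneralLinearGroup.scalar (ι × ι') (c * d)).1 := by
  ext ⟨a, b⟩ ⟨a', b'⟩
  simp only [QuotientAction.scalar_val, Matrix.kroneckerMap_apply, Matrix.scalar_apply,
    Matrix.diagonal_apply, Prod.mk.injEq, Units.val_mul]
  split_ifs <;> simp_all

theorem Rep.tensor_scalar {ι ι' : Type} [Fintype ι] [DecidableEq ι]
    [Fintype ι'] [DecidableEq ι'] {σ : Rep G ι} {σ' : Rep G ι'} {T : Over S} {g : G.pts T}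
    {c d : (Fn T)ˣ} (hc : σ.hom g = Matrix.GeneralLinearGroup.scalar _ c)
    (hd : σ'.hom g = Matrix.GeneralLinearGroup.scalar _ d) :
    (σ.tensor σ').hom g = Matrix.GeneralLinearGroup.scalar _ (c * d) := by
  refine Units.ext ?_
  rw [Rep.tensor_hom, hc, hd, kronecker_scalar]

theorem Rep.dual_scalar {ι : Type} [Fintype ι] [DecidableEq ι] {σ : Rep G ι} {T : Over S}
    {g : G.pts T} {c : (Fn T)ˣ} (hc : σ.hom g = Matrix.GeneralLinearGroup.scalar _ c) :
    σ.dual.hom g = Matrix.GeneralLinearGroup.scalar _ c⁻¹ := by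
  refine Units.ext ?_
  rw [Rep.dual_hom, map_inv, hc, ← map_inv, QuotientAction.scalar_val, Matrix.scalar_apply,
    Matrix.diagonal_transpose]

theorem IsPower.tensor {m m' : ℤ} {ι ι' : Type} [Fintype ι] [DecidableEq ι] [Nonempty ι]
    [Fintype ι'] [DecidableEq ι'] [Nonempty ι'] {σ : Rep G ι} {σ' : Rep G ι'}
    (h : IsPower hρ z₀ m σ) (h' : IsPower hρ z₀ m' σ') :
    IsPower hρ z₀ (m + m') (σ.tensor σ') where
  isProjective := h.isProjective.tensor h'.isProjective
  character g z hg t ht := by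
    rw [_root_.zpow_add]
    exact Rep.tensor_scalar (h.character g z hg t ht) (h'.character g z hg t ht)
  brauer_eq := by
    rw [QuotientAction.IsProjective.brauer_tensor z₀ h.isProjective h'.isProjective, h.brauer_eq,
      h'.brauer_eq, add_zsmul]

theorem IsPower.one : IsPower hρ z₀ 1 ρ where
  isProjective := hρ
  character g z hg t ht := by rw [ht, _root_.zpow_one]
  brauer_eq := (one_zsmul _).symm

theorem IsPower.neg_one : IsPower hρ z₀ (-1) ρ.dual where
  isProjective := hρ.dual
  character g z hg t ht := by
    rw [Rep.dual_scalar ht, _root_.zpow_neg_one]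
  brauer_eq := by rw [QuotientAction.IsProjective.brauer_dual, neg_one_zsmul]

/-- The trivial representation. -/
def trivialRep (G : GroupFunctor S) : Rep G Unit where
  hom := 1
  natural _ _ := (Matrix.map_one _ (map_zero _) (map_one _)).symm

theorem IsPower.zero : IsPower hρ z₀ 0 (trivialRep G) := by
  have h1 : 𝒜.IsHonest (trivialRep G) := fun _ _ _ _ => rfl
  refine ⟨h1.isProjective, fun g z hg t ht => ?_, ?_⟩
  · rw [_root_.zpow_zero, map_one]
    rfl
  · rw [h1.brauer_eq_zero, zero_zsmul]

variable (hρ z₀)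

/-- Tensor powers of `ρ` or of its dual, starting from the trivial representation. Only the
character and the class matter, so the index type is left unspecified. -/
theorem exists_isPower (m : ℤ) : ∃ (ι : Type) (_ : Fintype ι) (_ : DecidableEq ι)
    (_ : Nonempty ι) (σ : Rep G ι), IsPower hρ z₀ m σ := by
  induction m with
  | zero => exact ⟨Unit, _, _, inferInstance, _, IsPower.zero⟩
  | succ m ih =>
    obtain ⟨ι, _, _, _, σ, h⟩ := ih
    exact ⟨_, _, _, inferInstance, _, h.tensor IsPower.one⟩
  | pred m ih =>
    obtain ⟨ι, _, _, _, σ, h⟩ := ih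
    exact ⟨_, _, _, inferInstance, _, h.tensor IsPower.neg_one⟩

variable {hρ}

/-- The Brauer class of a projective representation only depends on the characters by which
stabilisers act. -/
theorem brauer_eq_zsmul {m : ℤ} {ι : Type} [Fintype ι] [DecidableEq ι] [Nonempty ι] {τ : Rep G ι}
    (hτ : 𝒜.IsProjective τ) (h : ∀ {T : Over S} (g : G.pts T) (z : T ⟶ Z), 𝒜.act g z = z →
      ∃ t : (Fn T)ˣ, ρ.hom g = Matrix.GeneralLinearGroup.scalar _ t ∧
        τ.hom g = Matrix.GeneralLinearGroup.scalar _ (t ^ m)) :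
    hτ.brauer z₀ = m • hρ.brauer z₀ := by
  -- The representation `σ` has the character inverse to that of `τ` on stabilisers, so `τ.tensor σ`
  -- is honest and its class vanishes.
  obtain ⟨ι', _, _, _, σ, hσ⟩ := exists_isPower hρ z₀ (-m)
  have h1 : 𝒜.IsHonest (τ.tensor σ) := by
    intro T g z hg
    obtain ⟨t, ht, ht'⟩ := h g z hg
    rw [Rep.tensor_scalar ht' (hσ.character g z hg t ht), ← _root_.zpow_add, add_neg_cancel,
      _root_.zpow_zero, map_one]
  have h2 := h1.brauer_eq_zero z₀
  have h3 := hτ.brauer_tensor z₀ hσ.isProjective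
  rw [hσ.brauer_eq] at h3
  have h4 := h3.symm.trans h2
  rw [neg_zsmul] at h4
  exact add_neg_eq_zero.1 h4

end Powers

end FrameTorsor

/-! ### The quotients of the frame bundles -/

section FrameQuotients
open TwistedGrassmannian.Brauer

variable {S : Scheme.{u}}

/-- Points over the generic point exist over some field. -/
theorem QuotientAction.exists_genericPt {G : GroupFunctor S} {Z Y : Over S} {π : Z ⟶ Y}
    (𝒜 : QuotientAction G π) [IsIntegral Y.left] :
    ∃ (L : Type u) (_ : Field L) (_ : Algebra Y.left.functionField L), Nonempty (GenericPt π L) := by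
  let y : Over.mk (Y.left.fromSpecStalk (genericPoint Y.left) ≫ Y.hom) ⟶ Y :=
    Over.homMk (Y.left.fromSpecStalk (genericPoint Y.left)) rfl
  -- The generic point of `Y` lifts to `Z` only on a covering `T`; the field `L` is the residue
  -- field of a point of `T`.
  obtain ⟨T, p, hp, x, hx⟩ := 𝒜.lift y
  obtain ⟨s⟩ : Nonempty (Spec Y.left.functionField) :=
    inferInstanceAs (Nonempty (PrimeSpectrum Y.left.functionField))
  obtain ⟨t, -⟩ := hp.surj.surj s
  let f : Spec (T.left.residueField t) ⟶ Spec Y.left.functionField :=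
    T.left.fromSpecResidueField t ≫ p.left
  have h1 : x.left ≫ π.left = p.left ≫ Y.left.fromSpecStalk (genericPoint Y.left) :=
    congrArg (fun m => m.left) hx
  let _ : Algebra Y.left.functionField (T.left.residueField t) := (Spec.preimage f).hom.toAlgebra
  let z : GenericPt π (T.left.residueField t) :=
    { pt := T.left.fromSpecResidueField t ≫ x.left
      w := by
        rw [Category.assoc, h1, ← Category.assoc]
        exact congrArg (· ≫ _) (Spec.map_preimage f).symm }
  exact ⟨T.left.residueField t, inferInstance, inferInstance, ⟨z⟩⟩

/-- The class of a torsor is the class of the generic fibre of the bundle of matrix algebras. -/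
theorem brauer_eq_classOf {Z Y Z' : Over S} {π : Z ⟶ Y} {π' : Z' ⟶ Y} {ψ : Z ⟶ Z'}
    [IsIntegral Y.left] [IsIntegral Z'.left]
    {G : GroupFunctor S} {𝒜 : QuotientAction G π} {n : ℕ} [Nonempty (Fin n)]
    {ρ : Rep G (Fin n)} (hρ : 𝒜.IsProjective ρ) {L : Type u} [Field L]
    [Algebra Y.left.functionField L] (z₀ : GenericPt π L)
    {A' : GLSchemeAction n Z'} (h' : A'.IsQuotient π')
    (hs : ∀ {T : Over S} (g : GL (Fin n) (Fn T)) (x : T ⟶ Z'), A'.act g x = x →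
      ∃ t : (Fn T)ˣ, g = scalarPt n t)
    (csa : IsCSA (A'.genericAlgebra π' h'.isInvariant)) (hψ : ψ ≫ π' = π)
    (hact : ∀ {T : Over S} (g : G.pts T) (z : T ⟶ Z),
      𝒜.act g z ≫ ψ = (show T ⟶ Z' from A'.act (ρ.hom g) (z ≫ ψ))) :
    hρ.brauer z₀ = classOf _ csa := by
  have : IsDominant (𝟙 Y : Y ⟶ Y).left := inferInstanceAs (IsDominant (𝟙 Y.left))
  have h1 := brauer_eq_pullback hρ z₀ h' hs csa (φ := 𝟙 Y) (hψ.trans (Category.comp_id π).symm) hact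
  have h2 : functionFieldMap (𝟙 Y : Y ⟶ Y).left = RingHom.id _ := functionFieldMap_id Y.left
  rw [h1, h2, pullback_id]

/-! ### Twisting by the inverse transpose -/

section Twist

theorem invTranspose_invTranspose {R : Type*} [CommRing R] {j : ℕ} (g : GL (Fin j) R) :
    invTranspose (invTranspose g) = g := Units.ext (Matrix.transpose_transpose _)

theorem invTranspose_scalar {R : Type*} [CommRing R] {j : ℕ} (t : Rˣ) :
    invTranspose (Matrix.GeneralLinearGroup.scalar (Fin j) t) =
      Matrix.GeneralLinearGroup.scalar (Fin j) t⁻¹ := by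
  refine Units.ext ?_
  change ((Matrix.GeneralLinearGroup.scalar (Fin j) t)⁻¹).1ᵀ = _
  rw [← map_inv, QuotientAction.scalar_val, Matrix.scalar_apply, Matrix.diagonal_transpose]

/-- The twist of an action of `GL_j` by the inverse transpose. -/
def GLAction.twist {j : ℕ} {F : (Over S)ᵒᵖ ⥤ Type v} (A : GLAction j F) : GLAction j F where
  act g x := A.act (invTranspose g) x
  one_act x := by
    rw [show ∀ {R : Type u} [CommRing R], invTranspose (1 : GL (Fin j) R) = 1 from
      Units.ext (by simp [invTranspose])]
    exact A.one_act x
  mul_act g h x := by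
    rw [show invTranspose (g * h) = invTranspose g * invTranspose h from
      Units.ext (by simp [invTranspose, Matrix.transpose_mul])]
    exact A.mul_act _ _ x
  map_act f g x := A.map_act f (invTranspose g) x

variable {j : ℕ} {X Y : Over S} {A : GLSchemeAction j X} {π : X ⟶ Y}

theorem GLAction.act_eq_twist {T : Over S} (g : GL (Fin j) (Fn T)) (x : T ⟶ X) :
    A.act g x = A.twist.act (invTranspose g) x := by
  change _ = A.act (invTranspose (invTranspose g)) x
  rw [invTranspose_invTranspose]

theorem GLAction.stabilizer_of_twist
    (hs : ∀ {T : Over S} (g : GL (Fin j) (Fn T)) (x : T ⟶ X), A.twist.act g x = x →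
      ∃ t : (Fn T)ˣ, g = scalarPt j t) {T : Over S} (g : GL (Fin j) (Fn T)) (x : T ⟶ X)
    (h : A.act g x = x) : ∃ t : (Fn T)ˣ, g = scalarPt j t := by
  rw [GLAction.act_eq_twist] at h
  obtain ⟨t, ht⟩ := hs _ x h
  refine ⟨t⁻¹, ?_⟩
  rw [← invTranspose_invTranspose g, ht, invTranspose_scalar]

theorem GLAction.isFreePGL_of_twist (h : A.twist.IsFreePGL) : A.IsFreePGL where
  scalar_act t x := by
    refine (GLAction.act_eq_twist _ _).trans ?_
    rw [invTranspose_scalar]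
    exact h.scalar_act _ _
  stabilizer g x := GLAction.stabilizer_of_twist h.stabilizer g x

theorem GLAction.isQuotient_of_twist (h : A.twist.IsQuotient π) : A.IsQuotient π where
  invariant g x := by
    rw [GLAction.act_eq_twist]
    exact h.invariant _ _
  lift := h.lift
  transitive x x' e := by
    obtain ⟨T', p, hp, g, hg⟩ := h.transitive x x' e
    exact ⟨T', p, hp, _, hg⟩

/-- Seen from the twisted action, the original one corresponds to the dual of the standard
representation, so `brauer_dual` gives the sign. -/
theorem classOf_twist [IsIntegral X.left] [IsIntegral Y.left] (hj : 0 < j)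
    (ht : A.twist.IsQuotient π) (h : A.IsQuotient π)
    (hs : ∀ {T : Over S} (g : GL (Fin j) (Fn T)) (x : T ⟶ X), A.twist.act g x = x →
      ∃ t : (Fn T)ˣ, g = scalarPt j t)
    (csat : IsCSA (A.twist.genericAlgebra π ht.isInvariant))
    (csa : IsCSA (A.genericAlgebra π h.isInvariant)) :
    classOf _ csa = - classOf _ csat := by
  have : Nonempty (Fin j) := ⟨⟨0, hj⟩⟩
  obtain ⟨L, _, _, ⟨z₀⟩⟩ := ht.quotientAction.exists_genericPt
  have h1 := ht.isProjective hs
  rw [← brauer_eq_classOf h1 z₀ ht hs csat (Category.id_comp π) (fun g z => by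
    rw [Category.comp_id, Category.comp_id]
    rfl), ← h1.brauer_dual]
  refine (brauer_eq_classOf h1.dual z₀ h (GLAction.stabilizer_of_twist hs) csa
    (Category.id_comp π) (fun g z => ?_)).symm
  rw [Category.comp_id, Category.comp_id]
  exact congrArg (fun a => A.act a z) (Units.ext rfl)

end Twist

/-- Being scalar is an identity between matrix entries, which can be checked on a covering. The
scalar is read off from a diagonal entry of `h`, and its inverse from that of `h⁻¹`; this uses `0 <
j`. -/
theorem exists_scalarPt_of_glMap {j : ℕ} (hj : 0 < j) {T' T : Over S} {p : T' ⟶ T}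
    (hp : IsFppfCover p) (h : GL (Fin j) (Fn T)) (c : (Fn T')ˣ) (e : glMap p h = scalarPt j c) :
    ∃ t : (Fn T)ˣ, h = scalarPt j t := by
  let i : Fin j := ⟨0, hj⟩
  have key : ∀ (h : GL (Fin j) (Fn T)) (c : (Fn T')ˣ), glMap p h = scalarPt j c → ∀ a b,
      fnMap p (h.1 a b) = if a = b then (c : Fn T') else 0 := by
    intro h c e a b
    have h1 := congrArg (fun M : GL (Fin j) (Fn T') => M.1 a b) e
    refine h1.trans ?_
    change Matrix.scalar (Fin j) (c : Fn T') a b = _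
    rw [Matrix.scalar_apply, Matrix.diagonal_apply]
  have e' : glMap p h⁻¹ = scalarPt j c⁻¹ := by
    rw [map_inv, e]
    exact (map_inv (Matrix.GeneralLinearGroup.scalar (Fin j)) c).symm
  have h1 := key h c e
  have h2 := key h⁻¹ c⁻¹ e'
  refine ⟨⟨h.1 i i, (h⁻¹).1 i i, hp.fnMap_injective ?_, hp.fnMap_injective ?_⟩, ?_⟩
  · rw [map_mul, h1, h2, map_one, if_pos rfl, if_pos rfl, Units.mul_inv]
  · rw [map_mul, h1, h2, map_one, if_pos rfl, if_pos rfl, Units.inv_mul]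
  · refine Units.ext (Matrix.ext fun a b => hp.fnMap_injective ?_)
    change _ = fnMap p (Matrix.scalar (Fin j) (h.1 i i) a b)
    rw [h1, Matrix.scalar_apply, Matrix.diagonal_apply]
    split_ifs
    · rw [h1, if_pos rfl]
    · rw [map_zero]

namespace VBundle
namespace FrameQuotient
variable {X : Over S} {r : ℕ} {P : VBundle X r} {j : ℕ} {Gr Q : Over S}
  {hGr : (P.grassmannian j).RepresentableBy Gr} {n : ℕ} {A : GLSchemeAction n X} {w : ℤ}
  {E : WeightStructure A P w} {q : Gr ⟶ Q}

/-- The twist of a covariant frame quotient by the inverse transpose. -/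
def twist (F : FrameQuotient E (P.covariantAction j) hGr q) :
    FrameQuotient E (P.contravariantAction j) hGr q where
  frames := F.frames
  represents := F.represents
  quot := F.quot
  isVariety := F.isVariety
  quotMap := F.quotMap
  isQuotient := F.isQuotient
  action := F.action.twist
  quotMap_act {T} h e := by
    refine (F.quotMap_act (invTranspose h) e).trans ?_
    refine congrArg (· ≫ F.quotMap) ?_
    change F.represents.homEquiv.symm (FrPoint.changeFrame (invTranspose (invTranspose h)) _) = _
    rw [invTranspose_invTranspose]
    rfl
  toQuot := F.toQuot
  quotMap_toQuot := F.quotMap_toQuot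

variable (F : FrameQuotient E (P.contravariantAction j) hGr q) (hA : A.IsFreePGL)
  (hq : ((E.grAction j).ofRepresentable hGr).IsQuotient q)

theorem pairAct_quotMap {T : Over S} (g : GL (Fin n) (Fn T) × GL (Fin j) (Fn T))
    (x : T ⟶ F.frames) : E.pairAct F.represents g x ≫ F.quotMap =
      (show T ⟶ F.quot from F.action.act g.2 (x ≫ F.quotMap)) := by
  refine (congrArg (· ≫ F.quotMap) (E.pairAct_eq F.represents g.1 g.2 x)).trans ?_
  refine (F.quotMap_act g.2 _).symm.trans ?_
  exact congrArg (fun y => F.action.act g.2 y) (F.isQuotient.invariant g.1 x)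

include hq in
-- All three properties are checked on lifts to the frame bundle, whose quotient by `GL_n × GL_j` is
-- `Q`; the factor `GL_n` becomes invisible in `F.quot`.
theorem isQuotient_toQuot : F.action.IsQuotient F.toQuot where
  invariant {T} g x := by
    obtain ⟨T', p, hp, e, he⟩ := F.isQuotient.lift x
    have := hp.epi
    rw [← cancel_epi p, ← Category.assoc, ← Category.assoc, GLAction.comp_act, ← he]
    have h1 := F.pairAct_quotMap (1, glMap p g) e
    refine (congrArg (· ≫ F.toQuot) h1.symm).trans ?_
    rw [Category.assoc, Category.assoc, F.quotMap_toQuot]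
    exact E.pairAct_invariant hGr F.represents hq _ e
  lift {T} y := by
    obtain ⟨T', p, hp, x, hx⟩ := E.exists_lift_frames hGr F.represents hq y
    exact ⟨T', p, hp, x ≫ F.quotMap, by rw [Category.assoc, F.quotMap_toQuot, hx]⟩
  transitive {T} x x' h := by
    obtain ⟨T₁, p₁, hp₁, e, he⟩ := F.isQuotient.lift x
    obtain ⟨T₂, p₂, hp₂, e', he'⟩ := F.isQuotient.lift (p₁ ≫ x')
    obtain ⟨T₃, p₃, hp₃, g, hg⟩ := E.exists_pairAct hGr F.represents hq (p₂ ≫ e) e' (by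
      rw [← F.quotMap_toQuot, Category.assoc, reassoc_of% he, reassoc_of% he', h])
    refine ⟨T₃, p₃ ≫ p₂ ≫ p₁, hp₃.comp (hp₂.comp hp₁), g.2, ?_⟩
    have h1 := F.pairAct_quotMap g (p₃ ≫ p₂ ≫ e)
    rw [hg] at h1
    simp only [Category.assoc, he, he'] at h1 ⊢
    exact h1.symm

include hA in
-- If `h` fixes the image of a frame `e`, then fppf-locally some pair `(g, h)` fixes `e` itself, and
-- `stabilizer_frameAction` makes `h` scalar. This holds also for weight zero.
theorem stabilizer_action (hj : 0 < j) {T : Over S} (h : GL (Fin j) (Fn T)) (x : T ⟶ F.quot)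
    (hx : F.action.act h x = x) : ∃ t : (Fn T)ˣ, h = scalarPt j t := by
  obtain ⟨T', p, hp, e, he⟩ := F.isQuotient.lift x
  have h1 : E.pairAct F.represents (1, glMap p h) e ≫ F.quotMap = e ≫ F.quotMap := by
    rw [pairAct_quotMap, he]
    exact (GLAction.comp_act _ p h x).symm.trans (congrArg (p ≫ ·) hx)
  obtain ⟨T'', p', hp', g, hg⟩ := F.isQuotient.transitive _ _ h1
  have h2 : ∀ (y : T'' ⟶ F.frames), E.pairAct F.represents (g, 1) y =
      ((E.frAction j).ofRepresentable F.represents).act g y := fun y =>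
    (E.pairAct_eq F.represents g 1 y).trans (GLAction.one_act _ _)
  have h3 : E.pairAct F.represents (g, glMap p' (glMap p h)) (p' ≫ e) = p' ≫ e := by
    refine Eq.trans ?_ hg
    rw [← h2, E.comp_pairAct, ← E.pairAct_mul]
    simp
  obtain ⟨t, -, ht⟩ := E.stabilizer_frameAction F.represents hA h3
  exact exists_scalarPt_of_glMap hj (hp'.comp hp) h _ ((glMap_comp _ _ _).trans ht)

include hA in
-- Scalars of `GL_j` act trivially because, on a covering, they act on frames as scalars of `GL_n`,
-- which are divided out. This requires a `w`-th root and fails to make sense for `w = 0`.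
theorem isFreePGL_action (hj : 0 < j) (hw : w ≠ 0) : F.action.IsFreePGL where
  stabilizer h x hx := F.stabilizer_action hA hj h x hx
  scalar_act {T} t x := by
    obtain ⟨T', p, hp, e, he⟩ := F.isQuotient.lift x
    -- A root of order `|w|` is taken, and replaced by its inverse when `w` is negative.
    obtain ⟨T'', p', hp', s, hs⟩ := IsFppfCover.exists_root
      (Units.map (fnMap p : Fn T →* Fn T') t) (Int.natAbs_ne_zero.2 hw)
    have h1 : ∃ s' : (Fn T'')ˣ, s' ^ w = Units.map (fnMap (p' ≫ p) : Fn T →* Fn T'') t := by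
      rcases Int.natAbs_eq w with h | h
      · exact ⟨s, by rw [h, _root_.zpow_natCast, hs]; rfl⟩
      · refine ⟨s⁻¹, ?_⟩
        rw [h, _root_.inv_zpow, _root_.zpow_neg, inv_inv, _root_.zpow_natCast, hs]
        rfl
    obtain ⟨s', hs'⟩ := h1
    have h2 : E.pairAct F.represents (1, glMap (p' ≫ p) (scalarPt j t)) (p' ≫ e) =
        E.pairAct F.represents (scalarPt n s', 1) (p' ≫ e) := by
      refine congrArg (frPoint F.represents).symm ?_
      refine (congrArg (FrPoint.changeFrame _) ((E.frAction j).one_act _)).trans ?_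
      refine Eq.trans ?_ ((P.contravariantAction j).one_act _).symm
      refine Eq.trans ?_ (E.actFr_scalar hA s' _).symm
      rw [hs', glMap_scalarPt]
    have h3 := congrArg (· ≫ F.quotMap) h2
    simp only [pairAct_quotMap, Category.assoc, he] at h3
    have := (hp'.comp hp).epi
    rw [← cancel_epi (p' ≫ p)]
    refine (GLAction.comp_act F.action (p' ≫ p) _ x).trans ?_
    rw [Category.assoc]
    exact h3.trans (F.action.one_act _)

include hA hq in
-- Both classes are computed on the frame bundle over `Q`, from the two projections of `GL_n ×
-- GL_j`. The stabilisers act by `t` in the first and by `t ^ (-w)` in the second, so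
-- `brauer_eq_zsmul` compares them.
theorem classOf_eq [IsIntegral Gr.left] [IsIntegral Q.left] (hn : 0 < n) (hj : 0 < j)
    (csaGr : IsCSA (((E.grAction j).ofRepresentable hGr).genericAlgebra q hq.isInvariant))
    (csa : IsCSA (F.action.genericAlgebra F.toQuot (F.isQuotient_toQuot hq).isInvariant)) :
    classOf _ csa = (-w) • classOf _ csaGr := by
  have : Nonempty (Fin n) := ⟨⟨0, hn⟩⟩
  have : Nonempty (Fin j) := ⟨⟨0, hj⟩⟩
  let 𝒜 := E.frameAction hGr F.represents hq
  obtain ⟨L, _, _, ⟨z₀⟩⟩ := 𝒜.exists_genericPt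
  have h1 := E.isProjective_fstRep hGr F.represents hA hq
  have h2 := E.isProjective_sndRep hGr F.represents hA hq
  have h3 : h1.brauer z₀ = classOf _ csaGr := brauer_eq_classOf h1 z₀ hq
    ((E.isFreePGL_grAction hA j).ofRepresentable hGr).stabilizer csaGr rfl
    fun g z => E.pairAct_frProj hGr F.represents g z
  have h4 : h2.brauer z₀ = classOf _ csa := brauer_eq_classOf h2 z₀ (F.isQuotient_toQuot hq)
    (F.stabilizer_action hA hj) csa F.quotMap_toQuot fun g z => F.pairAct_quotMap g z
  rw [← h3, ← h4]
  exact brauer_eq_zsmul z₀ h2 fun g z hg => E.stabilizer_frameAction F.represents hA hg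

end FrameQuotient

end VBundle
end FrameQuotients

/-! ### The main results on the Grassmannian bundle -/

section Grassmannian
open TwistedGrassmannian.Brauer

variable {S : Scheme.{u}}

theorem GLAction.IsQuotient.surjective {n : ℕ} {X Y : Over S} {A : GLSchemeAction n X}
    {π : X ⟶ Y} (h : A.IsQuotient π) : Surjective π.left := by
  obtain ⟨T', p, hp, x, hx⟩ := h.lift (𝟙 Y)
  have h2 : x.left ≫ π.left = p.left := by
    rw [← Over.comp_left, hx]; simp
  have : Surjective (x.left ≫ π.left) := h2 ▸ hp.surj
  exact Surjective.of_comp x.left π.left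

namespace VBundle
variable {X : Over S} {r : ℕ} {P : VBundle X r} {j : ℕ} {Gr : Over S}
  (hGr : (P.grassmannian j).RepresentableBy Gr)

/-- The first `j` sections of a local basis of `P` span a sub-bundle, which gives a local section of
the projection. -/
theorem surjective_grProj (hjr : j ≤ r) : Surjective (grProj hGr).left := by
  refine ⟨fun p => ?_⟩
  obtain ⟨U, i, -, ⟨u, rfl⟩, e, he⟩ := P.locally_free p
  have hv : P.IsFrame fun l : Fin j => (e (Fin.castLE hjr l) : P.Sect i) := by
    intro T f y h
    subst h
    exact (he f (fun l => P.pull f rfl (e l)) fun l => rfl).1.comp _ (Fin.castLE_injective hjr)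
  let s : U ⟶ Gr := (grPoint hGr).symm (FrPoint.ofFrame _ hv).toGrPoint
  have hs : s ≫ grProj hGr = i := by
    rw [← grPoint_base, Equiv.apply_symm_apply]
    rfl
  exact ⟨s.left u, congrArg (fun m : U ⟶ X => m.left u) hs⟩

variable {n : ℕ} {A : GLSchemeAction n X} {w : ℤ} (E : WeightStructure A P w)

theorem WeightStructure.actGr_grProj {T : Over S} (g : GL (Fin n) (Fn T)) (x : T ⟶ Gr) :
    (show T ⟶ Gr from ((E.grAction j).ofRepresentable hGr).act g x) ≫ grProj hGr =
      (show T ⟶ X from A.act g (x ≫ grProj hGr)) := by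
  rw [← grPoint_base, ← grPoint_base]
  exact congrArg GrPoint.base (hGr.homEquiv.apply_symm_apply _)

variable {Y Q : Over S} {π : X ⟶ Y} {q : Gr ⟶ Q} {φ : Q ⟶ Y}

theorem surjective_of_grProj (hπ : A.IsQuotient π) (hjr : j ≤ r)
    (hφ : q ≫ φ = grProj hGr ≫ π) : Surjective φ.left := by
  have := hπ.surjective
  have := surjective_grProj hGr hjr
  have h1 : q.left ≫ φ.left = (grProj hGr).left ≫ π.left := congrArg (fun m => m.left) hφ
  have : Surjective (q.left ≫ φ.left) := h1 ▸ inferInstance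
  exact Surjective.of_comp q.left φ.left

/-- The class of the Grassmannian bundle is the pullback of the class of its base. -/
theorem classOf_grassmannian [IsIntegral X.left] [IsIntegral Y.left] [IsIntegral Gr.left]
    [IsIntegral Q.left] (hn : 0 < n) (hπ : A.IsPGLBundle π)
    (hq : ((E.grAction j).ofRepresentable hGr).IsQuotient q)
    (hφ : q ≫ φ = grProj hGr ≫ π) [IsDominant φ.left]
    (csaX : IsCSA (A.genericAlgebra π hπ.isQuotient.isInvariant))
    (csaGr : IsCSA (((E.grAction j).ofRepresentable hGr).genericAlgebra q hq.isInvariant)) :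
    classOf _ csaGr = pullback (functionFieldMap φ.left) (classOf _ csaX) := by
  have : Nonempty (Fin n) := ⟨⟨0, hn⟩⟩
  have hs := fun {T : Over S} =>
    ((E.isFreePGL_grAction hπ.isFree j).ofRepresentable hGr).stabilizer (T := T)
  obtain ⟨L, _, _, ⟨z₀⟩⟩ := hq.quotientAction.exists_genericPt
  have hρ := hq.isProjective hs
  -- Both sides are the class of the standard representation on `q`, compared once with `X` along
  -- the projection and once with `Gr` itself.
  rw [← brauer_eq_pullback hρ z₀ hπ.isQuotient hπ.isFree.stabilizer csaX hφ.symm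
    fun g z => E.actGr_grProj hGr g z]
  refine (brauer_eq_classOf hρ z₀ hq hs csaGr (Category.id_comp q) fun g z => ?_).symm
  rw [Category.comp_id, Category.comp_id]
  rfl

end VBundle

end Grassmannian

end TwistedGrassmannian

end

/-! ### The main theorem -/

theorem mainTheorem7 {k : Type u} [Field k] [IsAlgClosed k] {n : ℕ} (hn : 0 < n)
    {X Y : Over (Spec (CommRingCat.of k))} [IsVariety X] [IsVariety Y]
    (A : GLSchemeAction n X) (π : X ⟶ Y) (hπ : A.IsPGLBundle π)
    {r : ℕ} (P : VBundle X r) (w : ℤ) (E : VBundle.WeightStructure A P w)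
    {j : ℕ} (hj : 0 < j) (hjr : j < r)
    {Gr Q : Over (Spec (CommRingCat.of k))} [IsVariety Gr] [IsVariety Q]
    (hGr : (P.grassmannian j).RepresentableBy Gr) (q : Gr ⟶ Q)
    (hq : ((E.grAction j).ofRepresentable hGr).IsQuotient q)
    (φ : Q ⟶ Y) (hφ : q ≫ φ = VBundle.grProj hGr ≫ π)
    (F : VBundle.FrameQuotient E (P.covariantAction j) hGr q)
    (F' : VBundle.FrameQuotient E (P.contravariantAction j) hGr q) :
    ((E.grAction j).ofRepresentable hGr).IsFreePGL ∧
    (w ≠ 0 → F.action.IsFreePGL ∧ F'.action.IsFreePGL) ∧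
    ∃ (_ : IsDominant φ.left)
      (hF : F.action.IsQuotient F.toQuot) (hF' : F'.action.IsQuotient F'.toQuot)
      (csaX : Brauer.IsCSA (A.genericAlgebra π hπ.isQuotient.isInvariant))
      (csaGr : Brauer.IsCSA
        (((E.grAction j).ofRepresentable hGr).genericAlgebra q hq.isInvariant))
      (csaF : Brauer.IsCSA (F.action.genericAlgebra F.toQuot hF.isInvariant))
      (csaF' : Brauer.IsCSA (F'.action.genericAlgebra F'.toQuot hF'.isInvariant)),
      Brauer.classOf _ csaGr =
          Brauer.pullback (functionFieldMap φ.left) (Brauer.classOf _ csaX) ∧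
        Brauer.classOf _ csaF = w • Brauer.classOf _ csaGr ∧
        Brauer.classOf _ csaF' = (-w) • Brauer.classOf _ csaGr := by
  have hA := hπ.isFree
  have hGrFree := (E.isFreePGL_grAction hA j).ofRepresentable hGr
  -- The covariant action is treated through its twist by the inverse transpose, which is an
  -- instance of the contravariant case.
  have hF : F.action.IsQuotient F.toQuot := GLAction.isQuotient_of_twist (F.twist.isQuotient_toQuot hq)
  have hF' := F'.isQuotient_toQuot hq
  have hφs := VBundle.surjective_of_grProj hGr hπ.isQuotient hjr.le hφ
  have hφd : IsDominant φ.left := inferInstance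
  have csaX := hπ.isQuotient.isCSA hA.stabilizer hn
  have csaGr := hq.isCSA hGrFree.stabilizer hn
  have csaT := (F.twist.isQuotient_toQuot hq).isCSA (F.twist.stabilizer_action hA hj) hj
  have csaF := hF.isCSA (GLAction.stabilizer_of_twist (F.twist.stabilizer_action hA hj)) hj
  have csaF' := hF'.isCSA (F'.stabilizer_action hA hj) hj
  refine ⟨hGrFree, fun hw => ⟨GLAction.isFreePGL_of_twist (F.twist.isFreePGL_action hA hj hw),
    F'.isFreePGL_action hA hj hw⟩, hφd, hF, hF', csaX, csaGr, csaF, csaF',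
    VBundle.classOf_grassmannian hGr E hn hπ hq hφ csaX csaGr, ?_,
    F'.classOf_eq hA hq hn hj csaGr csaF'⟩
  -- The contravariant formula for the twist gives `-w`, and undoing the twist changes the sign to
  -- `w`.
  refine (classOf_twist hj (F.twist.isQuotient_toQuot hq) hF (F.twist.stabilizer_action hA hj) csaT
    csaF).trans ?_
  refine (congrArg _ (F.twist.classOf_eq hA hq hn hj csaGr csaT)).trans ?_
  rw [neg_smul, neg_neg]
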